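/- For a nonzero integer $n$ let $T_{2n}$ be the twist knot with two left-handed vertical crossings (the clasp) and $2n$ right-handed horizontal crossings ($-2n$ left-handed ones if $n<0$); so $T_2$ is the figure-eight knot and $T_{-2}$ is the right-handed trefoil. Fix the standard meridian $\mu$ and longitude $\lambda$ of $T_{2n}$. Consider all pairs $(L,M)\in\mathbb C^2$ for which some representation $\rho$ of the knot group in $SL(2,\mathbb C)$ sends $\mu$ and $\lambda$ to upper triangular matrices with upper left entries $M$ and $L$. The A-polynomial $A_{2n}(L,M)\in\mathbb Z[L,M]$ is the primitive polynomial such that $(L-1)A_{2n}$ is a defining polynomial without repeated factors of the union of the one-dimensional components of the Zariski closure of the set of these pairs. It exists and is unique up to sign; its sign can be, and is, chosen so that the coefficient of $M^{4n}$ is $-1$ if $n>0$, and the constant term is $1$ if $n<0$. The Newton polygon of $A_{2n}$ is the convex hull of the points $(i,j)$ such that $L^iM^j$ occurs in $A_{2n}$. For an edge (of positive length) of slope $a/b$, in lowest terms with $b>0$, the edge polynomial is obtained from the sum of the terms of $A_{2n}$ along the edge by dividing by the monomial of the left end point and putting $t$ for $L^bM^a$. **Theorem.** If $n>0$, every edge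 of the Newton polygon of $A_{2n}$ has slope $0$, $-4n$ or $4$, and * the edge polynomials of the edges of slope $-4n$ are exactly $t-1$ and $-(t-1)$; * the edge polynomials of the edges of slope $4$ are exactly $(t-1)^n$ and $-(t-1)^n$ if $n$ is odd, and only $-(t-1)^n$ if $n$ is even. If $n<0$, every edge of the Newton polygon of $A_{2n}$ has slope $0$, $-4n+2$ or $4$, and * the only edge polynomial of the edges of slope $-4n+2$ is $t+1$; * if $n<-1$, the edge polynomials of the edges of slope $4$ are exactly $(t-1)^{-n-1}$ and $-(t-1)^{-n-1}$ if $n$ is even, and only $(t-1)^{-n-1}$ if $n$ is odd. If $n=-1$, the Newton polygon is a segment of slope $-4n+2=6$, and this segment is its only edge. -/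

import Mathlib

noncomputable section

/-- The combinatorial data of an oriented knot diagram with `N` crossings that enter the
Wirtinger presentation of its knot group. The arcs (from one undercrossing to the next one) are
numbered `0, 1, …, N - 1` in the order in which the knot runs through them; the end of arc `i`,
where it turns into arc `i + 1` (cyclically), is the undercrossing number `i`. There the knot
passes under the arc `overArc i`, and `sign i = ±1` is the usual sign of this crossing (a right-handed
crossing is positive). -/
structure KnotDiagram (N : ℕ) where
  overArc : Fin N → Fin N
  sign : Fin N → ℤˣ

namespace KnotDiagram

variable {N : ℕ} [NeZero N] (D : KnotDiagram N)

/-- The Wirtinger relator `x_o ^ ε * x_{i+1} * x_o ^ (-ε) * x_i⁻¹` of the `i`-th crossing, where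
`o = overArc i` and `ε = sign i`; that is, `x_{i+1} = x_o ^ (-ε) * x_i * x_o ^ ε`. -/
def relator (i : Fin N) : FreeGroup (Fin N) :=
  FreeGroup.of (D.overArc i) ^ (D.sign i : ℤ) * FreeGroup.of (i + 1) *
    FreeGroup.of (D.overArc i) ^ (-(D.sign i : ℤ)) * (FreeGroup.of i)⁻¹

/-- The knot group (the fundamental group of the knot exterior), by the Wirtinger presentation. -/
abbrev KnotGroup : Type := PresentedGroup (Set.range D.relator)

/-- The meridian of the arc `i`. -/
def arc (i : Fin N) : D.KnotGroup := PresentedGroup.of i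

/-- The preferred meridian, that of arc `0`. -/
def meridian : D.KnotGroup := D.arc 0

/-- The preferred (null-homologous) longitude that commutes with the meridian of arc `0`:
run once along the knot from arc `0`, collect the meridian of the overcrossing arc at every
undercrossing, with the sign of the crossing as exponent, and correct by the writhe. -/
def longitude : D.KnotGroup :=
  (List.ofFn fun i : Fin N => D.arc (D.overArc i) ^ (D.sign i : ℤ)).prod *
    D.meridian ^ (-∑ i, (D.sign i : ℤ))

/-- The pairs `(L, M)` (coordinate `0` is `L`, coordinate `1` is `M`) for which some representation
of the knot group in `SL(2, ℂ)` sends meridian and longitude to upper triangular matrices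
with upper left entries `M` and `L`. -/
def eigenvalueSet : Set (Fin 2 → ℂ) :=
  {x | ∃ ρ : D.KnotGroup →* Matrix.SpecialLinearGroup (Fin 2) ℂ,
    (ρ D.longitude).1 1 0 = 0 ∧ (ρ D.meridian).1 1 0 = 0 ∧
    (ρ D.longitude).1 0 0 = x 0 ∧ (ρ D.meridian).1 0 0 = x 1}

/-- `A ∈ ℤ[L, M]` (variable `0` is `L`, variable `1` is `M`) is an A-polynomial of the knot,
in the normalization without the factor `L - 1` of the abelian representations:
`A` is primitive, and `(L - 1) * A` is, over `ℂ`, a defining polynomial without repeated factors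
of the union of the one-dimensional components of the Zariski closure of the eigenvalue set.
So its irreducible factors are the `f` whose plane curve `f = 0` lies in this closure.
This determines `A` up to sign. -/
def IsAPolynomial (A : MvPolynomial (Fin 2) ℤ) : Prop :=
  (∀ c : ℤ, MvPolynomial.C c ∣ A → IsUnit c) ∧
  Squarefree (MvPolynomial.map (Int.castRingHom ℂ) ((MvPolynomial.X 0 - 1) * A)) ∧
  ∀ f : MvPolynomial (Fin 2) ℂ, Irreducible f →
    (f ∣ MvPolynomial.map (Int.castRingHom ℂ) ((MvPolynomial.X 0 - 1) * A) ↔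
      {x : Fin 2 → ℂ | MvPolynomial.eval x f = 0} ⊆
        MvPolynomial.zeroLocus ℂ (MvPolynomial.vanishingIdeal ℂ D.eigenvalueSet))

end KnotDiagram

/-- The twist knot `T_{2n}`, with two left-handed vertical crossings (the clasp) and `2n`
right-handed horizontal crossings (`-2n` left-handed ones if `n < 0`).

Let `k = |n|`. Run along the knot. The first strand goes through the horizontal crossings
`1, …, 2k`, then through the two clasp crossings `a, b`; the second strand comes back through the
horizontal crossings `2k, …, 1`, and finally through the clasp crossings `b, a`.
Both strands of the horizontal part and both strands of the clasp are antiparallel, so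
the clasp crossings are positive and the horizontal ones have the sign of `-n`.
On each strand the horizontal crossings are passed alternately over and under. In
Gauss code (`O` over, `U` under) the knot is
`O1 U2 O3 … U(2k), Oa Ub, O(2k) U(2k-1) … U1, Ob Ua` if `n > 0` and
`U1 O2 U3 … O(2k), Oa Ub, U(2k) O(2k-1) … O1, Ob Ua` if `n < 0`.
Arc `0` begins after the undercrossing at `a`. Thus arc `k` ends at `b` under arc `2k + 1`, arc
`2k + 1` ends at `a` under arc `k`, and every other arc `i` ends at a horizontal crossing, under
arc `2k - i` if `n > 0`, under arc `2k + 1 - i` if `n < 0`. -/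
def twistKnot (n : ℤ) : KnotDiagram (2 * n.natAbs + 2) where
  overArc i :=
    ⟨if (i : ℕ) = n.natAbs then 2 * n.natAbs + 1
      else if (i : ℕ) = 2 * n.natAbs + 1 then n.natAbs
      else if 0 < n then 2 * n.natAbs - i
      else 2 * n.natAbs + 1 - i, by split_ifs <;> omega⟩
  sign i :=
    if (i : ℕ) = n.natAbs ∨ (i : ℕ) = 2 * n.natAbs + 1 then 1
      else if 0 < n then -1
      else 1

/-- The exponent of the monomial `L ^ i * M ^ j` as the point `(i, j)` of the plane. -/
def exponentPoint (m : Fin 2 →₀ ℕ) : ℝ × ℝ := (m 0, m 1)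

/-- The Newton polygon of a polynomial in `L` and `M`. -/
def newtonPolygon (A : MvPolynomial (Fin 2) ℤ) : Set (ℝ × ℝ) :=
  convexHull ℝ (exponentPoint '' (A.support : Set (Fin 2 →₀ ℕ)))

/-- The segment from `p` to `q` is an edge (a nondegenerate side) of the Newton polygon of `A`.
If the Newton polygon is itself a segment, then that segment is its only edge. -/
def IsNewtonEdge (A : MvPolynomial (Fin 2) ℤ) (p q : Fin 2 →₀ ℕ) : Prop :=
  p ≠ q ∧ IsExposed ℝ (newtonPolygon A) (segment ℝ (exponentPoint p) (exponentPoint q))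

/-- The edge from `p` to `q` has slope `r`, with `L`-exponents drawn horizontally and
`M`-exponents vertically. -/
def HasSlope (p q : Fin 2 →₀ ℕ) (r : ℚ) : Prop :=
  p 0 ≠ q 0 ∧ ((q 1 : ℚ) - p 1) = r * ((q 0 : ℚ) - p 0)

open Classical in
/-- `f` is the edge polynomial of an edge of slope `r = a / b` (in lowest terms, `b > 0`) of
the Newton polygon of `A`: in the sum of the terms of `A` along the edge, divided by the monomial of
the left end point `p`, put `t` for `L ^ b * M ^ a`. A term with exponent `m` on the edge thus gives
its coefficient times `t ^ ((m 0 - p 0) / b)`. -/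
def IsEdgePolynomial (A : MvPolynomial (Fin 2) ℤ) (r : ℚ) (f : Polynomial ℤ) : Prop :=
  ∃ p q : Fin 2 →₀ ℕ, IsNewtonEdge A p q ∧ HasSlope p q r ∧ p 0 < q 0 ∧
    f = ∑ m ∈ A.support with exponentPoint m ∈ segment ℝ (exponentPoint p) (exponentPoint q),
      Polynomial.monomial ((m 0 - p 0) / r.den) (MvPolynomial.coeff m A)

end

/-! The group of `T_{2n}` is generated by two meridians `a`, `b` with the one relation
`vⁿ b = a vⁿ`, where `v = b a⁻¹ b⁻¹ a`; the longitude is `vⁿ wⁿ`, where `w = a b⁻¹ a⁻¹ b`. A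
representation in which `a` and `b` have no common eigenvector is determined up to conjugation by
`M` and `s = tr (a b⁻¹) - 1`, subject to the Riley equation, and its longitude has the eigenvalue
`L` with `s (1 + L M²) = L + M²`. Eliminating `s` from the Riley equation gives `A_{2n}` as a
combination of Lucas sequences whose parameters do not depend on `n`.

For fixed `M`, the fractional linear substitution from `L` to `s` carries the roots of `A_{2n}` to
those of the Riley polynomial, which are simple for almost all `M` because they are simple at
`M² + M⁻² = -2`; hence `A_{2n}` has no repeated factors.

For the weight belonging to a side of slope `0` or `4`, the initial form of a Lucas sequence is the
Lucas sequence of the initial forms, and this gives the edge polynomial. The highest and lowest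
powers of `L` each occur at a single vertex, and the steep side that leaves it is found among the
terms with the adjacent power of `L`. The resulting Newton polygon is a hexagon with opposite sides
parallel, in which sides may degenerate to points.
-/

namespace KnotDiagram

variable {N : ℕ} [NeZero N] (D : KnotDiagram N) {G : Type*} [Group G]

/-- A colouring of a knot diagram by a group: labels of the arcs satisfying the Wirtinger relations.
The colourings are the restrictions to the arcs of the homomorphisms from the knot group. -/
def IsColoring (x : Fin N → G) : Prop :=
  ∀ i, x (i + 1) = x (D.overArc i) ^ (-(D.sign i : ℤ)) * x i * x (D.overArc i) ^ (D.sign i : ℤ)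

/-- The word of the longitude, read in the labels of the arcs. -/
def longitudeWord (x : Fin N → G) : G :=
  (List.ofFn fun i => x (D.overArc i) ^ (D.sign i : ℤ)).prod * x 0 ^ (-∑ i, (D.sign i : ℤ))

variable {D}

theorem lift_relator_eq_one_iff {x : Fin N → G} {i : Fin N} :
    FreeGroup.lift x (D.relator i) = 1 ↔
      x (i + 1) = x (D.overArc i) ^ (-(D.sign i : ℤ)) * x i * x (D.overArc i) ^ (D.sign i : ℤ) := by
  simp only [relator, map_mul, map_zpow, map_inv, FreeGroup.lift_apply_of, mul_inv_eq_one,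
    zpow_neg]
  rw [mul_inv_eq_iff_eq_mul, ← eq_inv_mul_iff_mul_eq, mul_assoc]

theorem exists_hom_arc_iff {x : Fin N → G} :
    (∃ ρ : D.KnotGroup →* G, ∀ i, ρ (D.arc i) = x i) ↔ D.IsColoring x := by
  constructor
  · rintro ⟨ρ, hρ⟩ i
    have hlift : ρ.comp (PresentedGroup.mk (Set.range D.relator)) = FreeGroup.lift x := by
      ext j
      exact (hρ j).trans FreeGroup.lift_apply_of.symm
    rw [← lift_relator_eq_one_iff, ← hlift, MonoidHom.comp_apply,
      PresentedGroup.one_of_mem (Set.mem_range_self i), map_one]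
  · intro hx
    have h : ∀ r ∈ Set.range D.relator, FreeGroup.lift x r = 1 := by
      rintro _ ⟨i, rfl⟩
      exact lift_relator_eq_one_iff.2 (hx i)
    exact ⟨PresentedGroup.toGroup h, fun _ => PresentedGroup.toGroup.of h⟩

theorem map_longitude (ρ : D.KnotGroup →* G) :
    ρ D.longitude = D.longitudeWord fun i => ρ (D.arc i) := by
  rw [longitude, longitudeWord, map_mul, map_zpow, map_list_prod, List.map_ofFn, meridian]
  simp only [Function.comp_def, map_zpow]

theorem exists_hom_meridian_longitude_iff {a l : G} :
    (∃ ρ : D.KnotGroup →* G, ρ D.meridian = a ∧ ρ D.longitude = l) ↔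
      ∃ x : Fin N → G, D.IsColoring x ∧ x 0 = a ∧ D.longitudeWord x = l := by
  constructor
  · rintro ⟨ρ, ha, hl⟩
    exact ⟨_, exists_hom_arc_iff.1 ⟨ρ, fun _ => rfl⟩, ha, (map_longitude ρ).symm.trans hl⟩
  · rintro ⟨x, hx, ha, hl⟩
    obtain ⟨ρ, hρ⟩ := exists_hom_arc_iff.2 hx
    exact ⟨ρ, (hρ 0).trans ha, by rw [map_longitude, funext hρ, hl]⟩

end KnotDiagram

section TwistKnotGroup

variable {G : Type*} [Group G]

theorem prod_range_telescope (c : ℕ → G) (g : G) (k : ℕ) :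
    ((List.range k).map fun i => c i * g * (c (i + 1))⁻¹).prod = c 0 * g ^ k * (c k)⁻¹ := by
  induction k with
  | zero => simp
  | succ k ih =>
    rw [List.prod_range_succ, ih, pow_succ]
    group

/-- The commutator `b a⁻¹ b⁻¹ a` of the meridians `a`, `b` of the arcs `0` and `|n|` of a twist
knot, both of which pass through the clasp. Each full twist conjugates meridians by it. -/
def claspWord (a b : G) : G := b * a⁻¹ * b⁻¹ * a

theorem map_claspWord {H : Type*} [Group H] (f : G →* H) (a b : G) :
    f (claspWord a b) = claspWord (f a) (f b) := by
  simp only [claspWord, map_mul, map_inv]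

theorem claspWord_swap_zpow (a b : G) (n : ℤ) :
    claspWord b a ^ n = b⁻¹ * a * (claspWord a b ^ n)⁻¹ * (b⁻¹ * a)⁻¹ := by
  rw [← inv_zpow, ← conj_zpow]
  congr 1
  simp only [claspWord]
  group

theorem claspWord_swap_zpow' (a b : G) (n : ℤ) :
    claspWord b a ^ n = a * b⁻¹ * (claspWord a b ^ n)⁻¹ * (a * b⁻¹)⁻¹ := by
  rw [← inv_zpow, ← conj_zpow]
  congr 1
  simp only [claspWord]
  group

theorem commute_zpow_claspWord_mul {a b : G} {n : ℤ}
    (h : claspWord a b ^ n * b = a * claspWord a b ^ n) :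
    Commute a (claspWord a b ^ n * claspWord b a ^ n) := by
  have hba : b * claspWord b a ^ n = claspWord b a ^ n * a := by
    have h_inv : b⁻¹ * (claspWord a b ^ n)⁻¹ = (claspWord a b ^ n)⁻¹ * a⁻¹ := by
      rw [← mul_inv_rev, ← mul_inv_rev, h]
    calc b * claspWord b a ^ n = a * ((claspWord a b ^ n)⁻¹ * a⁻¹) * b := by
          rw [claspWord_swap_zpow]; group
      _ = claspWord b a ^ n * a := by rw [← h_inv, claspWord_swap_zpow']; group
  rw [commute_iff_eq, ← mul_assoc, ← h, mul_assoc, hba, mul_assoc]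

theorem twist_longitude_eq {a b : G} {n : ℤ}
    (h : claspWord a b ^ n * b = a * claspWord a b ^ n) :
    a ^ (-n) * claspWord a b ^ n * (b * a * b⁻¹) *
        ((claspWord a b ^ n)⁻¹ * (b * a * b⁻¹) ^ (-n)) * b * a ^ (2 * n - 2) =
      claspWord a b ^ n * claspWord b a ^ n := by
  have hcomm := commute_zpow_claspWord_mul h
  have hswap := claspWord_swap_zpow' a b n
  generalize claspWord b a ^ n = w at hcomm hswap ⊢
  generalize claspWord a b ^ n = v at h hcomm hswap ⊢
  have hb : b = v⁻¹ * a * v := by rw [mul_assoc, ← h]; group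
  have hconj : a * (v * w) * a⁻¹ = v * (b * a * b⁻¹) * v⁻¹ * b * a ^ (-2 : ℤ) := by
    rw [hswap, hb]; group
  calc a ^ (-n) * v * (b * a * b⁻¹) * (v⁻¹ * (b * a * b⁻¹) ^ (-n)) * b * a ^ (2 * n - 2)
      = a ^ (-n) * (v * (b * a * b⁻¹) * v⁻¹ * b * a ^ (-2 : ℤ)) * a ^ n := by
        rw [conj_zpow]; group
    _ = a ^ (-n) * (v * w) * a ^ n := by rw [← hconj, hcomm.eq, mul_inv_cancel_right]
    _ = v * w := by
      rw [mul_assoc, ← (hcomm.zpow_left n).eq, zpow_neg, inv_mul_cancel_left]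

/-- The two strands of a half twist run in opposite directions; `p`, `q` and `p'`, `q'` label their
arcs at the two ends. -/
theorem half_twist_iff_of_pos {p q p' q' : G} :
    (p' = q' * p * q'⁻¹ ∧ q = p * q' * p⁻¹) ↔
      p' = (q⁻¹ * p)⁻¹ * p * (q⁻¹ * p) ∧ q' = (q⁻¹ * p)⁻¹ * q * (q⁻¹ * p) := by
  constructor <;> rintro ⟨rfl, rfl⟩ <;> constructor <;> group

theorem half_twist_iff_of_neg {p q p' q' : G} :
    (p' = q⁻¹ * p * q ∧ q = p'⁻¹ * q' * p') ↔
      p' = q⁻¹ * p * p * (q⁻¹ * p)⁻¹ ∧ q' = q⁻¹ * p * q * (q⁻¹ * p)⁻¹ := by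
  have hq : q = p'⁻¹ * q' * p' ↔ q' = p' * q * p'⁻¹ := by
    constructor <;> rintro rfl <;> group
  rw [hq]
  constructor <;> rintro ⟨rfl, rfl⟩ <;> constructor <;> group

theorem half_twists_iff {k : ℕ} {e : ℤ} {p q : ℕ → G} :
    (∀ i < k, p (i + 1) = ((q i)⁻¹ * p i) ^ (-e) * p i * ((q i)⁻¹ * p i) ^ e ∧
        q (i + 1) = ((q i)⁻¹ * p i) ^ (-e) * q i * ((q i)⁻¹ * p i) ^ e) ↔
      ∀ i ≤ k, p i = ((q 0)⁻¹ * p 0) ^ (-(e * i)) * p 0 * ((q 0)⁻¹ * p 0) ^ (e * i) ∧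
        q i = ((q 0)⁻¹ * p 0) ^ (-(e * i)) * q 0 * ((q 0)⁻¹ * p 0) ^ (e * i) := by
  generalize hv : (q 0)⁻¹ * p 0 = v
  have step {i : ℕ} (hp : p i = v ^ (-(e * i)) * p 0 * v ^ (e * i))
      (hq : q i = v ^ (-(e * i)) * q 0 * v ^ (e * i)) :
      (q i)⁻¹ * p i = v ∧
        v ^ (-e) * p i * v ^ e = v ^ (-(e * (i + 1 : ℕ))) * p 0 * v ^ (e * (i + 1 : ℕ)) ∧
        v ^ (-e) * q i * v ^ e = v ^ (-(e * (i + 1 : ℕ))) * q 0 * v ^ (e * (i + 1 : ℕ)) := by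
    have hexp : e * (i + 1 : ℕ) = e * i + e := by push_cast; ring
    refine ⟨?_, ?_, ?_⟩
    · calc (q i)⁻¹ * p i = v ^ (-(e * i)) * ((q 0)⁻¹ * p 0) * v ^ (e * i) := by
            rw [hp, hq]; group
        _ = v := by rw [hv]; group
    · rw [hp, hexp]; group
    · rw [hq, hexp]; group
  constructor
  · intro h i
    induction i with
    | zero => simp
    | succ i ih =>
      intro hi
      obtain ⟨hp, hq⟩ := ih (by omega)
      obtain ⟨hpq, hp', hq'⟩ := step hp hq
      obtain ⟨h₁, h₂⟩ := h i hi
      rw [hpq] at h₁ h₂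
      exact ⟨h₁.trans hp', h₂.trans hq'⟩
  · intro h i hi
    obtain ⟨hpq, hp', hq'⟩ := step (h i hi.le).1 (h i hi.le).2
    rw [hpq]
    exact ⟨(h (i + 1) hi).1.trans hp'.symm, (h (i + 1) hi).2.trans hq'.symm⟩

/-- `(twistKnot n).overArc` as a function on natural numbers. -/
def twistOver (n : ℤ) (i : ℕ) : ℕ :=
  if i = n.natAbs then 2 * n.natAbs + 1
  else if i = 2 * n.natAbs + 1 then n.natAbs
  else if 0 < n then 2 * n.natAbs - i
  else 2 * n.natAbs + 1 - i

theorem twistKnot_overArc_val (n : ℤ) (i : Fin (2 * n.natAbs + 2)) :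
    ((twistKnot n).overArc i : ℕ) = twistOver n i := rfl

/-- `(twistKnot n).sign` as a function on natural numbers. -/
def twistSign (n : ℤ) (i : ℕ) : ℤ :=
  if i = n.natAbs ∨ i = 2 * n.natAbs + 1 then 1 else -n.sign

theorem twistKnot_sign_coe {n : ℤ} (hn : n ≠ 0) (i : Fin (2 * n.natAbs + 2)) :
    ((twistKnot n).sign i : ℤ) = twistSign n i := by
  rcases hn.lt_or_gt with hn | hn
  · simp [twistKnot, twistSign, hn.not_gt, Int.sign_eq_neg_one_of_neg hn]
  · simp only [twistKnot, twistSign, hn, Int.sign_eq_one_of_pos hn]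
    split_ifs <;> rfl

theorem twistOver_natAbs (n : ℤ) : twistOver n n.natAbs = 2 * n.natAbs + 1 := if_pos rfl

theorem twistOver_last (n : ℤ) : twistOver n (2 * n.natAbs + 1) = n.natAbs := by
  rw [twistOver, if_neg (by omega), if_pos rfl]

theorem twistOver_of_pos {n : ℤ} (hn : 0 < n) {i : ℕ} (hi : i ≠ n.natAbs)
    (hi' : i ≠ 2 * n.natAbs + 1) : twistOver n i = 2 * n.natAbs - i := by
  rw [twistOver, if_neg hi, if_neg hi', if_pos hn]

theorem twistOver_of_neg {n : ℤ} (hn : n < 0) {i : ℕ} (hi : i ≠ n.natAbs)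
    (hi' : i ≠ 2 * n.natAbs + 1) : twistOver n i = 2 * n.natAbs + 1 - i := by
  rw [twistOver, if_neg hi, if_neg hi', if_neg hn.not_gt]

theorem twistSign_natAbs (n : ℤ) : twistSign n n.natAbs = 1 := if_pos (Or.inl rfl)

theorem twistSign_last (n : ℤ) : twistSign n (2 * n.natAbs + 1) = 1 := if_pos (Or.inr rfl)

theorem twistSign_of_ne {n : ℤ} {i : ℕ} (hi : i ≠ n.natAbs) (hi' : i ≠ 2 * n.natAbs + 1) :
    twistSign n i = -n.sign :=
  if_neg (not_or.2 ⟨hi, hi'⟩)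

theorem horizontal_crossings_iff {n : ℤ} (hn : n ≠ 0) {x : ℕ → G} {i : ℕ} (hi : i < n.natAbs) :
    ((x (i + 1) = x (twistOver n i) ^ (-twistSign n i) * x i * x (twistOver n i) ^ twistSign n i) ∧
      x (2 * n.natAbs + 1 - i) = x (twistOver n (2 * n.natAbs - i)) ^
        (-twistSign n (2 * n.natAbs - i)) * x (2 * n.natAbs - i) *
          x (twistOver n (2 * n.natAbs - i)) ^ twistSign n (2 * n.natAbs - i)) ↔
    x (i + 1) = ((x (2 * n.natAbs + 1 - i))⁻¹ * x i) ^ (-n.sign) * x i *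
        ((x (2 * n.natAbs + 1 - i))⁻¹ * x i) ^ n.sign ∧
      x (2 * n.natAbs - i) = ((x (2 * n.natAbs + 1 - i))⁻¹ * x i) ^ (-n.sign) *
        x (2 * n.natAbs + 1 - i) * ((x (2 * n.natAbs + 1 - i))⁻¹ * x i) ^ n.sign := by
  rw [twistSign_of_ne (by omega) (by omega), twistSign_of_ne (by omega) (by omega)]
  rcases hn.lt_or_gt with hn | hn
  · rw [twistOver_of_neg hn (by omega) (by omega), twistOver_of_neg hn (by omega) (by omega),
      show 2 * n.natAbs + 1 - (2 * n.natAbs - i) = i + 1 by omega, Int.sign_eq_neg_one_of_neg hn]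
    simpa only [neg_neg, zpow_one, zpow_neg_one] using half_twist_iff_of_neg
  · rw [twistOver_of_pos hn (by omega) (by omega), twistOver_of_pos hn (by omega) (by omega),
      show 2 * n.natAbs - (2 * n.natAbs - i) = i by omega, Int.sign_eq_one_of_pos hn]
    simpa only [neg_neg, zpow_one, zpow_neg_one] using half_twist_iff_of_pos

theorem forall_fin_two_mul_add_two_iff {k : ℕ} (P : ℕ → Prop) :
    (∀ i : Fin (2 * k + 2), P i) ↔ (∀ i < k, P i ∧ P (2 * k - i)) ∧ P k ∧ P (2 * k + 1) := by
  rw [Fin.forall_iff]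
  refine ⟨fun h => ⟨fun i hi => ⟨h _ (by omega), h _ (by omega)⟩, h _ (by omega), h _ (by omega)⟩,
    fun ⟨h, hk, hl⟩ i hi => ?_⟩
  obtain hi | rfl | rfl | hi : i < k ∨ i = k ∨ i = 2 * k + 1 ∨ 2 * k - i < k ∧ i ≤ 2 * k := by
    omega
  · exact (h i hi).1
  · exact hk
  · exact hl
  · simpa only [Nat.sub_sub_self hi.2] using (h _ hi.1).2

theorem isColoring_twistKnot_iff_crossings {n : ℤ} (hn : n ≠ 0) {x : ℕ → G} :
    (twistKnot n).IsColoring (fun i => x i) ↔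
      (∀ i < n.natAbs,
        x (i + 1) = ((x (2 * n.natAbs + 1 - i))⁻¹ * x i) ^ (-n.sign) * x i *
          ((x (2 * n.natAbs + 1 - i))⁻¹ * x i) ^ n.sign ∧
        x (2 * n.natAbs - i) = ((x (2 * n.natAbs + 1 - i))⁻¹ * x i) ^ (-n.sign) *
          x (2 * n.natAbs + 1 - i) * ((x (2 * n.natAbs + 1 - i))⁻¹ * x i) ^ n.sign) ∧
      x (n.natAbs + 1) = (x (2 * n.natAbs + 1))⁻¹ * x n.natAbs * x (2 * n.natAbs + 1) ∧
      x 0 = (x n.natAbs)⁻¹ * x (2 * n.natAbs + 1) * x n.natAbs := by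
  have crossing (i : Fin (2 * n.natAbs + 2)) :
      (((i + 1 : Fin (2 * n.natAbs + 2)) : ℕ)) = (i + 1) % (2 * n.natAbs + 2) := by
    simp [Fin.val_add]
  simp only [KnotDiagram.IsColoring, twistKnot_sign_coe hn, twistKnot_overArc_val, crossing]
  rw [forall_fin_two_mul_add_two_iff fun i => x ((i + 1) % (2 * n.natAbs + 2)) =
    x (twistOver n i) ^ (-twistSign n i) * x i * x (twistOver n i) ^ twistSign n i]
  refine and_congr (forall₂_congr fun i hi => ?_) (and_congr ?_ ?_)
  · rw [← horizontal_crossings_iff hn hi, show 2 * n.natAbs - i + 1 = 2 * n.natAbs + 1 - i by omega,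
      Nat.mod_eq_of_lt (show i + 1 < 2 * n.natAbs + 2 by omega),
      Nat.mod_eq_of_lt (show 2 * n.natAbs + 1 - i < 2 * n.natAbs + 2 by omega)]
  · rw [twistOver_natAbs, twistSign_natAbs,
      Nat.mod_eq_of_lt (show n.natAbs + 1 < 2 * n.natAbs + 2 by omega), zpow_neg_one, zpow_one]
  · rw [twistOver_last, twistSign_last, Nat.mod_self, zpow_neg_one, zpow_one]

/-- The meridian of arc `i` of a twist knot in terms of the meridians `a`, `b` of the arcs `0` and
`|n|`. The meridian of the last arc is `b a b⁻¹`; the exponents count half twists, with sign. -/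
def twistArc (n : ℤ) (a b : G) (i : ℕ) : G :=
  if i ≤ n.natAbs then claspWord a b ^ (-(n.sign * i)) * a * claspWord a b ^ (n.sign * i)
  else claspWord a b ^ (-(n.sign * (2 * n.natAbs + 1 - i : ℕ))) * (b * a * b⁻¹) *
    claspWord a b ^ (n.sign * (2 * n.natAbs + 1 - i : ℕ))

theorem twistArc_of_le {n : ℤ} {a b : G} {i : ℕ} (hi : i ≤ n.natAbs) :
    twistArc n a b i = claspWord a b ^ (-(n.sign * i)) * a * claspWord a b ^ (n.sign * i) :=
  if_pos hi

theorem twistArc_sub {n : ℤ} {a b : G} {i : ℕ} (hi : i ≤ n.natAbs) :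
    twistArc n a b (2 * n.natAbs + 1 - i) =
      claspWord a b ^ (-(n.sign * i)) * (b * a * b⁻¹) * claspWord a b ^ (n.sign * i) := by
  rw [twistArc, if_neg (by omega), show 2 * n.natAbs + 1 - (2 * n.natAbs + 1 - i) = i by omega]

theorem twistArc_last (n : ℤ) (a b : G) :
    twistArc n a b (2 * n.natAbs + 1) = b * a * b⁻¹ := by
  simpa using twistArc_sub (n := n) (a := a) (b := b) (i := 0) (by omega)

theorem isColoring_twistKnot_iff {n : ℤ} (hn : n ≠ 0) {x : ℕ → G} :
    (twistKnot n).IsColoring (fun i => x i) ↔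
      ∀ i ≤ 2 * n.natAbs + 1, x i = twistArc n (x 0) (x n.natAbs) i := by
  have closed := half_twists_iff (k := n.natAbs) (e := n.sign) (p := x)
    (q := fun i => x (2 * n.natAbs + 1 - i))
  simp only [Nat.add_sub_add_right, Nat.sub_zero] at closed
  rw [isColoring_twistKnot_iff_crossings hn, closed]
  have claspWord_eq (h : x (2 * n.natAbs + 1) = x n.natAbs * x 0 * (x n.natAbs)⁻¹) :
      (x (2 * n.natAbs + 1))⁻¹ * x 0 = claspWord (x 0) (x n.natAbs) := by
    rw [h, claspWord]; group
  constructor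
  · rintro ⟨h, -, hlast⟩ i hi
    have hq : x (2 * n.natAbs + 1) = x n.natAbs * x 0 * (x n.natAbs)⁻¹ := by rw [hlast]; group
    rw [claspWord_eq hq, hq] at h
    obtain hi' | ⟨j, hj, rfl⟩ : i ≤ n.natAbs ∨ ∃ j ≤ n.natAbs, i = 2 * n.natAbs + 1 - j := by
      by_cases hik : i ≤ n.natAbs
      · exact Or.inl hik
      · exact Or.inr ⟨2 * n.natAbs + 1 - i, by omega, by omega⟩
    · rw [twistArc_of_le hi', ← (h i hi').1]
    · rw [twistArc_sub hj, ← (h j hj).2]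
  · intro h
    have hq := (h _ le_rfl).trans (twistArc_last n _ _)
    have hk := (h _ (by omega)).trans (twistArc_of_le (le_refl n.natAbs))
    have hk' := (h _ (by omega)).trans (twistArc_sub (le_refl n.natAbs))
    rw [claspWord_eq hq]
    refine ⟨fun i hi => ⟨(h i (by omega)).trans (twistArc_of_le hi), ?_⟩, ?_, by rw [hq]; group⟩
    · rw [hq, ← twistArc_sub hi]
      exact h _ (by omega)
    · rw [show 2 * n.natAbs + 1 - n.natAbs = n.natAbs + 1 by omega,
        Int.sign_mul_natAbs] at hk'
      rw [Int.sign_mul_natAbs] at hk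
      have hconj : x n.natAbs * x 0 * (x n.natAbs)⁻¹ =
          x 0 * (claspWord (x 0) (x n.natAbs))⁻¹ := by rw [claspWord]; group
      calc x (n.natAbs + 1)
          = claspWord (x 0) (x n.natAbs) ^ (-n) * x 0 * claspWord (x 0) (x n.natAbs) ^ n *
              (claspWord (x 0) (x n.natAbs))⁻¹ := by
            rw [hk', hconj]; group
        _ = x n.natAbs * (claspWord (x 0) (x n.natAbs))⁻¹ := by rw [← hk]
        _ = (x (2 * n.natAbs + 1))⁻¹ * x n.natAbs * x (2 * n.natAbs + 1) := by
            rw [hq, claspWord]; group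

theorem prod_ofFn_two_mul_add_two {M : Type*} [Monoid M] (f : ℕ → M) (k : ℕ) :
    (List.ofFn fun i : Fin (2 * k + 2) => f i).prod =
      ((List.range k).map f).prod * f k * ((List.range k).map fun j => f (k + 1 + j)).prod *
        f (2 * k + 1) := by
  have hrange : List.range (2 * k + 2) =
      List.range k ++ [k] ++ (List.range k).map (k + 1 + ·) ++ [2 * k + 1] := by
    rw [List.range_succ, show 2 * k + 1 = k + 1 + k by omega, List.range_add, List.range_succ]
  have hofFn : (List.ofFn fun i : Fin (2 * k + 2) => f i) = (List.range (2 * k + 2)).map f :=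
    List.ext_getElem (by rw [List.length_ofFn, List.length_map, List.length_range]) fun i _ _ => by
      rw [List.getElem_ofFn, List.getElem_map, List.getElem_range]
  rw [hofFn, hrange]
  simp [Function.comp_def, mul_assoc]

theorem sum_sign_twistKnot {n : ℤ} (hn : n ≠ 0) :
    ∑ i, ((twistKnot n).sign i : ℤ) = 2 - 2 * n := by
  have sum_strand {f : ℕ → ℤ} (hf : ∀ i < n.natAbs, f i = -n.sign) :
      ∑ i ∈ Finset.range n.natAbs, f i = -n := by
    rw [Finset.sum_congr rfl fun i hi => hf i (Finset.mem_range.1 hi), Finset.sum_const,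
      Finset.card_range, nsmul_eq_mul, mul_neg, mul_comm, Int.sign_mul_natAbs]
  simp only [twistKnot_sign_coe hn]
  rw [Fin.sum_univ_eq_sum_range (twistSign n), show 2 * n.natAbs + 2 = n.natAbs + 1 + (n.natAbs + 1)
    by omega, Finset.sum_range_add, Finset.sum_range_succ, Finset.sum_range_succ,
    sum_strand fun i hi => twistSign_of_ne (by omega) (by omega),
    sum_strand fun i hi => twistSign_of_ne (by omega) (by omega), twistSign_natAbs,
    show n.natAbs + 1 + n.natAbs = 2 * n.natAbs + 1 by omega, twistSign_last]
  ring

theorem twistArc_over_zpow_sign_of_lt {n : ℤ} (hn : n ≠ 0) (a b : G) {i : ℕ} (hi : i < n.natAbs) :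
    twistArc n a b (twistOver n i) ^ twistSign n i =
      claspWord a b ^ (-(n.sign * i)) * a ^ (-n.sign) *
        (claspWord a b ^ (-(n.sign * (i + 1 : ℕ))))⁻¹ := by
  rw [twistSign_of_ne (by omega) (by omega)]
  have hq : b * a * b⁻¹ = a * (claspWord a b)⁻¹ := by rw [claspWord]; group
  rcases hn.lt_or_gt with hn | hn
  · rw [twistOver_of_neg hn (by omega) (by omega), twistArc_sub hi.le, hq,
      Int.sign_eq_neg_one_of_neg hn]
    push_cast
    group
  · rw [twistOver_of_pos hn (by omega) (by omega),
      show 2 * n.natAbs - i = 2 * n.natAbs + 1 - (i + 1) by omega, twistArc_sub hi, hq,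
      Int.sign_eq_one_of_pos hn]
    push_cast
    group

theorem twistArc_over_zpow_sign_sub {n : ℤ} (hn : n ≠ 0) (a b : G) {i : ℕ} (hi : i < n.natAbs) :
    twistArc n a b (twistOver n (2 * n.natAbs - i)) ^ twistSign n (2 * n.natAbs - i) =
      claspWord a b ^ (-(n.sign * (i + 1 : ℕ))) * (b * a * b⁻¹) ^ (-n.sign) *
        (claspWord a b ^ (-(n.sign * i)))⁻¹ := by
  rw [twistSign_of_ne (by omega) (by omega)]
  have ha : b * a * b⁻¹ * claspWord a b = a := by rw [claspWord]; group
  generalize b * a * b⁻¹ = q at ha ⊢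
  rcases hn.lt_or_gt with hn | hn
  · rw [twistOver_of_neg hn (by omega) (by omega),
      show 2 * n.natAbs + 1 - (2 * n.natAbs - i) = i + 1 by omega, twistArc_of_le hi,
      Int.sign_eq_neg_one_of_neg hn]
    generalize claspWord a b = v at ha ⊢
    rw [← ha]
    push_cast
    group
  · rw [twistOver_of_pos hn (by omega) (by omega), Nat.sub_sub_self (by omega),
      twistArc_of_le hi.le, Int.sign_eq_one_of_pos hn]
    generalize claspWord a b = v at ha ⊢
    rw [← ha]
    push_cast
    group

theorem prod_twistArc_over_fst {n : ℤ} (hn : n ≠ 0) (a b : G) :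
    ((List.range n.natAbs).map fun i => twistArc n a b (twistOver n i) ^ twistSign n i).prod =
      a ^ (-n) * claspWord a b ^ n := by
  rw [List.map_congr_left fun i hi =>
    twistArc_over_zpow_sign_of_lt hn a b (List.mem_range.1 hi), prod_range_telescope fun i =>
      claspWord a b ^ (-(n.sign * i)), ← zpow_natCast, ← zpow_mul, neg_mul, Int.sign_mul_natAbs]
  simp

theorem prod_twistArc_over_snd {n : ℤ} (hn : n ≠ 0) (a b : G) :
    ((List.range n.natAbs).map fun j => twistArc n a b (twistOver n (n.natAbs + 1 + j)) ^
        twistSign n (n.natAbs + 1 + j)).prod =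
      (claspWord a b ^ n)⁻¹ * (b * a * b⁻¹) ^ (-n) := by
  have hterm : ∀ j ∈ List.range n.natAbs, twistArc n a b (twistOver n (n.natAbs + 1 + j)) ^
      twistSign n (n.natAbs + 1 + j) = claspWord a b ^ (-(n.sign * (n.natAbs - j : ℕ))) *
        (b * a * b⁻¹) ^ (-n.sign) *
          (claspWord a b ^ (-(n.sign * (n.natAbs - (j + 1) : ℕ))))⁻¹ := by
    intro j hj
    rw [List.mem_range] at hj
    have := twistArc_over_zpow_sign_sub hn a b (show n.natAbs - (j + 1) < n.natAbs by omega)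
    rwa [show 2 * n.natAbs - (n.natAbs - (j + 1)) = n.natAbs + 1 + j by omega,
      show n.natAbs - (j + 1) + 1 = n.natAbs - j by omega] at this
  rw [List.map_congr_left hterm, prod_range_telescope fun j =>
      claspWord a b ^ (-(n.sign * (n.natAbs - j : ℕ))), ← zpow_natCast, ← zpow_mul, neg_mul,
      Nat.sub_zero, Nat.sub_self, Int.sign_mul_natAbs]
  simp

theorem longitudeWord_twistArc {n : ℤ} (hn : n ≠ 0) {a b : G}
    (h : claspWord a b ^ n * b = a * claspWord a b ^ n) :
    (twistKnot n).longitudeWord (fun i => twistArc n a b i) =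
      claspWord a b ^ n * claspWord b a ^ n := by
  have hk : twistArc n a b n.natAbs = b := by
    rw [twistArc_of_le le_rfl, Int.sign_mul_natAbs, mul_assoc, ← h]; group
  have hzero : twistArc n a b 0 = a := by simp [twistArc_of_le]
  rw [KnotDiagram.longitudeWord, sum_sign_twistKnot hn]
  simp only [twistKnot_sign_coe hn, twistKnot_overArc_val]
  rw [prod_ofFn_two_mul_add_two fun i => twistArc n a b (twistOver n i) ^ twistSign n i,
    prod_twistArc_over_fst hn, prod_twistArc_over_snd hn, twistOver_natAbs, twistSign_natAbs,
    twistOver_last, twistSign_last, hk, twistArc_last, zpow_one, zpow_one,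
    Fin.val_zero, hzero, neg_sub, ← twist_longitude_eq h]

theorem exists_hom_twistKnot_iff {n : ℤ} (hn : n ≠ 0) {a l : G} :
    (∃ ρ : (twistKnot n).KnotGroup →* G,
        ρ (twistKnot n).meridian = a ∧ ρ (twistKnot n).longitude = l) ↔
      ∃ b, claspWord a b ^ n * b = a * claspWord a b ^ n ∧
        claspWord a b ^ n * claspWord b a ^ n = l := by
  rw [KnotDiagram.exists_hom_meridian_longitude_iff]
  have twistArc_natAbs_iff {b : G} :
      twistArc n a b n.natAbs = b ↔ claspWord a b ^ n * b = a * claspWord a b ^ n := by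
    rw [twistArc_of_le le_rfl, Int.sign_mul_natAbs, zpow_neg, mul_assoc, inv_mul_eq_iff_eq_mul,
      eq_comm]
  have hzero (b : G) : twistArc n a b 0 = a := by simp [twistArc_of_le]
  constructor
  · rintro ⟨x, hx, rfl, rfl⟩
    obtain ⟨y, rfl⟩ : ∃ y : ℕ → G, x = fun i : Fin _ => y i :=
      ⟨fun i => x (Fin.ofNat _ i), by simp⟩
    rw [isColoring_twistKnot_iff hn] at hx
    have hrel := twistArc_natAbs_iff.1 (hx _ (by omega)).symm
    refine ⟨y n.natAbs, hrel, ?_⟩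
    rw [← longitudeWord_twistArc hn hrel]
    congr 1
    ext i
    exact (hx i (by omega)).symm
  · rintro ⟨b, hb, rfl⟩
    refine ⟨fun i => twistArc n a b i, ?_, hzero b, longitudeWord_twistArc hn hb⟩
    rw [isColoring_twistKnot_iff hn, hzero, twistArc_natAbs_iff.2 hb]
    exact fun _ _ => rfl

end TwistKnotGroup

section SpecialLinearGroup

open Polynomial Matrix

open scoped MatrixGroups

section CommRing

variable {R : Type*} [CommRing R]

theorem coe_mul_self_eq_trace_smul_sub_one (V : SL(2, R)) : V.1 * V.1 = V.1.trace • V.1 - 1 := by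
  have hdet : V.1 0 0 * V.1 1 1 - V.1 0 1 * V.1 1 0 = 1 := by rw [← det_fin_two, V.2]
  ext i j
  fin_cases i <;> fin_cases j <;> simp [mul_apply, Fin.sum_univ_two, trace_fin_two] <;> grind

theorem coe_inv_eq_trace_smul_one_sub (V : SL(2, R)) :
    (V⁻¹).1 = V.1.trace • (1 : Matrix (Fin 2) (Fin 2) R) - V.1 := by
  ext i j
  fin_cases i <;> fin_cases j <;> simp [adjugate_fin_two, trace_fin_two]

theorem coe_zpow_eq_chebyshev_smul_sub (V : SL(2, R)) (n : ℤ) :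
    (V ^ n).1 = (Chebyshev.S R (n - 1)).eval V.1.trace • V.1 -
      (Chebyshev.S R (n - 2)).eval V.1.trace • (1 : Matrix (Fin 2) (Fin 2) R) := by
  have hS (m : ℤ) : (Chebyshev.S R m).eval V.1.trace =
      V.1.trace * (Chebyshev.S R (m - 1)).eval V.1.trace -
        (Chebyshev.S R (m - 2)).eval V.1.trace := by
    rw [Chebyshev.S_eq, eval_sub, eval_mul, eval_X]
  induction n with
  | zero => simp [Chebyshev.S_neg_one, Chebyshev.S_neg_two]
  | succ n ih =>
    rw [_root_.zpow_add_one, Matrix.SpecialLinearGroup.coe_mul, ih, add_sub_cancel_right, hS n,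
      show (n : ℤ) + 1 - 2 = n - 1 by ring, sub_mul, smul_mul_assoc,
      coe_mul_self_eq_trace_smul_sub_one, smul_one_mul]
    module
  | pred n ih =>
    have hinv : V.1 * (V⁻¹).1 = 1 := by
      rw [← Matrix.SpecialLinearGroup.coe_mul, mul_inv_cancel, Matrix.SpecialLinearGroup.coe_one]
    rw [_root_.zpow_sub_one, Matrix.SpecialLinearGroup.coe_mul, ih, sub_mul, smul_mul_assoc, hinv,
      smul_one_mul, coe_inv_eq_trace_smul_one_sub, hS (-n - 1),
      show -(n : ℤ) - 1 - 1 = -n - 2 by ring]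
    module

theorem smul_sub_smul_one_fin_two (α β x y z w : R) :
    α • !![x, y; z, w] - β • (1 : Matrix (Fin 2) (Fin 2) R) =
      !![α * x - β, α * y; α * z, α * w - β] := by
  ext i j
  fin_cases i <;> fin_cases j <;> simp

/-- The subgroup of `SL(2, R)` of the matrices whose entry at the off-diagonal place `(i, j)`
vanishes: the upper or the lower triangular matrices. -/
def triangularSubgroup (R : Type*) [CommRing R] {i j : Fin 2} (hij : i ≠ j) :
    Subgroup SL(2, R) where
  carrier := {V | V.1 i j = 0}
  one_mem' := by simp [hij]
  mul_mem' {V W} (hV : V.1 i j = 0) (hW : W.1 i j = 0) := by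
    fin_cases i <;> fin_cases j <;> simp_all [mul_apply, Fin.sum_univ_two]
  inv_mem' {V} (hV : V.1 i j = 0) := by
    fin_cases i <;> fin_cases j <;> simp_all [adjugate_fin_two]

/-- The character `V ↦ V 0 0` of the group of triangular matrices. -/
def triangularCharacter (R : Type*) [CommRing R] {i j : Fin 2} (hij : i ≠ j) :
    triangularSubgroup R hij →* R where
  toFun V := V.1.1 0 0
  map_one' := by simp
  map_mul' := by
    rintro ⟨V, hV : V.1 i j = 0⟩ ⟨W, hW : W.1 i j = 0⟩
    have h : V.1 0 1 * W.1 1 0 = 0 := by fin_cases i <;> fin_cases j <;> simp_all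
    simp [mul_apply, Fin.sum_univ_two, h]

theorem claspWord_zpow_mul_apply_zero_zero_of_triangular {i j : Fin 2} (hij : i ≠ j)
    {a b : SL(2, R)} (ha : a.1 i j = 0) (hb : b.1 i j = 0) (n : ℤ) :
    (claspWord a b ^ n * claspWord b a ^ n).1 0 0 = 1 := by
  let a' : triangularSubgroup R hij := ⟨a, ha⟩
  let b' : triangularSubgroup R hij := ⟨b, hb⟩
  have h : (triangularCharacter R hij).toHomUnits
      (claspWord a' b' ^ n * claspWord b' a' ^ n) = 1 := by
    rw [map_mul, map_zpow, map_zpow, map_claspWord, map_claspWord]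
    generalize (triangularCharacter R hij).toHomUnits a' = u
    generalize (triangularCharacter R hij).toHomUnits b' = v
    simp [claspWord, mul_comm u]
  exact congrArg Units.val h

end CommRing

variable {K : Type*} [Field K]

theorem apply_zero_zero_ne_zero_of_upper {V : SL(2, K)} (h : V.1 1 0 = 0) : V.1 0 0 ≠ 0 := by
  have hdet := V.2
  rw [det_fin_two, h, mul_zero, sub_zero] at hdet
  exact left_ne_zero_of_mul_eq_one hdet

theorem coe_eq_of_upper {V : SL(2, K)} (h : V.1 1 0 = 0) :
    V.1 = !![V.1 0 0, V.1 0 1; 0, (V.1 0 0)⁻¹] := by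
  have hdet := V.2
  rw [det_fin_two, h, mul_zero, sub_zero] at hdet
  rw [← eq_inv_of_mul_eq_one_right hdet, ← h]
  exact eta_fin_two _

theorem conj_upper_unipotent_coe {c : K} {U : SL(2, K)} (hU : U.1 = !![1, -c; 0, 1])
    (V : SL(2, K)) :
    (U * V * U⁻¹).1 =
      !![V.1 0 0 - c * V.1 1 0, (V.1 0 0 - c * V.1 1 0) * c + V.1 0 1 - c * V.1 1 1;
        V.1 1 0, V.1 1 0 * c + V.1 1 1] := by
  rw [Matrix.SpecialLinearGroup.coe_mul, Matrix.SpecialLinearGroup.coe_mul,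
    Matrix.SpecialLinearGroup.coe_inv, hU, adjugate_fin_two_of]
  conv_lhs => rw [eta_fin_two V.1, mul_fin_two, mul_fin_two]
  ext i j
  fin_cases i <;> fin_cases j <;> simp <;> ring

/-- The first basis vector stays the common eigenvector of the upper triangular matrices; the
second one becomes an eigenvector of `b`. -/
theorem exists_conj_eq_upper_lower {a b : SL(2, K)} (ha : a.1 1 0 = 0) (hb : b.1 1 0 ≠ 0)
    (htr : b.1.trace = a.1.trace) :
    ∃ (U : SL(2, K)) (g : K), (U * a * U⁻¹).1 = !![a.1 0 0, g; 0, (a.1 0 0)⁻¹] ∧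
      (U * b * U⁻¹).1 = !![a.1 0 0, 0; b.1 1 0, (a.1 0 0)⁻¹] ∧
      ∀ V : SL(2, K), V.1 1 0 = 0 → (U * V * U⁻¹).1 0 0 = V.1 0 0 := by
  have hM := mul_inv_cancel₀ (apply_zero_zero_ne_zero_of_upper ha)
  have ha' := coe_eq_of_upper ha
  have hdet := b.2
  rw [ha', trace_fin_two_of, trace_fin_two] at htr
  rw [det_fin_two] at hdet
  generalize a.1 0 0 = M at *
  generalize a.1 0 1 = g at *
  let c := (b.1 0 0 - M) / b.1 1 0
  have hc : c * b.1 1 0 = b.1 0 0 - M := div_mul_cancel₀ _ hb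
  let U : SL(2, K) := ⟨!![1, -c; 0, 1], by simp [det_fin_two]⟩
  have hU := conj_upper_unipotent_coe (U := U) rfl
  have hb01 : (b.1 0 0 - c * b.1 1 0) * c + b.1 0 1 - c * b.1 1 1 = 0 := by
    apply mul_right_cancel₀ hb
    linear_combination (M - c * b.1 1 0 - b.1 1 1) * hc - hdet + M * htr + hM
  refine ⟨U, M * c + g - c * M⁻¹, ?_, ?_, fun V hV => by rw [hU, hV]; simp⟩
  · rw [hU, ha']
    ext i j
    fin_cases i <;> fin_cases j <;> simp
  · rw [hU]
    ext i j
    fin_cases i <;> fin_cases j <;> simp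
    · linear_combination -hc
    · linear_combination hb01
    · linear_combination hc + htr

end SpecialLinearGroup

section Riley

open Polynomial Matrix

open scoped MatrixGroups

/-- The trace of `claspWord a b` for two matrices `a`, `b` of `SL(2, R)` with the same eigenvalues
`M` and `M⁻¹`, in terms of `s = tr (a b⁻¹) - 1` and `X = M² + M⁻²`. -/
noncomputable def claspTrace {R : Type*} [CommRing R] (s X : R) : R := s ^ 2 - s * X + X + 1

/-- The value of the Riley polynomial of the twist knot at `s = tr (a b⁻¹) - 1` and
`X = M² + M⁻²`: it vanishes exactly for the noncommuting meridian images `a`, `b` that satisfy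
the relation of the knot group. -/
noncomputable def riley {R : Type*} [CommRing R] (n : ℤ) (s X : R) : R :=
  (Chebyshev.S R n).eval (claspTrace s X) - (X - s) * (Chebyshev.S R (n - 1)).eval (claspTrace s X)

theorem riley_eq_mul_sub {R : Type*} [CommRing R] (n : ℤ) (s X : R) :
    riley n s X = (claspTrace s X - (X - s)) * (Chebyshev.S R (n - 1)).eval (claspTrace s X) -
      (Chebyshev.S R (n - 2)).eval (claspTrace s X) := by
  rw [riley, Chebyshev.S_eq R n, eval_sub, eval_mul, eval_X]
  ring

variable {K : Type*} [Field K] {M g r : K} {a b : SL(2, K)}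

theorem claspWord_coe (hM : M ≠ 0) (ha : a.1 = !![M, g; 0, M⁻¹]) (hb : b.1 = !![M, 0; r, M⁻¹]) :
    (claspWord a b).1 = !![1 + g * r * M ^ 2, g * (M⁻¹ - M * (1 - g * r));
      r * (M⁻¹ - (1 - g * r) * M), g * r * M⁻¹ ^ 2 + (1 - g * r) ^ 2] := by
  simp only [claspWord, Matrix.SpecialLinearGroup.coe_mul, Matrix.SpecialLinearGroup.coe_inv, ha,
    hb, adjugate_fin_two_of, mul_fin_two]
  ext i j
  fin_cases i <;> fin_cases j <;> simp <;> field_simp <;> ring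

theorem claspWord_swap_coe (hM : M ≠ 0) (ha : a.1 = !![M, g; 0, M⁻¹])
    (hb : b.1 = !![M, 0; r, M⁻¹]) :
    (claspWord b a).1 = !![(1 - g * r) ^ 2 + g * r * M ^ 2, g * (M - (1 - g * r) * M⁻¹);
      r * (M - M⁻¹ * (1 - g * r)), 1 + g * r * M⁻¹ ^ 2] := by
  simp only [claspWord, Matrix.SpecialLinearGroup.coe_mul, Matrix.SpecialLinearGroup.coe_inv, ha,
    hb, adjugate_fin_two_of, mul_fin_two]
  ext i j
  fin_cases i <;> fin_cases j <;> simp <;> field_simp <;> ring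

theorem claspWord_zpow_coe (hM : M ≠ 0) (ha : a.1 = !![M, g; 0, M⁻¹])
    (hb : b.1 = !![M, 0; r, M⁻¹]) (n : ℤ) :
    (claspWord a b ^ n).1 =
      (Chebyshev.S K (n - 1)).eval (claspTrace (1 - g * r) (M ^ 2 + M⁻¹ ^ 2)) •
        (claspWord a b).1 -
      (Chebyshev.S K (n - 2)).eval (claspTrace (1 - g * r) (M ^ 2 + M⁻¹ ^ 2)) • 1 := by
  have htr : (claspWord a b).1.trace = claspTrace (1 - g * r) (M ^ 2 + M⁻¹ ^ 2) := by
    rw [claspWord_coe hM ha hb, trace_fin_two_of, claspTrace]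
    ring
  rw [coe_zpow_eq_chebyshev_smul_sub, htr]

theorem claspWord_swap_zpow_coe (hM : M ≠ 0) (ha : a.1 = !![M, g; 0, M⁻¹])
    (hb : b.1 = !![M, 0; r, M⁻¹]) (n : ℤ) :
    (claspWord b a ^ n).1 =
      (Chebyshev.S K (n - 1)).eval (claspTrace (1 - g * r) (M ^ 2 + M⁻¹ ^ 2)) •
        (claspWord b a).1 -
      (Chebyshev.S K (n - 2)).eval (claspTrace (1 - g * r) (M ^ 2 + M⁻¹ ^ 2)) • 1 := by
  have htr : (claspWord b a).1.trace = claspTrace (1 - g * r) (M ^ 2 + M⁻¹ ^ 2) := by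
    rw [claspWord_swap_coe hM ha hb, trace_fin_two_of, claspTrace]
    ring
  rw [coe_zpow_eq_chebyshev_smul_sub, htr]

theorem claspWord_zpow_mul_sub_mul_claspWord_zpow (hM : M ≠ 0) (ha : a.1 = !![M, g; 0, M⁻¹])
    (hb : b.1 = !![M, 0; r, M⁻¹]) (n : ℤ) :
    (claspWord a b ^ n * b).1 - (a * claspWord a b ^ n).1 =
      (-riley n (1 - g * r) (M ^ 2 + M⁻¹ ^ 2)) • (a.1 - b.1) := by
  rw [Matrix.SpecialLinearGroup.coe_mul, Matrix.SpecialLinearGroup.coe_mul,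
    claspWord_zpow_coe hM ha hb, riley_eq_mul_sub]
  generalize (Chebyshev.S K (n - 1)).eval (claspTrace (1 - g * r) (M ^ 2 + M⁻¹ ^ 2)) = α
  generalize (Chebyshev.S K (n - 2)).eval (claspTrace (1 - g * r) (M ^ 2 + M⁻¹ ^ 2)) = β
  rw [claspWord_coe hM ha hb, ha, hb, claspTrace, smul_sub_smul_one_fin_two, mul_fin_two,
    mul_fin_two]
  ext i j
  fin_cases i <;> fin_cases j <;> simp <;> field_simp <;> ring

theorem claspWord_zpow_mul_eq_iff (hM : M ≠ 0) (hg : g ≠ 0) (ha : a.1 = !![M, g; 0, M⁻¹])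
    (hb : b.1 = !![M, 0; r, M⁻¹]) (n : ℤ) :
    claspWord a b ^ n * b = a * claspWord a b ^ n ↔
      riley n (1 - g * r) (M ^ 2 + M⁻¹ ^ 2) = 0 := by
  have h := claspWord_zpow_mul_sub_mul_claspWord_zpow hM ha hb n
  constructor
  · intro hrel
    rw [hrel, sub_self] at h
    simpa [ha, hb, hg] using congrFun (congrFun h 0) 1
  · intro hriley
    rw [hriley, neg_zero, zero_smul, sub_eq_zero] at h
    exact Subtype.ext h

/-- This is `det (claspWord a b ^ n) = 1`, simplified by `riley n s X = 0`. -/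
theorem chebyshev_sq_mul_of_riley_eq_zero (hM : M ≠ 0) {n : ℤ} {s : K}
    (h : riley n s (M ^ 2 + M⁻¹ ^ 2) = 0) :
    (Chebyshev.S K (n - 1)).eval (claspTrace s (M ^ 2 + M⁻¹ ^ 2)) ^ 2 *
      ((s + 1 - M ^ 2 - M⁻¹ ^ 2) * (s - M ^ 2) * (s * M ^ 2 - 1)) = M ^ 2 := by
  have hdet := congrArg (eval (claspTrace s (M ^ 2 + M⁻¹ ^ 2)))
    (Chebyshev.S_sq_add_S_sq K (n - 2))
  rw [show n - 2 + 1 = n - 1 by ring] at hdet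
  simp only [eval_add, eval_sub, eval_mul, eval_pow, eval_X, eval_one] at hdet
  rw [riley_eq_mul_sub, sub_eq_zero] at h
  rw [← h] at hdet
  generalize (Chebyshev.S K (n - 1)).eval (claspTrace s (M ^ 2 + M⁻¹ ^ 2)) = α at *
  rw [claspTrace] at hdet
  field_simp at hdet ⊢
  linear_combination hdet

theorem claspWord_zpow_mul_swap_zpow_apply_one_zero (hM : M ≠ 0) (ha : a.1 = !![M, g; 0, M⁻¹])
    (hb : b.1 = !![M, 0; r, M⁻¹]) {n : ℤ} (h : riley n (1 - g * r) (M ^ 2 + M⁻¹ ^ 2) = 0) :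
    (claspWord a b ^ n * claspWord b a ^ n).1 1 0 = 0 := by
  rw [riley_eq_mul_sub, sub_eq_zero] at h
  rw [Matrix.SpecialLinearGroup.coe_mul, claspWord_zpow_coe hM ha hb,
    claspWord_swap_zpow_coe hM ha hb, ← h, claspWord_coe hM ha hb, claspWord_swap_coe hM ha hb,
    smul_sub_smul_one_fin_two, smul_sub_smul_one_fin_two, mul_fin_two]
  generalize (Chebyshev.S K (n - 1)).eval (claspTrace (1 - g * r) (M ^ 2 + M⁻¹ ^ 2)) = α
  simp only [of_apply, cons_val', cons_val_zero, cons_val_one, claspTrace]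
  field_simp
  ring

theorem claspWord_zpow_mul_swap_zpow_apply_zero_zero (hM : M ≠ 0)
    (ha : a.1 = !![M, g; 0, M⁻¹]) (hb : b.1 = !![M, 0; r, M⁻¹]) {n : ℤ}
    (h : riley n (1 - g * r) (M ^ 2 + M⁻¹ ^ 2) = 0) :
    (claspWord a b ^ n * claspWord b a ^ n).1 0 0 * (M ^ 2 * (1 - g * r) - 1) =
      M ^ 2 - (1 - g * r) := by
  have hsq := chebyshev_sq_mul_of_riley_eq_zero hM h
  rw [riley_eq_mul_sub, sub_eq_zero] at h
  rw [Matrix.SpecialLinearGroup.coe_mul, claspWord_zpow_coe hM ha hb,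
    claspWord_swap_zpow_coe hM ha hb, ← h, claspWord_coe hM ha hb, claspWord_swap_coe hM ha hb,
    smul_sub_smul_one_fin_two, smul_sub_smul_one_fin_two, mul_fin_two]
  generalize (Chebyshev.S K (n - 1)).eval (claspTrace (1 - g * r) (M ^ 2 + M⁻¹ ^ 2)) = α at *
  simp only [of_apply, cons_val', cons_val_zero, claspTrace]
  field_simp at hsq ⊢
  linear_combination (M ^ 2 - 1 + g * r) * hsq

/-- The pairs `(L, M)` that come from the irreducible representations of the knot group of the
twist knot. -/
def IsRileyPoint (n : ℤ) (L M : K) : Prop :=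
  ∃ s, riley n s (M ^ 2 + M⁻¹ ^ 2) = 0 ∧ s * (1 + L * M ^ 2) = L + M ^ 2

theorem eq_one_or_isRileyPoint_of_claspWord_zpow_mul_eq {n : ℤ}
    (hrel : claspWord a b ^ n * b = a * claspWord a b ^ n) (ha : a.1 1 0 = 0)
    (hl : (claspWord a b ^ n * claspWord b a ^ n).1 1 0 = 0) :
    (claspWord a b ^ n * claspWord b a ^ n).1 0 0 = 1 ∨
      IsRileyPoint n ((claspWord a b ^ n * claspWord b a ^ n).1 0 0) (a.1 0 0) := by
  by_cases hb : b.1 1 0 = 0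
  · exact .inl (claspWord_zpow_mul_apply_zero_zero_of_triangular one_ne_zero ha hb n)
  have htr : b.1.trace = a.1.trace := by
    have hconj : b = (claspWord a b ^ n)⁻¹ * (a * claspWord a b ^ n) := by
      rw [← hrel, inv_mul_cancel_left]
    rw [hconj, Matrix.SpecialLinearGroup.coe_mul, trace_mul_comm,
      ← Matrix.SpecialLinearGroup.coe_mul, mul_inv_cancel_right]
  obtain ⟨U, g, hUa, hUb, hU⟩ := exists_conj_eq_upper_lower ha hb htr
  have hM := apply_zero_zero_ne_zero_of_upper ha
  have hrel' := congrArg (MulAut.conj U) hrel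
  rw [← hU _ hl]
  change (MulAut.conj U (claspWord a b ^ n * claspWord b a ^ n)).1 0 0 = 1 ∨
    IsRileyPoint n ((MulAut.conj U (claspWord a b ^ n * claspWord b a ^ n)).1 0 0) (a.1 0 0)
  change (MulAut.conj U a).1 = _ at hUa
  change (MulAut.conj U b).1 = _ at hUb
  have hmap (x y : SL(2, K)) :
      MulAut.conj U (claspWord x y) = claspWord (MulAut.conj U x) (MulAut.conj U y) :=
    map_claspWord (MulAut.conj U).toMonoidHom x y
  simp only [map_mul, map_zpow, hmap] at hrel' ⊢
  by_cases hg : g = 0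
  · exact .inl (claspWord_zpow_mul_apply_zero_zero_of_triangular zero_ne_one
      (by rw [hUa, hg]; rfl) (by rw [hUb]; rfl) n)
  · have hriley := (claspWord_zpow_mul_eq_iff hM hg hUa hUb n).1 hrel'
    refine .inr ⟨_, hriley, ?_⟩
    linear_combination claspWord_zpow_mul_swap_zpow_apply_zero_zero hM hUa hUb hriley

theorem IsRileyPoint.exists_claspWord_zpow_mul_eq {n : ℤ} {L M : K} (hM : M ≠ 0)
    (h : IsRileyPoint n L M) :
    ∃ a b : SL(2, K), claspWord a b ^ n * b = a * claspWord a b ^ n ∧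
      a.1 1 0 = 0 ∧ a.1 0 0 = M ∧ (claspWord a b ^ n * claspWord b a ^ n).1 1 0 = 0 ∧
      (claspWord a b ^ n * claspWord b a ^ n).1 0 0 = L := by
  obtain ⟨s, hs, hL⟩ := h
  let a : SL(2, K) := ⟨!![M, 1; 0, M⁻¹], by simp [det_fin_two, hM]⟩
  let b : SL(2, K) := ⟨!![M, 0; 1 - s, M⁻¹], by simp [det_fin_two, hM]⟩
  have hs' : 1 - 1 * (1 - s) = s := by ring
  have hriley : riley n (1 - 1 * (1 - s)) (M ^ 2 + M⁻¹ ^ 2) = 0 := by rw [hs', hs]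
  refine ⟨a, b, (claspWord_zpow_mul_eq_iff hM one_ne_zero rfl rfl n).2 hriley, rfl, rfl,
    claspWord_zpow_mul_swap_zpow_apply_one_zero hM rfl rfl hriley, ?_⟩
  have hsM : s * M ^ 2 - 1 ≠ 0 := fun h0 => by
    have hsq := chebyshev_sq_mul_of_riley_eq_zero hM hs
    rw [h0, mul_zero, mul_zero] at hsq
    exact pow_ne_zero 2 hM hsq.symm
  have hl := claspWord_zpow_mul_swap_zpow_apply_zero_zero (a := a) (b := b) hM rfl rfl hriley
  rw [hs'] at hl
  apply mul_right_cancel₀ hsM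
  linear_combination hl - hL

theorem mem_eigenvalueSet_twistKnot {n : ℤ} (hn : n ≠ 0) (x : Fin 2 → ℂ) :
    x ∈ (twistKnot n).eigenvalueSet ↔ x 1 ≠ 0 ∧ (x 0 = 1 ∨ IsRileyPoint n (x 0) (x 1)) := by
  constructor
  · rintro ⟨ρ, hl, ha, hL, hM⟩
    obtain ⟨b, hrel, hl'⟩ := (exists_hom_twistKnot_iff hn).1 ⟨ρ, rfl, rfl⟩
    rw [← hl'] at hl hL
    rw [← hL, ← hM]
    exact ⟨apply_zero_zero_ne_zero_of_upper ha,
      eq_one_or_isRileyPoint_of_claspWord_zpow_mul_eq hrel ha hl⟩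
  · rintro ⟨hM, hL | hriley⟩
    · let a : SL(2, ℂ) := ⟨!![x 1, 0; 0, (x 1)⁻¹], by simp [det_fin_two, hM]⟩
      obtain ⟨ρ, ha, hl⟩ := (exists_hom_twistKnot_iff hn (a := a) (l := 1)).2
        ⟨a, by simp [claspWord], by simp [claspWord]⟩
      exact ⟨ρ, by simp [hl], by simp [ha, a], by simp [hl, hL], by simp [ha, a]⟩
    · obtain ⟨a, b, hrel, ha, hM', hl, hL⟩ := hriley.exists_claspWord_zpow_mul_eq hM
      obtain ⟨ρ, rfl, hρ⟩ := (exists_hom_twistKnot_iff hn).2 ⟨b, hrel, rfl⟩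
      exact ⟨ρ, by rw [hρ, hl], ha, by rw [hρ, hL], hM'⟩

end Riley

section TwistAPoly

/-- The Lucas sequence of the first kind with parameters `t` and `w`. -/
def lucasSeq {R : Type*} [CommRing R] (t w : R) : ℕ → R
  | 0 => 0
  | 1 => 1
  | j + 2 => t * lucasSeq t w (j + 1) - w * lucasSeq t w j

/-- The numerator of `claspTrace` as a rational function of the eigenvalues. -/
def twistT {R : Type*} [CommRing R] (L M : R) : R :=
  (1 + M ^ 4) + L * (-1 + 2 * M ^ 2 + 2 * M ^ 4 + 2 * M ^ 6 - M ^ 8) + L ^ 2 * (M ^ 4 + M ^ 8)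

/-- The denominator of `claspTrace` as a rational function of the eigenvalues. -/
def twistW {R : Type*} [CommRing R] (L M : R) : R := M ^ 2 * (1 + L * M ^ 2) ^ 2

/-- The A-polynomial of the twist knot `T_{2n}`, evaluated at two elements of a commutative ring;
it is the Riley polynomial, written in the eigenvalues and cleared of denominators. The signs are
those of the normalization of `A_{2n}`. -/
def twistAPoly {R : Type*} [CommRing R] (n : ℤ) (L M : R) : R :=
  if 0 < n then
    (1 + L * M ^ 6) * (1 + L * M ^ 2) * lucasSeq (twistT L M) (twistW L M ^ 2) n.natAbs -
      lucasSeq (twistT L M) (twistW L M ^ 2) (n.natAbs + 1)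
  else
    (1 + L * M ^ 6) * lucasSeq (twistT L M) (twistW L M ^ 2) n.natAbs -
      M ^ 4 * (1 + L * M ^ 2) ^ 3 * lucasSeq (twistT L M) (twistW L M ^ 2) (n.natAbs - 1)

section CommRing

variable {R : Type*} [CommRing R]

theorem lucasSeq_add_two (t w : R) (j : ℕ) :
    lucasSeq t w (j + 2) = t * lucasSeq t w (j + 1) - w * lucasSeq t w j := rfl

theorem map_lucasSeq {S : Type*} [CommRing S] (f : R →+* S) (t w : R) (j : ℕ) :
    f (lucasSeq t w j) = lucasSeq (f t) (f w) j := by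
  induction j using Nat.twoStepInduction with
  | zero => simp [lucasSeq]
  | one => simp [lucasSeq]
  | more j h h' => simp [lucasSeq_add_two, h, h']

theorem lucasSeq_zero_right (t : R) (j : ℕ) : lucasSeq t 0 (j + 1) = t ^ j := by
  induction j with
  | zero => simp [lucasSeq]
  | succ j h => rw [lucasSeq_add_two, h, zero_mul, sub_zero, pow_succ']

theorem lucasSeq_add_mul_sub (a b : R) (j : ℕ) :
    lucasSeq (a + b) (a * b) (j + 1) - a * lucasSeq (a + b) (a * b) j = b ^ j := by
  induction j with
  | zero => simp [lucasSeq]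
  | succ j h =>
    rw [lucasSeq_add_two]
    linear_combination b * h

open Polynomial in
theorem mul_lucasSeq_eq_pow_mul_chebyshev (t w : R) (j : ℕ) :
    w * lucasSeq (t * w) (w ^ 2) j = w ^ j * (Chebyshev.S R (j - 1)).eval t := by
  induction j using Nat.twoStepInduction with
  | zero => simp [lucasSeq, Chebyshev.S_neg_one]
  | one => simp [lucasSeq]
  | more j h h' =>
    have hS := congrArg (eval t) (Chebyshev.S_add_two R ((j : ℤ) - 1))
    rw [eval_sub, eval_mul, eval_X] at hS
    rw [lucasSeq_add_two, show ((j + 2 : ℕ) : ℤ) - 1 = j - 1 + 2 by push_cast; ring, hS,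
      show (j : ℤ) - 1 + 1 = (j + 1 : ℕ) - 1 by push_cast; ring]
    linear_combination t * w * h' - w ^ 2 * h

theorem map_twistT {S : Type*} [CommRing S] (f : R →+* S) (L M : R) :
    f (twistT L M) = twistT (f L) (f M) := by
  simp [twistT, map_ofNat]

theorem map_twistAPoly {S : Type*} [CommRing S] (f : R →+* S) (n : ℤ) (L M : R) :
    f (twistAPoly n L M) = twistAPoly n (f L) (f M) := by
  unfold twistAPoly
  split_ifs <;> simp [map_lucasSeq, map_twistT, twistW]

theorem twistAPoly_zero_left_of_pos {n : ℤ} (hn : 0 < n) (M : R) :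
    twistAPoly n 0 M = -M ^ (4 * n.natAbs) := by
  have h := lucasSeq_add_mul_sub 1 (M ^ 4) n.natAbs
  rw [← pow_mul] at h
  simp only [twistAPoly, if_pos hn, twistT, twistW]
  ring_nf at h ⊢
  linear_combination -h

theorem twistAPoly_zero_left_of_neg {n : ℤ} (hn : n < 0) (M : R) : twistAPoly n 0 M = 1 := by
  obtain ⟨j, rfl⟩ : ∃ j : ℕ, n = -(j + 1 : ℕ) := ⟨n.natAbs - 1, by omega⟩
  have h := lucasSeq_add_mul_sub (M ^ 4) 1 j
  rw [one_pow] at h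
  simp only [twistAPoly, if_neg hn.not_gt, twistT, twistW, Int.natAbs_neg, Int.natAbs_natCast,
    Nat.add_sub_cancel]
  ring_nf at h ⊢
  linear_combination h

theorem twistAPoly_zero_right_of_pos {n : ℤ} (hn : 0 < n) (L : R) :
    twistAPoly n L 0 = L * (1 - L) ^ (n.natAbs - 1) := by
  obtain ⟨j, rfl⟩ : ∃ j : ℕ, n = (j + 1 : ℕ) := ⟨n.natAbs - 1, by omega⟩
  simp only [twistAPoly, if_pos hn, twistT, twistW, Int.natAbs_natCast, Nat.add_sub_cancel]
  simp only [zero_mul, ne_eq, OfNat.ofNat_ne_zero, not_false_eq_true, zero_pow, mul_zero,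
    lucasSeq_zero_right]
  ring

theorem twistAPoly_zero_right_of_neg {n : ℤ} (hn : n < 0) (L : R) :
    twistAPoly n L 0 = (1 - L) ^ (n.natAbs - 1) := by
  obtain ⟨j, rfl⟩ : ∃ j : ℕ, n = -(j + 1 : ℕ) := ⟨n.natAbs - 1, by omega⟩
  simp only [twistAPoly, if_neg hn.not_gt, twistT, twistW, Int.natAbs_neg, Int.natAbs_natCast,
    Nat.add_sub_cancel]
  simp only [zero_mul, ne_eq, OfNat.ofNat_ne_zero, not_false_eq_true, zero_pow, mul_zero,
    lucasSeq_zero_right]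
  ring

theorem claspTrace_mul_twistW {L M s x : R} (hx : x * M ^ 2 = M ^ 4 + 1)
    (hs : s * (1 + L * M ^ 2) = L + M ^ 2) : claspTrace s x * twistW L M = twistT L M := by
  rw [claspTrace, twistW, twistT]
  linear_combination
    (M ^ 2 * (s * (1 + L * M ^ 2) + L + M ^ 2) - x * M ^ 2 * (1 + L * M ^ 2)) * hs +
    (1 + L * M ^ 2) * (1 + L * M ^ 2 - L - M ^ 2) * hx

theorem twistW_mul_twistAPoly_of_pos {n : ℤ} (hn : 0 < n) {L M s x : R}
    (hx : x * M ^ 2 = M ^ 4 + 1) (hs : s * (1 + L * M ^ 2) = L + M ^ 2) :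
    twistW L M * twistAPoly n L M = -twistW L M ^ (n.natAbs + 1) * riley n s x := by
  obtain ⟨k, rfl⟩ : ∃ k : ℕ, n = k := ⟨n.natAbs, by omega⟩
  have h := mul_lucasSeq_eq_pow_mul_chebyshev (claspTrace s x) (twistW L M) k
  have h' := mul_lucasSeq_eq_pow_mul_chebyshev (claspTrace s x) (twistW L M) (k + 1)
  have hxs : (x - s) * twistW L M = (1 + L * M ^ 6) * (1 + L * M ^ 2) := by
    rw [twistW]
    linear_combination (1 + L * M ^ 2) ^ 2 * hx - M ^ 2 * (1 + L * M ^ 2) * hs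
  rw [claspTrace_mul_twistW hx hs] at h h'
  rw [Nat.cast_add, Nat.cast_one, add_sub_cancel_right] at h'
  rw [twistAPoly, if_pos hn, Int.natAbs_natCast, riley]
  linear_combination (1 + L * M ^ 6) * (1 + L * M ^ 2) * h - h' -
    twistW L M ^ k * (Polynomial.Chebyshev.S R (k - 1)).eval (claspTrace s x) * hxs

theorem twistW_mul_twistAPoly_of_neg {n : ℤ} (hn : n < 0) {L M s x : R}
    (hx : x * M ^ 2 = M ^ 4 + 1) (hs : s * (1 + L * M ^ 2) = L + M ^ 2) :
    twistW L M * twistAPoly n L M =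
      twistW L M ^ n.natAbs * (M ^ 2 * (1 + L * M ^ 2)) * riley n s x := by
  obtain ⟨j, rfl⟩ : ∃ j : ℕ, n = -((j : ℤ) + 1) := ⟨n.natAbs - 1, by omega⟩
  have habs : (-((j : ℤ) + 1)).natAbs = j + 1 := by omega
  have h := mul_lucasSeq_eq_pow_mul_chebyshev (claspTrace s x) (twistW L M) j
  have h' := mul_lucasSeq_eq_pow_mul_chebyshev (claspTrace s x) (twistW L M) (j + 1)
  have hxs : (x - s) * (M ^ 2 * (1 + L * M ^ 2)) = 1 + L * M ^ 6 := by
    linear_combination (1 + L * M ^ 2) * hx - M ^ 2 * hs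
  have hW : M ^ 4 * (1 + L * M ^ 2) ^ 3 = M ^ 2 * (1 + L * M ^ 2) * twistW L M := by
    rw [twistW]; ring
  rw [claspTrace_mul_twistW hx hs] at h h'
  rw [Nat.cast_add, Nat.cast_one, add_sub_cancel_right] at h'
  rw [twistAPoly, if_neg hn.not_gt, riley, habs, Nat.add_sub_cancel,
    show -((j : ℤ) + 1) - 1 = -j - 2 by ring, Polynomial.Chebyshev.S_neg_sub_two,
    Polynomial.Chebyshev.S_neg, add_sub_assoc, show (1 : ℤ) - 2 = -1 by norm_num,
    ← sub_eq_add_neg, Polynomial.eval_neg, Polynomial.eval_neg, hW]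
  linear_combination (1 + L * M ^ 6) * h' - M ^ 2 * (1 + L * M ^ 2) * twistW L M * h -
    twistW L M ^ (j + 1) * (Polynomial.Chebyshev.S R j).eval (claspTrace s x) * hxs

end CommRing

section Field

variable {K : Type*} [Field K] {L M s : K}

theorem exists_twistAPoly_eq_riley (K : Type*) [Field K] {n : ℤ} (hn : n ≠ 0) :
    ∃ (ε : K) (p q : ℕ), ε ≠ 0 ∧ ∀ L M s : K, M ≠ 0 → 1 + L * M ^ 2 ≠ 0 →
      s * (1 + L * M ^ 2) = L + M ^ 2 →
      twistAPoly n L M = ε * M ^ p * (1 + L * M ^ 2) ^ q * riley n s (M ^ 2 + M⁻¹ ^ 2) := by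
  have hx {M : K} (hM : M ≠ 0) : (M ^ 2 + M⁻¹ ^ 2) * M ^ 2 = M ^ 4 + 1 := by
    field_simp
  have hW {L M : K} (hM : M ≠ 0) (hD : 1 + L * M ^ 2 ≠ 0) : twistW L M ≠ 0 :=
    mul_ne_zero (pow_ne_zero _ hM) (pow_ne_zero _ hD)
  rcases lt_or_gt_of_ne hn with hn | hn
  · obtain ⟨j, hj⟩ : ∃ j, n.natAbs = j + 1 := ⟨n.natAbs - 1, by omega⟩
    refine ⟨1, 2 * j + 2, 2 * j + 1, one_ne_zero, fun L M s hM hD hs => ?_⟩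
    apply mul_left_cancel₀ (hW hM hD)
    rw [twistW_mul_twistAPoly_of_neg hn (hx hM) hs, hj, twistW, mul_pow, ← pow_mul, ← pow_mul]
    ring
  · refine ⟨-1, 2 * n.natAbs, 2 * n.natAbs, neg_ne_zero.2 one_ne_zero, fun L M s hM hD hs => ?_⟩
    apply mul_left_cancel₀ (hW hM hD)
    rw [twistW_mul_twistAPoly_of_pos hn (hx hM) hs, twistW, mul_pow, ← pow_mul, ← pow_mul]
    ring

theorem twistAPoly_eq_mul_pow_of_one_add_mul_eq_zero {R : Type*} [CommRing R] {n : ℤ}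
    (hn : n ≠ 0) {L M : R} (h : 1 + L * M ^ 2 = 0) :
    twistAPoly n L M = (if 0 < n then -twistT L M else 1 + L * M ^ 6) *
      twistT L M ^ (n.natAbs - 1) := by
  obtain ⟨j, hj⟩ : ∃ j, n.natAbs = j + 1 := ⟨n.natAbs - 1, by omega⟩
  have hW : twistW L M ^ 2 = 0 := by rw [twistW, h]; ring
  rw [twistAPoly, hj, hW, h]
  simp only [lucasSeq_zero_right, Nat.add_sub_cancel]
  split_ifs <;> ring

theorem twistAPoly_eq_zero_of_isRileyPoint {n : ℤ} (hn : n ≠ 0) (hM : M ≠ 0)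
    (h : IsRileyPoint n L M) : (L - 1) * twistAPoly n L M = 0 := by
  obtain ⟨s, hs, hL⟩ := h
  by_cases hD : 1 + L * M ^ 2 = 0
  · have hLM : L = -M ^ 2 := by linear_combination s * hD - hL
    have hfactor : (L - 1) * (M ^ 2 - 1) = 0 := by
      rw [hLM] at hD ⊢
      linear_combination hD
    rcases mul_eq_zero.1 hfactor with hL1 | hM1
    · rw [hL1, zero_mul]
    · have hT : twistT L M = 0 := by
        rw [twistT, hLM]
        linear_combination (M ^ 10 + 2 * M ^ 8 + M ^ 6 - M ^ 4 - 2 * M ^ 2 - 1) * hM1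
      have h6 : 1 + L * M ^ 6 = 0 := by
        rw [hLM]
        linear_combination -(M ^ 2 + 1) * (M ^ 4 + 1) * hM1
      rw [twistAPoly_eq_mul_pow_of_one_add_mul_eq_zero hn hD, hT, h6]
      simp
  · obtain ⟨ε, p, q, -, hA⟩ := exists_twistAPoly_eq_riley K hn
    rw [hA L M s hM hD hL, hs, mul_zero, mul_zero]

theorem one_add_mul_sq_ne_zero_of_twistAPoly_eq_zero {n : ℤ} (hn : n ≠ 0) (hM4 : M ^ 4 ≠ 1)
    (h : twistAPoly n L M = 0) : 1 + L * M ^ 2 ≠ 0 := by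
  intro hD
  have hT : twistT L M * M ^ 2 = (M ^ 4 - 1) ^ 2 := by
    rw [twistT]
    linear_combination (L * (M ^ 4 + M ^ 8) - 1 + M ^ 2 + 2 * M ^ 4 + M ^ 6 - M ^ 8) * hD
  have hT0 : twistT L M ≠ 0 :=
    left_ne_zero_of_mul (hT ▸ pow_ne_zero 2 (sub_ne_zero.2 hM4))
  rw [twistAPoly_eq_mul_pow_of_one_add_mul_eq_zero hn hD] at h
  refine mul_ne_zero ?_ (pow_ne_zero _ hT0) h
  split_ifs
  · exact neg_ne_zero.2 hT0
  · intro h6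
    exact hM4 (by linear_combination M ^ 4 * hD - h6)

theorem isRileyPoint_of_twistAPoly_eq_zero {n : ℤ} (hn : n ≠ 0) (hM : M ≠ 0) (hM4 : M ^ 4 ≠ 1)
    (h : twistAPoly n L M = 0) : IsRileyPoint n L M := by
  have hD := one_add_mul_sq_ne_zero_of_twistAPoly_eq_zero hn hM4 h
  obtain ⟨ε, p, q, hε, hA⟩ := exists_twistAPoly_eq_riley K hn
  have hs : (L + M ^ 2) / (1 + L * M ^ 2) * (1 + L * M ^ 2) = L + M ^ 2 := div_mul_cancel₀ _ hD
  refine ⟨_, ?_, hs⟩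
  rw [hA L M _ hM hD hs] at h
  exact (mul_eq_zero.1 h).resolve_left
    (mul_ne_zero (mul_ne_zero hε (pow_ne_zero _ hM)) (pow_ne_zero _ hD))

end Field

end TwistAPoly

section Separability

open Polynomial

theorem separable_map_iff_isUnit_resultant {R S : Type*} [CommRing R] [CommRing S] [Nontrivial S]
    {p : R[X]} (hp : p.Monic) (φ : R →+* S) :
    (p.map φ).Separable ↔ IsUnit (φ (resultant p (derivative p))) := by
  have hm : (p.map φ).Monic := hp.map φ
  obtain ⟨k, hk⟩ := Nat.exists_eq_add_of_le (natDegree_map_le (p := derivative p) (f := φ))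
  rw [separable_def, ← isUnit_resultant_iff_isCoprime hm, derivative_map,
    ← resultant_map_map p (derivative p), hk, resultant_add_right_deg _ _ _ _ _ le_rfl,
    ← hp.natDegree_map φ, coeff_natDegree, hm.leadingCoeff, one_pow, one_mul]

theorem finite_setOf_not_separable {K : Type*} [Field K] {p : K[X][X]} (hp : p.Monic) {ξ₀ : K}
    (h₀ : (p.map (evalRingHom ξ₀)).Separable) :
    {ξ | ¬ (p.map (evalRingHom ξ)).Separable}.Finite := by
  classical
  have hres : resultant p (derivative p) ≠ 0 := fun h => by
    simp [separable_map_iff_isUnit_resultant hp, h] at h₀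
  refine (resultant p (derivative p)).roots.toFinset.finite_toSet.subset fun ξ hξ => ?_
  simpa [separable_map_iff_isUnit_resultant hp, hres] using hξ

theorem separable_iff_eval_derivative_ne_zero {K : Type*} [Field K] [IsAlgClosed K] {p : K[X]} :
    p.Separable ↔ ∀ z, p.eval z = 0 → p.derivative.eval z ≠ 0 := by
  rw [separable_def, isCoprime_iff_aeval_ne_zero_of_isAlgClosed K K]
  simp only [coe_aeval_eq_eval, or_iff_not_imp_left, not_not]

theorem separable_neg {R : Type*} [CommRing R] {p : R[X]} : (-p).Separable ↔ p.Separable := by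
  rw [separable_def, separable_def, derivative_neg, IsCoprime.neg_neg_iff]

theorem hasDerivAt_mul_eval {𝕜 : Type*} [NontriviallyNormedField 𝕜] {p : 𝕜[X]} {u v : 𝕜 → 𝕜}
    {z u' v' : 𝕜} (hu : HasDerivAt u u' z) (hv : HasDerivAt v v' z) (hp : p.eval (u z) = 0) :
    HasDerivAt (fun w => v w * p.eval (u w)) (v z * (p.derivative.eval (u z) * u')) z := by
  have h := hv.mul ((p.hasDerivAt (u z)).comp z hu)
  rwa [Function.comp_apply, hp, mul_zero, zero_add] at h

section CommRing

variable {R : Type*} [CommRing R]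

theorem map_riley {S : Type*} [CommRing S] (f : R →+* S) (n : ℤ) (s x : R) :
    f (riley n s x) = riley n (f s) (f x) := by
  have h (m : ℤ) (t : R) : f ((Chebyshev.S R m).eval t) = (Chebyshev.S S m).eval (f t) := by
    rw [← Chebyshev.map_S f, eval_map, eval₂_hom]
  simp [riley, h, claspTrace]

theorem eval_riley_X_C (n : ℤ) (x s : R) : (riley n (X : R[X]) (C x)).eval s = riley n s x := by
  simpa using map_riley (evalRingHom s) n (X : R[X]) (C x)

theorem eval_twistAPoly_X_C (n : ℤ) (L M : R) :
    (twistAPoly n (X : R[X]) (C M)).eval L = twistAPoly n L M := by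
  simpa using map_twistAPoly (evalRingHom L) n (X : R[X]) (C M)

theorem riley_add_one (n : ℤ) (s x : R) :
    riley (n + 1) s x = claspTrace s x * riley n s x - riley (n - 1) s x := by
  have h := congrArg (eval (claspTrace s x)) (Chebyshev.S_add_one R n)
  have h' := congrArg (eval (claspTrace s x)) (Chebyshev.S_add_one R (n - 1))
  rw [eval_sub, eval_mul, eval_X] at h h'
  rw [sub_add_cancel] at h'
  rw [riley, riley, riley, h, add_sub_cancel_right, h']
  ring

theorem riley_zero (s x : R) : riley 0 s x = 1 := by
  simp [riley, Chebyshev.S_neg_one]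

theorem riley_neg_one (s x : R) : riley (-1) s x = x - s := by
  simp [riley, Chebyshev.S_neg_one, Chebyshev.S_neg_two]

theorem eq_of_recurrence {t : R} {F G : ℤ → R} (hF : ∀ n, F (n + 1) = t * F n - F (n - 1))
    (hG : ∀ n, G (n + 1) = t * G n - G (n - 1)) (h0 : F 0 = G 0) (h1 : F (-1) = G (-1)) (n : ℤ) :
    F n = G n := by
  suffices h : F n = G n ∧ F (n - 1) = G (n - 1) from h.1
  induction n with
  | zero => exact ⟨h0, h1⟩
  | succ n ih =>
    rw [add_sub_cancel_right]
    exact ⟨by rw [hF, hG, ih.1, ih.2], ih.1⟩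
  | pred n ih =>
    have hF' := hF (-(n : ℤ) - 1)
    have hG' := hG (-(n : ℤ) - 1)
    rw [sub_add_cancel] at hF' hG'
    exact ⟨ih.2, by linear_combination t * ih.2 - ih.1 + hF' - hG'⟩

theorem riley_one_left (n : ℤ) (x : R) : riley n 1 x = 2 * n + 1 - n * x := by
  have ht : claspTrace (1 : R) x = 2 := by rw [claspTrace]; ring
  refine eq_of_recurrence (t := 2) (F := fun n => riley n 1 x) (G := fun n => 2 * n + 1 - n * x)
    (fun n => by rw [riley_add_one, ht]) (fun n => ?_) ?_ ?_ n
  · push_cast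
    ring
  · simp [riley_zero]
  · rw [riley_neg_one]
    push_cast
    ring

theorem riley_neg_two_mul {K : Type*} [Field K] (n : ℤ) {ζ : K} (hζ : ζ ≠ 0) :
    (ζ - 1) * riley n (ζ + ζ⁻¹ - 1) (-2) = ζ ^ (2 * n + 1) - ζ ^ (-(2 * n)) := by
  have ht : claspTrace (ζ + ζ⁻¹ - 1) (-2) = ζ ^ (2 : ℤ) + ζ ^ (-2 : ℤ) := by
    rw [claspTrace, zpow_neg, zpow_ofNat]
    field_simp
    ring
  refine eq_of_recurrence (t := ζ ^ (2 : ℤ) + ζ ^ (-2 : ℤ))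
    (F := fun n => (ζ - 1) * riley n (ζ + ζ⁻¹ - 1) (-2))
    (G := fun n => ζ ^ (2 * n + 1) - ζ ^ (-(2 * n))) (fun n => ?_) (fun n => ?_) ?_ ?_ n
  · rw [riley_add_one, ht]
    ring
  · have e₁ : (2 : ℤ) + (2 * n + 1) = 2 * (n + 1) + 1 := by ring
    have e₂ : (2 : ℤ) + -(2 * n) = -(2 * (n - 1)) := by ring
    have e₃ : (-2 : ℤ) + (2 * n + 1) = 2 * (n - 1) + 1 := by ring
    have e₄ : (-2 : ℤ) + -(2 * n) = -(2 * (n + 1)) := by ring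
    rw [add_mul, mul_sub, mul_sub, ← zpow_add₀ hζ, ← zpow_add₀ hζ, ← zpow_add₀ hζ, ← zpow_add₀ hζ,
      e₁, e₂, e₃, e₄]
    ring
  · simp [riley_zero]
  · have e₁ : 2 * (-1 : ℤ) + 1 = -1 := by norm_num
    have e₂ : -(2 * (-1 : ℤ)) = 2 := by norm_num
    rw [riley_neg_one, e₁, e₂, zpow_neg_one, zpow_ofNat]
    field_simp
    ring

theorem monic_mul_sub {t p q : R[X]} (ht : t.Monic) (hp : p.Monic)
    (hq : q.natDegree < t.natDegree + p.natDegree) :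
    (t * p - q).Monic ∧ (t * p - q).natDegree = t.natDegree + p.natDegree := by
  rw [← ht.natDegree_mul hp] at hq ⊢
  exact ⟨(ht.mul hp).sub_of_left (degree_lt_degree hq),
    natDegree_sub_eq_left_of_natDegree_lt hq⟩

theorem monic_of_recurrence {t : R[X]} (ht : t.Monic) (ht0 : 0 < t.natDegree) {F : ℕ → R[X]}
    (hF : ∀ j, F (j + 2) = t * F (j + 1) - F j) (h0 : (F 0).Monic) (h1 : (F 1).Monic)
    (hdeg : (F 0).natDegree ≤ (F 1).natDegree) (j : ℕ) : (F j).Monic := by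
  suffices h : (F j).Monic ∧ (F (j + 1)).Monic ∧ (F j).natDegree ≤ (F (j + 1)).natDegree from h.1
  induction j with
  | zero => exact ⟨h0, h1, hdeg⟩
  | succ j ih =>
    obtain ⟨hm, hd⟩ := monic_mul_sub ht ih.2.1 (q := F j) (by omega)
    rw [hF]
    exact ⟨ih.2.1, hm, by omega⟩

variable [Nontrivial R]

theorem monic_claspTrace (x : R) : (claspTrace (X : R[X]) (C x)).Monic ∧
    (claspTrace (X : R[X]) (C x)).natDegree = 2 := by
  have h : claspTrace (X : R[X]) (C x) = X ^ 2 + C (-x) * X + C (x + 1) := by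
    rw [claspTrace]
    simp only [C_neg, C_add, C_1]
    ring
  rw [h]
  exact ⟨by monicity!, by compute_degree!⟩

theorem monic_riley_or_monic_neg_riley (n : ℤ) (x : R) :
    (riley n (X : R[X]) (C x)).Monic ∨ (-riley n (X : R[X]) (C x)).Monic := by
  obtain ⟨ht, hd⟩ := monic_claspTrace x
  have hpred : -riley (-1) (X : R[X]) (C x) = X - C x := by rw [riley_neg_one, neg_sub]
  have hdeg : (riley (-1) (X : R[X]) (C x)).natDegree = 1 := by
    rw [← natDegree_neg, hpred, natDegree_X_sub_C]
  rcases le_or_gt 0 n with hn | hn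
  · lift n to ℕ using hn
    refine .inl (monic_of_recurrence ht (by omega) (F := fun j => riley j X (C x))
      (fun j => ?_) (by simp [riley_zero]) ?_ (by simp [riley_zero]) n)
    · have h := riley_add_one (j + 1 : ℤ) (X : R[X]) (C x)
      rw [add_sub_cancel_right] at h
      exact_mod_cast h
    · have h := riley_add_one 0 (X : R[X]) (C x)
      rw [riley_zero, zero_add, zero_sub] at h
      simpa [h] using (monic_mul_sub ht monic_one (q := riley (-1) X (C x)) (by simp [hd, hdeg])).1
  · obtain ⟨j, rfl⟩ : ∃ j : ℕ, n = -(j : ℤ) - 1 := ⟨(-n - 1).toNat, by omega⟩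
    have hstep (m : ℤ) : -riley (m - 1) (X : R[X]) (C x) =
        claspTrace X (C x) * -riley m X (C x) - -riley (m + 1) X (C x) := by
      rw [riley_add_one]
      ring
    have h2 := hstep (-1)
    rw [hpred, neg_add_cancel, riley_zero] at h2
    obtain ⟨hm2, hd2⟩ := monic_mul_sub ht (monic_X_sub_C x) (q := -1) (by simp [hd])
    rw [← h2] at hm2 hd2
    refine .inr (monic_of_recurrence ht (by omega) (F := fun j => -riley (-(j : ℤ) - 1) X (C x))
      (fun j => ?_) ?_ ?_ ?_ j)
    · convert hstep (-((j + 1 : ℕ) : ℤ) - 1) using 4 <;> push_cast <;> ring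
    · simpa [hpred] using monic_X_sub_C x
    · simpa using hm2
    · simpa [hpred] using hd2.ge.trans' (by simp)

end CommRing

theorem exists_add_inv_eq {K : Type*} [Field K] [IsAlgClosed K] (c : K) :
    ∃ ζ : K, ζ ≠ 0 ∧ ζ + ζ⁻¹ = c := by
  have hdeg : (X ^ 2 - C c * X + 1 : K[X]).degree = 2 := by compute_degree!
  obtain ⟨ζ, hζ⟩ := IsAlgClosed.exists_root (X ^ 2 - C c * X + 1 : K[X]) (by simp [hdeg])
  have hζ' : ζ ^ 2 - c * ζ + 1 = 0 := by simpa using hζ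
  have hζ0 : ζ ≠ 0 := by
    rintro rfl
    simp at hζ'
  refine ⟨ζ, hζ0, ?_⟩
  field_simp
  linear_combination hζ'

/-- The roots are the values `ζ + ζ⁻¹ - 1` for the roots of unity `ζ ^ (4 * n + 1) = 1`. -/
theorem separable_riley_neg_two (n : ℤ) : (riley n (X : ℂ[X]) (C (-2))).Separable := by
  refine separable_iff_eval_derivative_ne_zero.2 fun s hs hs' => ?_
  obtain ⟨ζ, hζ, hζs⟩ := exists_add_inv_eq (s + 1)
  obtain rfl : ζ + ζ⁻¹ - 1 = s := by rw [hζs, add_sub_cancel_right]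
  have hu : HasDerivAt (fun w : ℂ => w + w⁻¹ - 1) (1 + -(ζ ^ 2)⁻¹) ζ :=
    ((hasDerivAt_id ζ).add (hasDerivAt_inv hζ)).sub_const 1
  have hderiv := hasDerivAt_mul_eval hu ((hasDerivAt_id ζ).sub_const 1) hs
  have hzpow : HasDerivAt (fun w : ℂ => w ^ (2 * n + 1) - w ^ (-(2 * n)))
      (((2 * n + 1 : ℤ) : ℂ) * ζ ^ (2 * n + 1 - 1) - ((-(2 * n) : ℤ) : ℂ) * ζ ^ (-(2 * n) - 1)) ζ :=
    (hasDerivAt_zpow _ ζ (.inl hζ)).sub (hasDerivAt_zpow _ ζ (.inl hζ))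
  have heq : (fun w : ℂ => (id w - 1) * (riley n (X : ℂ[X]) (C (-2))).eval (w + w⁻¹ - 1))
      =ᶠ[nhds ζ] fun w => w ^ (2 * n + 1) - w ^ (-(2 * n)) := by
    filter_upwards [isOpen_ne.mem_nhds hζ] with w hw
    rw [eval_riley_X_C]
    exact riley_neg_two_mul n hw
  have hzero := hderiv.unique (hzpow.congr_of_eventuallyEq heq)
  have hpow := riley_neg_two_mul n hζ
  rw [hs', zero_mul, mul_zero, zpow_sub_one₀ hζ, zpow_sub_one₀ hζ] at hzero
  rw [eval_riley_X_C] at hs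
  rw [hs, mul_zero] at hpow
  have hcast : ((4 * n + 1 : ℤ) : ℂ) * (ζ ^ (-(2 * n)) * ζ⁻¹) = 0 := by
    push_cast at hzero ⊢
    linear_combination (2 * n + 1) * ζ⁻¹ * hpow - hzero
  have hne : (4 * n + 1 : ℤ) ≠ 0 := by omega
  exact mul_ne_zero (Int.cast_ne_zero.2 hne)
    (mul_ne_zero (zpow_ne_zero _ hζ) (inv_ne_zero hζ)) hcast

theorem finite_setOf_not_separable_riley (n : ℤ) :
    {ξ : ℂ | ¬ (riley n (X : ℂ[X]) (C ξ)).Separable}.Finite := by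
  have hmap (ξ : ℂ) : (riley n (X : ℂ[X][X]) (C X)).map (evalRingHom ξ) =
      riley n (X : ℂ[X]) (C ξ) := by
    simpa using map_riley (mapRingHom (evalRingHom ξ)) n (X : ℂ[X][X]) (C X)
  rcases monic_riley_or_monic_neg_riley n (X : ℂ[X]) with hm | hm
  · simpa only [hmap] using finite_setOf_not_separable hm (ξ₀ := -2)
      (by simpa only [hmap] using separable_riley_neg_two n)
  · simpa only [Polynomial.map_neg, hmap, separable_neg] using
      finite_setOf_not_separable hm (ξ₀ := -2)
        (by simpa only [Polynomial.map_neg, hmap, separable_neg] using separable_riley_neg_two n)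

theorem finite_setOf_sq_add_inv_sq_mem {K : Type*} [Field K] {Z : Set K} (hZ : Z.Finite) :
    {M : K | M ^ 2 + M⁻¹ ^ 2 ∈ Z}.Finite := by
  classical
  refine Set.Finite.preimage' hZ fun ξ _ => ?_
  have hp : (X * (X ^ 4 - C ξ * X ^ 2 + 1) : K[X]) ≠ 0 := by
    refine mul_ne_zero X_ne_zero fun h => ?_
    simpa using congrArg (eval 0) h
  refine (X * (X ^ 4 - C ξ * X ^ 2 + 1) : K[X]).roots.toFinset.finite_toSet.subset ?_
  rintro M rfl
  rw [Finset.mem_coe, Multiset.mem_toFinset, mem_roots hp, IsRoot.def]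
  simp only [eval_mul, eval_add, eval_sub, eval_pow, eval_X, eval_C, eval_one]
  rcases eq_or_ne M 0 with rfl | hM
  · simp
  · field_simp
    ring

theorem twistAPoly_one_left_ne_zero {K : Type*} [Field K] {n : ℤ} (hn : n ≠ 0) {M : K}
    (hM : M ≠ 0) (hM4 : M ^ 4 ≠ 1) (h : n * (M ^ 2 + M⁻¹ ^ 2) ≠ 2 * n + 1) :
    twistAPoly n 1 M ≠ 0 := by
  intro hA
  have hD := one_add_mul_sq_ne_zero_of_twistAPoly_eq_zero hn hM4 hA
  obtain ⟨s, hs, hsL⟩ := isRileyPoint_of_twistAPoly_eq_zero hn hM hM4 hA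
  have hs1 : s = 1 := by
    apply mul_right_cancel₀ hD
    linear_combination hsL
  rw [hs1, riley_one_left] at hs
  exact h (by linear_combination -hs)

theorem separable_twistAPoly {n : ℤ} (hn : n ≠ 0) {M : ℂ} (hM : M ≠ 0) (hM4 : M ^ 4 ≠ 1)
    (h : (riley n (X : ℂ[X]) (C (M ^ 2 + M⁻¹ ^ 2))).Separable) :
    (twistAPoly n (X : ℂ[X]) (C M)).Separable := by
  refine separable_iff_eval_derivative_ne_zero.2 fun L hL hL' => ?_
  rw [eval_twistAPoly_X_C] at hL
  have hD := one_add_mul_sq_ne_zero_of_twistAPoly_eq_zero hn hM4 hL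
  obtain ⟨s, hs, hsL⟩ := isRileyPoint_of_twistAPoly_eq_zero hn hM hM4 hL
  obtain rfl : s = (L + M ^ 2) / (1 + L * M ^ 2) := eq_div_of_mul_eq hD hsL
  obtain ⟨ε, p, q, hε, hriley⟩ := exists_twistAPoly_eq_riley ℂ hn
  have hden : HasDerivAt (fun w : ℂ => 1 + w * M ^ 2) (M ^ 2) L := by
    simpa using ((hasDerivAt_id L).mul_const (M ^ 2)).const_add 1
  have hu : HasDerivAt (fun w : ℂ => (w + M ^ 2) / (1 + w * M ^ 2))
      ((1 * (1 + L * M ^ 2) - (L + M ^ 2) * M ^ 2) / (1 + L * M ^ 2) ^ 2) L :=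
    ((hasDerivAt_id L).add_const (M ^ 2)).div hden hD
  rw [← eval_riley_X_C] at hs
  have hderiv := hasDerivAt_mul_eval hu ((hden.fun_pow q).const_mul (ε * M ^ p)) hs
  have heq : (fun w => (twistAPoly n (X : ℂ[X]) (C M)).eval w) =ᶠ[nhds L]
      fun w => ε * M ^ p * (1 + w * M ^ 2) ^ q *
        (riley n (X : ℂ[X]) (C (M ^ 2 + M⁻¹ ^ 2))).eval ((w + M ^ 2) / (1 + w * M ^ 2)) := by
    filter_upwards [hden.continuousAt.eventually_ne hD] with w hw
    rw [eval_twistAPoly_X_C, eval_riley_X_C, hriley w M _ hM hw (div_mul_cancel₀ _ hw)]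
  have hzero := ((twistAPoly n (X : ℂ[X]) (C M)).hasDerivAt L).unique
    (hderiv.congr_of_eventuallyEq heq)
  have hs' := separable_iff_eval_derivative_ne_zero.1 h _ hs
  have hu' : 1 * (1 + L * M ^ 2) - (L + M ^ 2) * M ^ 2 ≠ 0 := by
    rw [show 1 * (1 + L * M ^ 2) - (L + M ^ 2) * M ^ 2 = 1 - M ^ 4 by ring]
    exact sub_ne_zero.2 hM4.symm
  rw [hL'] at hzero
  exact mul_ne_zero (mul_ne_zero (mul_ne_zero hε (pow_ne_zero p hM)) (pow_ne_zero q hD))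
    (mul_ne_zero hs' (div_ne_zero hu' (pow_ne_zero 2 hD))) hzero.symm

theorem finite_setOf_pow_four_eq_one : {M : ℂ | M ^ 4 = 1}.Finite :=
  (nthRoots 4 (1 : ℂ)).toFinset.finite_toSet.subset fun M hM => by
    simpa [mem_nthRoots] using hM

theorem finite_setOf_not_separable_X_sub_one_mul_twistAPoly {n : ℤ} (hn : n ≠ 0) :
    {M : ℂ | ¬ ((X - 1) * twistAPoly n (X : ℂ[X]) (C M)).Separable}.Finite := by
  have hnC : (n : ℂ) ≠ 0 := Int.cast_ne_zero.2 hn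
  refine (((Set.finite_singleton 0).union finite_setOf_pow_four_eq_one).union
    (finite_setOf_sq_add_inv_sq_mem ((finite_setOf_not_separable_riley n).union
      (Set.finite_singleton ((2 * n + 1) / (n : ℂ)))))).subset fun M hM => ?_
  contrapose! hM
  simp only [Set.mem_union, Set.mem_singleton_iff, Set.mem_ofPred_eq, not_or, not_not] at hM ⊢
  obtain ⟨⟨hM0, hM4⟩, hriley, hone⟩ := hM
  refine Separable.mul ?_ (separable_twistAPoly hn hM0 hM4 hriley) ?_
  · simpa using separable_X_sub_C (x := (1 : ℂ))
  · refine (isCoprime_iff_aeval_ne_zero_of_isAlgClosed ℂ ℂ _ _).2 fun L => ?_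
    simp only [coe_aeval_eq_eval, eval_twistAPoly_X_C, eval_sub, eval_X, eval_one, sub_ne_zero]
    rcases eq_or_ne L 1 with rfl | hL
    · refine .inr (twistAPoly_one_left_ne_zero hn hM0 hM4 fun h => hone ?_)
      rw [eq_div_iff hnC, mul_comm, h]
    · exact .inl hL

end Separability

section APolynomial

open MvPolynomial

theorem dvd_of_squarefree {R : Type*} [CommRing R] [IsDomain R] [UniqueFactorizationMonoid R]
    {a b : R} (ha : Squarefree a) (h : ∀ f, Irreducible f → f ∣ a → f ∣ b) : a ∣ b := by
  induction a using UniqueFactorizationMonoid.induction_on_prime with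
  | h₁ => exact absurd ha not_squarefree_zero
  | h₂ u hu => exact hu.dvd
  | h₃ a p _ hp ih =>
    have hpa : ¬ p ∣ a := fun ⟨c, hc⟩ => hp.not_isUnit (ha p ⟨c, by rw [hc, mul_assoc]⟩)
    obtain ⟨c, rfl⟩ := ih ha.of_mul_right fun f hf hfa => h f hf (hfa.mul_left p)
    have hpc := (hp.dvd_or_dvd (h p hp.irreducible (dvd_mul_right p a))).resolve_left hpa
    rw [mul_comm p a]
    exact mul_dvd_mul_left a hpc

section Nullstellensatz

variable {σ K : Type*} [Field K]

theorem irreducible_X_sub_C (i : σ) (b : K) : Irreducible (X i - C b : MvPolynomial σ K) := by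
  classical
  refine irreducible_of_totalDegree_eq_one ?_ fun c hc => ?_
  · rw [sub_eq_add_neg, ← C_neg, totalDegree_add_eq_left_of_totalDegree_lt (by simp),
      totalDegree_X]
  · refine isUnit_of_dvd_one ?_
    have hci := hc (Finsupp.single i 1)
    rwa [coeff_sub, coeff_X, if_pos rfl, coeff_C,
      if_neg (Finsupp.single_ne_zero.2 one_ne_zero).symm, sub_zero] at hci

variable [IsAlgClosed K] [Finite σ] {f g : MvPolynomial σ K}

theorem dvd_of_zeros_subset (hf : Irreducible f) (h : ∀ x, eval x f = 0 → eval x g = 0) :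
    f ∣ g := by
  have hprime : (Ideal.span {f}).IsPrime :=
    (Ideal.span_singleton_prime hf.ne_zero).2 hf.prime
  rw [← Ideal.mem_span_singleton,
    ← IsPrime.vanishingIdeal_zeroLocus (K := K) (Ideal.span {f}), mem_vanishingIdeal_iff]
  intro x hx
  have hxf := hx f (Ideal.mem_span_singleton_self f)
  rw [aeval_eq_eval] at hxf ⊢
  exact h x hxf

theorem dvd_of_zeros_subset_of_notMem {i : σ} {B : Set K} (hf : Irreducible f) (hB : B.Finite)
    (hfB : ∀ b ∈ B, ¬ f ∣ X i - C b) (h : ∀ x, eval x f = 0 → x i ∉ B → eval x g = 0) :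
    f ∣ g := by
  have hdvd : f ∣ g * ∏ b ∈ hB.toFinset, (X i - C b) := by
    refine dvd_of_zeros_subset hf fun x hx => ?_
    rw [map_mul, map_prod]
    by_cases hxB : x i ∈ B
    · rw [Finset.prod_eq_zero (hB.mem_toFinset.2 hxB) (by simp), mul_zero]
    · rw [h x hx hxB, zero_mul]
  refine (hf.prime.dvd_or_dvd hdvd).resolve_right fun hprod => ?_
  obtain ⟨b, hb, hfb⟩ := (hf.prime.dvd_finsetProd_iff _).1 hprod
  exact hfB b (hB.mem_toFinset.1 hb) hfb

theorem exists_zero_notMem {i : σ} {B : Set K} (hf : Irreducible f) (hB : B.Finite)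
    (hfB : ∀ b ∈ B, ¬ f ∣ X i - C b) : ∃ x, eval x f = 0 ∧ x i ∉ B := by
  by_contra! h
  exact hf.not_isUnit (isUnit_of_dvd_one
    (dvd_of_zeros_subset_of_notMem hf hB hfB fun x hx hxB => absurd (h x hx) hxB))

end Nullstellensatz

theorem eq_or_eq_neg_of_associated_map {σ : Type*} {A B : MvPolynomial σ ℤ}
    (h : Associated (map (Int.castRingHom ℂ) A) (map (Int.castRingHom ℂ) B))
    (hB : ∀ c : ℤ, C c ∣ B → IsUnit c) {m : σ →₀ ℕ} (hm : IsUnit (coeff m A)) :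
    B = A ∨ B = -A := by
  obtain ⟨u, hu⟩ := h
  obtain ⟨c, -, hcu⟩ := isUnit_iff_eq_C_of_isReduced.1 u.isUnit
  obtain ⟨ε, hε⟩ := hm
  have hcoeff := congrArg (coeff m) hu
  rw [hcu, mul_comm, coeff_C_mul, coeff_map, coeff_map, ← hε] at hcoeff
  have hεε : ((ε : ℤ) : ℂ) * ((ε : ℤ) : ℂ) = 1 := by
    rw [← Int.cast_mul, ← Units.val_mul, Int.units_mul_self, Units.val_one, Int.cast_one]
  have hc : c = ((ε * coeff m B : ℤ) : ℂ) := by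
    simp only [eq_intCast] at hcoeff
    push_cast
    linear_combination ((ε : ℤ) : ℂ) * hcoeff - c * hεε
  have hBA : B = A * C (ε * coeff m B) := by
    apply map_injective (Int.castRingHom ℂ) Int.cast_injective
    rw [map_mul, map_C, ← hu, hcu, hc, eq_intCast]
  obtain ⟨ε', hε'⟩ := hB _ ⟨A, by rw [mul_comm]; exact hBA⟩
  rw [hBA, ← hε']
  exact (Int.units_eq_one_or ε').imp (by rintro rfl; simp) (by rintro rfl; simp)

namespace KnotDiagram

variable {N : ℕ} [NeZero N] {D : KnotDiagram N} {A B : MvPolynomial (Fin 2) ℤ}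

theorem IsAPolynomial.map_dvd_map (hA : D.IsAPolynomial A) (hB : D.IsAPolynomial B) :
    map (Int.castRingHom ℂ) A ∣ map (Int.castRingHom ℂ) B := by
  have h := dvd_of_squarefree hA.2.1 fun f hf hfA => (hB.2.2 f hf).2 ((hA.2.2 f hf).1 hfA)
  have h0 : map (Int.castRingHom ℂ) (X 0 - 1 : MvPolynomial (Fin 2) ℤ) ≠ 0 := fun h0 => by
    simpa using congrArg (eval 0) h0
  rw [map_mul, map_mul] at h
  exact (mul_dvd_mul_iff_left h0).1 h

theorem IsAPolynomial.eq_or_eq_neg (hA : D.IsAPolynomial A) (hB : D.IsAPolynomial B)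
    {m : Fin 2 →₀ ℕ} (hm : IsUnit (coeff m A)) : B = A ∨ B = -A :=
  eq_or_eq_neg_of_associated_map
    (associated_of_dvd_dvd (hA.map_dvd_map hB) (hB.map_dvd_map hA)) hB.1 hm

end KnotDiagram

/-- The A-polynomial of the twist knot, with the sign chosen as in the theorem. -/
noncomputable def twistKnotAPolynomial (n : ℤ) : MvPolynomial (Fin 2) ℤ :=
  twistAPoly n (X 0) (X 1)

/-- The equation of the eigenvalue curve of the twist knot, including the component `L = 1` of the
abelian representations. -/
noncomputable def twistKnotCurve (n : ℤ) : MvPolynomial (Fin 2) ℂ :=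
  map (Int.castRingHom ℂ) ((X 0 - 1) * twistKnotAPolynomial n)

variable {n : ℤ} {f : MvPolynomial (Fin 2) ℂ}

theorem map_twistKnotCurve {R : Type*} [CommRing R] (φ : MvPolynomial (Fin 2) ℂ →+* R) (n : ℤ) :
    φ (twistKnotCurve n) = (φ (X 0) - 1) * twistAPoly n (φ (X 0)) (φ (X 1)) := by
  rw [twistKnotCurve, twistKnotAPolynomial, map_mul, map_mul, map_twistAPoly, map_twistAPoly]
  simp only [map_sub, map_X, map_one]

theorem eval_twistKnotCurve (x : Fin 2 → ℂ) (n : ℤ) :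
    eval x (twistKnotCurve n) = (x 0 - 1) * twistAPoly n (x 0) (x 1) := by
  rw [map_twistKnotCurve, eval_X, eval_X]

theorem exists_eval_twistKnotCurve_ne_zero (hn : n ≠ 0) (b : ℂ) :
    ∃ x, x 1 = b ∧ eval x (twistKnotCurve n) ≠ 0 := by
  suffices h : ∃ L : ℂ, (L - 1) * twistAPoly n L b ≠ 0 by
    obtain ⟨L, hL⟩ := h
    exact ⟨![L, b], rfl, by rwa [eval_twistKnotCurve]⟩
  rcases lt_or_gt_of_ne hn with hn | hn
  · exact ⟨0, by simp [twistAPoly_zero_left_of_neg hn]⟩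
  · rcases eq_or_ne b 0 with rfl | hb
    · exact ⟨2, by norm_num [twistAPoly_zero_right_of_pos hn]⟩
    · exact ⟨0, by simp [twistAPoly_zero_left_of_pos hn, hb]⟩

theorem not_dvd_X_sub_C_of_dvd_twistKnotCurve (hn : n ≠ 0) (hf : Irreducible f)
    (hfn : f ∣ twistKnotCurve n) (b : ℂ) : ¬ f ∣ X 1 - C b := fun hfb => by
  obtain ⟨g, hg⟩ := ((hf.dvd_comm (irreducible_X_sub_C 1 b)).1 hfb).trans hfn
  obtain ⟨x, rfl, hx⟩ := exists_eval_twistKnotCurve_ne_zero hn b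
  exact hx (by simp [hg])

theorem squarefree_twistKnotCurve (hn : n ≠ 0) : Squarefree (twistKnotCurve n) := by
  have h0 : twistKnotCurve n ≠ 0 := fun h => by
    obtain ⟨x, -, hx⟩ := exists_eval_twistKnotCurve_ne_zero hn 0
    exact hx (by rw [h, map_zero])
  rw [squarefree_iff_irreducible_sq_not_dvd_of_ne_zero h0]
  intro f hf hff
  obtain ⟨x, hx, hsep⟩ := exists_zero_notMem hf
    (finite_setOf_not_separable_X_sub_one_mul_twistAPoly hn)
    fun b _ => not_dvd_X_sub_C_of_dvd_twistKnotCurve hn hf ((dvd_mul_right f f).trans hff) b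
  let F : MvPolynomial (Fin 2) ℂ →+* Polynomial ℂ :=
    eval₂Hom Polynomial.C ![Polynomial.X, Polynomial.C (x 1)]
  have hF : (Polynomial.evalRingHom (x 0)).comp F = eval x := by
    refine ringHom_ext (fun r => by simp [F]) fun i => ?_
    fin_cases i <;> simp [F]
  have hsep' : (F (twistKnotCurve n)).Separable := by
    rw [map_twistKnotCurve]
    simpa [F] using hsep
  have hunit : IsUnit (F f) := hsep'.squarefree (F f) (by simpa only [map_mul] using map_dvd F hff)
  refine (hunit.map (Polynomial.evalRingHom (x 0))).ne_zero ?_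
  rw [← RingHom.comp_apply, hF, hx]

theorem eval_twistKnotCurve_eq_zero (hn : n ≠ 0) {x : Fin 2 → ℂ}
    (hx : x ∈ (twistKnot n).eigenvalueSet) : eval x (twistKnotCurve n) = 0 := by
  rw [eval_twistKnotCurve]
  obtain ⟨hM, hL | h⟩ := (mem_eigenvalueSet_twistKnot hn x).1 hx
  · rw [hL, sub_self, zero_mul]
  · exact twistAPoly_eq_zero_of_isRileyPoint hn hM h

theorem mem_eigenvalueSet_of_eval_twistKnotCurve_eq_zero (hn : n ≠ 0) {x : Fin 2 → ℂ}
    (hM : x 1 ≠ 0) (hM4 : x 1 ^ 4 ≠ 1) (hx : eval x (twistKnotCurve n) = 0) :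
    x ∈ (twistKnot n).eigenvalueSet := by
  rw [eval_twistKnotCurve, mul_eq_zero, sub_eq_zero] at hx
  exact (mem_eigenvalueSet_twistKnot hn x).2
    ⟨hM, hx.imp_right (isRileyPoint_of_twistAPoly_eq_zero hn hM hM4)⟩

theorem dvd_twistKnotCurve_iff (hn : n ≠ 0) (hf : Irreducible f) :
    f ∣ twistKnotCurve n ↔ {x : Fin 2 → ℂ | eval x f = 0} ⊆
      zeroLocus ℂ (vanishingIdeal ℂ (twistKnot n).eigenvalueSet) := by
  constructor
  · rintro hfn x (hx : eval x f = 0)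
    rw [mem_zeroLocus_iff]
    intro p hp
    obtain ⟨q, rfl⟩ : f ∣ p := dvd_of_zeros_subset_of_notMem hf
      ((Set.finite_singleton 0).union finite_setOf_pow_four_eq_one)
      (fun b _ => not_dvd_X_sub_C_of_dvd_twistKnotCurve hn hf hfn b) fun y hy hyB => by
        obtain ⟨hy0, hy4⟩ := not_or.1 hyB
        rw [← aeval_eq_eval]
        exact mem_vanishingIdeal_iff.1 hp y (mem_eigenvalueSet_of_eval_twistKnotCurve_eq_zero hn
          hy0 hy4 (zero_dvd_iff.1 (hy ▸ map_dvd (eval y) hfn)))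
    rw [aeval_eq_eval, map_mul, hx, zero_mul]
  · refine fun h => dvd_of_zeros_subset hf fun x hx => ?_
    have hmem : twistKnotCurve n ∈ vanishingIdeal ℂ (twistKnot n).eigenvalueSet :=
      mem_vanishingIdeal_iff.2 fun y hy => by
        rw [aeval_eq_eval]
        exact eval_twistKnotCurve_eq_zero hn hy
    simpa only [aeval_eq_eval] using mem_zeroLocus_iff.1 (h hx) _ hmem

theorem isAPolynomial_twistKnotAPolynomial (hn : n ≠ 0) {m : Fin 2 →₀ ℕ}
    (hm : IsUnit (coeff m (twistKnotAPolynomial n))) :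
    (twistKnot n).IsAPolynomial (twistKnotAPolynomial n) := by
  refine ⟨?_, squarefree_twistKnotCurve hn, fun f hf => dvd_twistKnotCurve_iff hn hf⟩
  rintro c ⟨g, hg⟩
  rw [hg, coeff_C_mul] at hm
  exact isUnit_of_mul_isUnit_left hm

end APolynomial

section InitialForm

open MvPolynomial

variable {R : Type*} [CommRing R] {u v d e : ℤ} {p q g h : MvPolynomial (Fin 2) R}

/-- Every monomial of `p` has weight at most `d`, where the variables have weights `u` and `v`. -/
def WeightLE (u v d : ℤ) (p : MvPolynomial (Fin 2) R) : Prop :=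
  ∀ m ∈ p.support, u * m 0 + v * m 1 ≤ d

/-- `g` is the part of weight `d` of `p`, and the other monomials of `p` have smaller weight.
It is allowed that `g = 0`, so that `d` need not be the weight of `p`. -/
structure HasInitialForm (u v d : ℤ) (p g : MvPolynomial (Fin 2) R) : Prop where
  le : WeightLE u v d g
  ge : WeightLE (-u) (-v) (-d) g
  sub : WeightLE u v (d - 1) (p - g)

theorem eq_of_weight_eq {u' v' : ℤ} {m m' : Fin 2 →₀ ℕ} (hdet : u * v' ≠ v * u')
    (h : u * m 0 + v * m 1 = u * m' 0 + v * m' 1)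
    (h' : u' * m 0 + v' * m 1 = u' * m' 0 + v' * m' 1) : m = m' := by
  have h0 : (u * v' - v * u') * (m 0 - m' 0 : ℤ) = 0 := by linear_combination v' * h - v * h'
  have h1 : (u * v' - v * u') * (m 1 - m' 1 : ℤ) = 0 := by linear_combination u * h' - u' * h
  have hm0 := (mul_eq_zero.1 h0).resolve_left (sub_ne_zero.2 hdet)
  have hm1 := (mul_eq_zero.1 h1).resolve_left (sub_ne_zero.2 hdet)
  exact Finsupp.ext (Fin.forall_fin_two.2 ⟨by omega, by omega⟩)

namespace WeightLE

theorem mono (hp : WeightLE u v d p) (hd : d ≤ e) : WeightLE u v e p :=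
  fun m hm => (hp m hm).trans hd

theorem zero : WeightLE u v d (0 : MvPolynomial (Fin 2) R) := by simp [WeightLE]

theorem add (hp : WeightLE u v d p) (hq : WeightLE u v d q) : WeightLE u v d (p + q) := by
  classical
  exact fun m hm => (Finset.mem_union.1 (support_add hm)).elim (hp m) (hq m)

theorem neg (hp : WeightLE u v d p) : WeightLE u v d (-p) := fun m hm =>
  hp m (by rwa [support_neg] at hm)

theorem mul (hp : WeightLE u v d p) (hq : WeightLE u v e q) : WeightLE u v (d + e) (p * q) := by
  classical
  intro m hm
  obtain ⟨a, ha, b, hb, rfl⟩ := Finset.mem_add.1 (support_mul p q hm)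
  have hpa := hp a ha
  have hqb := hq b hb
  simp only [Finsupp.add_apply, Nat.cast_add]
  linarith

theorem monomial (m : Fin 2 →₀ ℕ) (c : R) (hm : u * m 0 + v * m 1 ≤ d) :
    WeightLE u v d (MvPolynomial.monomial m c) := by
  classical
  intro m' hm'
  rwa [Finset.mem_singleton.1 (support_monomial_subset hm')]

end WeightLE

namespace HasInitialForm

theorem weightLE (hp : HasInitialForm u v d p g) : WeightLE u v d p := by
  rw [← sub_add_cancel p g]
  exact (hp.sub.mono (by omega)).add hp.le

theorem of_weightLE (hp : WeightLE u v e p) (hd : e < d) : HasInitialForm u v d p 0 :=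
  ⟨.zero, .zero, by rw [sub_zero]; exact hp.mono (by omega)⟩

theorem monomial (m : Fin 2 →₀ ℕ) (c : R) (hm : u * m 0 + v * m 1 = d) :
    HasInitialForm u v d (MvPolynomial.monomial m c) (MvPolynomial.monomial m c) :=
  ⟨.monomial m c hm.le, .monomial m c (by linarith), by rw [sub_self]; exact .zero⟩

theorem add (hp : HasInitialForm u v d p g) (hq : HasInitialForm u v d q h) :
    HasInitialForm u v d (p + q) (g + h) :=
  ⟨hp.le.add hq.le, hp.ge.add hq.ge, by rw [add_sub_add_comm]; exact hp.sub.add hq.sub⟩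

theorem neg (hp : HasInitialForm u v d p g) : HasInitialForm u v d (-p) (-g) :=
  ⟨hp.le.neg, hp.ge.neg, by rw [neg_sub_neg, ← neg_sub p g]; exact hp.sub.neg⟩

theorem minus (hp : HasInitialForm u v d p g) (hq : HasInitialForm u v d q h) :
    HasInitialForm u v d (p - q) (g - h) := by
  rw [sub_eq_add_neg, sub_eq_add_neg]
  exact hp.add hq.neg

theorem mul (hp : HasInitialForm u v d p g) (hq : HasInitialForm u v e q h) :
    HasInitialForm u v (d + e) (p * q) (g * h) := by
  refine ⟨hp.le.mul hq.le, neg_add d e ▸ hp.ge.mul hq.ge, ?_⟩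
  rw [show p * q - g * h = (p - g) * q + g * (q - h) by ring]
  exact ((hp.sub.mul hq.weightLE).mono (by omega)).add ((hp.le.mul hq.sub).mono (by omega))

theorem pow (hp : HasInitialForm u v d p g) (j : ℕ) :
    HasInitialForm u v (j * d) (p ^ j) (g ^ j) := by
  induction j with
  | zero => exact monomial 0 1 (by simp)
  | succ j ih =>
    rw [pow_succ, pow_succ, Nat.cast_succ, add_one_mul]
    exact ih.mul hp

theorem lucasSeq {t s t' s' : MvPolynomial (Fin 2) R} (ht : HasInitialForm u v d t t')
    (hs : HasInitialForm u v (2 * d) s s') (j : ℕ) :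
    HasInitialForm u v ((j - 1) * d) (lucasSeq t s j) (lucasSeq t' s' j) := by
  induction j using Nat.twoStepInduction with
  | zero => exact ⟨.zero, .zero, by rw [_root_.lucasSeq, _root_.lucasSeq, sub_self]; exact .zero⟩
  | one => exact monomial 0 1 (by simp)
  | more j h h' =>
    have h₁ := ht.mul h'
    have h₂ := hs.mul h
    rw [show d + ((j + 1 : ℕ) - 1) * d = ((j + 2 : ℕ) - 1) * d by push_cast; ring] at h₁
    rw [show 2 * d + ((j : ℤ) - 1) * d = ((j + 2 : ℕ) - 1) * d by push_cast; ring] at h₂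
    rw [lucasSeq_add_two, lucasSeq_add_two]
    exact h₁.minus h₂

theorem algHom {φ : MvPolynomial (Fin 2) R →ₐ[R] MvPolynomial (Fin 2) R}
    (hφ : ∀ i, HasInitialForm u v 0 (X i) (φ (X i))) (p : MvPolynomial (Fin 2) R) :
    HasInitialForm u v 0 p (φ p) := by
  induction p using MvPolynomial.induction_on with
  | C a =>
    rw [algHom_C]
    exact monomial 0 a (by simp)
  | add p q hp hq => rw [map_add]; exact hp.add hq
  | mul_X p i hp => rw [map_mul]; exact hp.mul (hφ i)

theorem term (c : R) (a b : ℕ) (hd : u * a + v * b ≤ d) :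
    HasInitialForm u v d (C c * X 0 ^ a * X 1 ^ b)
      (if u * a + v * b = d then C c * X 0 ^ a * X 1 ^ b else 0) := by
  have hm : (C c * X 0 ^ a * X 1 ^ b : MvPolynomial (Fin 2) R) =
      MvPolynomial.monomial (Finsupp.single 0 a + Finsupp.single 1 b) c := by
    rw [monomial_add_single, ← C_mul_X_pow_eq_monomial]
  rw [hm]
  split_ifs with h
  · exact .monomial _ c (by simpa using h)
  · exact .of_weightLE (.monomial (d := u * a + v * b) _ c (by simp)) (lt_of_le_of_ne hd h)

theorem one_add_X_mul_pow (b : ℕ) (hb : u + v * b ≤ d) (h0 : 0 ≤ d) :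
    HasInitialForm u v d (1 + X 0 * X 1 ^ b : MvPolynomial (Fin 2) R)
      ((if 0 = d then 1 else 0) + if u + v * b = d then X 0 * X 1 ^ b else 0) := by
  simpa using (term (R := R) (u := u) (v := v) 1 0 0 (by simpa)).add (term 1 1 b (by simpa))

theorem coeff_eq (hp : HasInitialForm u v d p g) {m : Fin 2 →₀ ℕ} (hm : u * m 0 + v * m 1 = d) :
    coeff m p = coeff m g := by
  by_contra h
  have := hp.sub m (by rwa [mem_support_iff, coeff_sub, sub_ne_zero])
  omega

theorem mem_support_iff (hp : HasInitialForm u v d p g) {m : Fin 2 →₀ ℕ} :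
    m ∈ g.support ↔ m ∈ p.support ∧ u * m 0 + v * m 1 = d := by
  rw [MvPolynomial.mem_support_iff, MvPolynomial.mem_support_iff]
  constructor
  · intro hm
    have hle := hp.le m (MvPolynomial.mem_support_iff.2 hm)
    have hge := hp.ge m (MvPolynomial.mem_support_iff.2 hm)
    have hd : u * m 0 + v * m 1 = d := by linarith
    exact ⟨by rwa [hp.coeff_eq hd], hd⟩
  · rintro ⟨hm, hd⟩
    rwa [← hp.coeff_eq hd]

theorem sum_monomial (hp : HasInitialForm u v d p g) :
    ∑ m ∈ p.support with u * m 0 + v * m 1 = d, Polynomial.monomial (m 0) (coeff m p) =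
      aeval ![Polynomial.X, 1] g := by
  classical
  have hs : (p.support.filter fun m => u * m 0 + v * m 1 = d) = g.support := by
    ext m
    rw [Finset.mem_filter, hp.mem_support_iff]
  rw [hs, aeval_def, eval₂_eq']
  refine Finset.sum_congr rfl fun m hm => ?_
  rw [hp.coeff_eq (hp.mem_support_iff.1 hm).2]
  simp [Fin.prod_univ_two, ← Polynomial.C_mul_X_pow_eq_monomial]

theorem coeff_eq_coeff_aeval (hp : HasInitialForm u v d p g) (hv : v ≠ 0) {m : Fin 2 →₀ ℕ}
    (hm : u * m 0 + v * m 1 = d) :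
    coeff m p = (aeval ![Polynomial.X, 1] g : Polynomial R).coeff (m 0) := by
  classical
  rw [← hp.sum_monomial, Polynomial.finsetSum_coeff, Finset.sum_eq_single m]
  · rw [Polynomial.coeff_monomial, if_pos rfl]
  · intro m' hm' hne
    rw [Polynomial.coeff_monomial, if_neg]
    intro h0
    refine hne (eq_of_weight_eq (u := u) (u' := 1) (v' := 0) (by simpa using hv.symm) ?_ ?_)
    · rw [(Finset.mem_filter.1 hm').2, hm]
    · simp only [h0, zero_mul, add_zero]
  · intro h
    rw [Finset.mem_filter, not_and, imp_not_comm] at h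
    rw [notMem_support_iff.1 (h hm), map_zero, Polynomial.coeff_zero]

/-- If the face of weight `(u, v)` is the vertex `r`, then the edge that leaves `r` is found by
maximizing another weight `(u', v')` on the next lower level of `(u, v)`. -/
theorem binomial {A : MvPolynomial (Fin 2) R} {u' v' k : ℤ} {r s : Fin 2 →₀ ℕ} {a : R}
    (hA : HasInitialForm u v d A (MvPolynomial.monomial r a)) (hA' : WeightLE u' v' e A)
    (hdet : u * v' ≠ v * u') (hk : 0 < k) (hr : u * r 0 + v * r 1 = d)
    (hs : u * s 0 + v * s 1 = d - 1) (hs' : u' * s 0 + v' * s 1 = e)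
    (hrs : u' * r 0 + v' * r 1 = e - k) :
    HasInitialForm (k * u + u') (k * v + v') (k * (d - 1) + e) A
      (MvPolynomial.monomial r (coeff r A) + MvPolynomial.monomial s (coeff s A)) := by
  classical
  have hr' : (k * u + u') * r 0 + (k * v + v') * r 1 = k * (d - 1) + e := by
    linear_combination k * hr + hrs
  have hs'' : (k * u + u') * s 0 + (k * v + v') * s 1 = k * (d - 1) + e := by
    linear_combination k * hs + hs'
  refine ⟨.add (.monomial r _ hr'.le) (.monomial s _ hs''.le),
    .add (.monomial r _ (by linarith)) (.monomial s _ (by linarith)), fun m hm => ?_⟩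
  have hne : r ≠ s := by rintro rfl; omega
  rw [MvPolynomial.mem_support_iff, coeff_sub, coeff_add, coeff_monomial, coeff_monomial] at hm
  have hmr : m ≠ r := by rintro rfl; simp [hne.symm] at hm
  have hms : m ≠ s := by rintro rfl; simp [hne] at hm
  rw [if_neg hmr.symm, if_neg hms.symm, add_zero, sub_zero, ← MvPolynomial.mem_support_iff] at hm
  have hlt : u * m 0 + v * m 1 ≤ d - 1 := by
    refine Int.le_sub_one_of_lt (lt_of_le_of_ne (hA.weightLE m hm) fun hd => hmr ?_)
    exact Finset.mem_singleton.1 (support_monomial_subset (hA.mem_support_iff.2 ⟨hm, hd⟩))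
  refine Int.le_sub_one_of_lt (lt_of_le_of_ne ?_ fun heq => hms ?_)
  · nlinarith [hA' m hm]
  · have hm' := hA' m hm
    have h1 : u * m 0 + v * m 1 = d - 1 := le_antisymm hlt (by nlinarith)
    have h2 : u' * m 0 + v' * m 1 = e := by linear_combination heq - k * h1
    exact eq_of_weight_eq hdet (h1.trans hs.symm) (h2.trans hs'.symm)

end HasInitialForm

end InitialForm

section TwistInitialForm

open MvPolynomial

variable {u v d d' e : ℤ} {g t s f : MvPolynomial (Fin 2) ℤ}

theorem hasInitialForm_twistT (h4 : v * 4 ≤ d := by norm_num) (h0 : 0 ≤ d := by norm_num)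
    (h10 : u ≤ d := by norm_num) (h18 : u + v * 8 ≤ d := by norm_num)
    (h24 : u * 2 + v * 4 ≤ d := by norm_num) (h28 : u * 2 + v * 8 ≤ d := by norm_num) :
    HasInitialForm (R := ℤ) u v d (twistT (X 0) (X 1)) (
      (if 0 = d then 1 else 0) + (if v * 4 = d then X 1 ^ 4 else 0) +
      (if u = d then -X 0 else 0) + (if u + v * 2 = d then C 2 * X 0 * X 1 ^ 2 else 0) +
      (if u + v * 4 = d then C 2 * X 0 * X 1 ^ 4 else 0) +
      (if u + v * 6 = d then C 2 * X 0 * X 1 ^ 6 else 0) +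
      (if u + v * 8 = d then -(X 0 * X 1 ^ 8) else 0) +
      (if u * 2 + v * 4 = d then X 0 ^ 2 * X 1 ^ 4 else 0) +
      (if u * 2 + v * 8 = d then X 0 ^ 2 * X 1 ^ 8 else 0)) := by
  have H := (((((((((HasInitialForm.term (u := u) (v := v) (d := d) 1 0 0 (by simpa)).add
    (.term 1 0 4 (by push_cast; linarith))).add (.term (-1) 1 0 (by push_cast; linarith))).add
    (.term 2 1 2 (by push_cast; linarith))).add (.term 2 1 4 (by push_cast; linarith))).add
    (.term 2 1 6 (by push_cast; linarith))).add (.term (-1) 1 8 (by push_cast; linarith))).add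
    (.term 1 2 4 (by push_cast; linarith))).add (.term 1 2 8 (by push_cast; linarith)))
  convert H using 1
  · simp only [twistT, map_neg, map_one, map_ofNat]
    ring
  · simp

theorem hasInitialForm_twistAPoly_of_pos (u v : ℤ) (j : ℕ)
    (ht : HasInitialForm u v d (twistT (X 0) (X 1)) t)
    (hs : HasInitialForm (R := ℤ) u v (2 * d) (twistW (X 0) (X 1) ^ 2) s)
    (hf : HasInitialForm u v d ((1 + X 0 * X 1 ^ 6) * (1 + X 0 * X 1 ^ 2)) f) :
    HasInitialForm u v ((j + 1) * d) (twistKnotAPolynomial (j + 1 : ℕ))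
      (f * lucasSeq t s (j + 1) - lucasSeq t s (j + 2)) := by
  have h₁ := hf.mul (ht.lucasSeq hs (j + 1))
  have h₂ := ht.lucasSeq hs (j + 2)
  rw [show d + ((j + 1 : ℕ) - 1) * d = (j + 1) * d by push_cast; ring] at h₁
  rw [show ((j + 2 : ℕ) - 1) * d = (j + 1) * d by push_cast; ring] at h₂
  rw [twistKnotAPolynomial, twistAPoly, if_pos (by omega), Int.natAbs_natCast]
  exact h₁.minus h₂

theorem hasInitialForm_twistAPoly_of_neg (u v : ℤ) (j : ℕ)
    (ht : HasInitialForm u v d (twistT (X 0) (X 1)) t)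
    (hs : HasInitialForm (R := ℤ) u v (2 * d) (twistW (X 0) (X 1) ^ 2) s)
    (hf : HasInitialForm u v d' (1 + X 0 * X 1 ^ 6) f)
    (hg : HasInitialForm u v (d' + d) (X 1 ^ 4 * (1 + X 0 * X 1 ^ 2) ^ 3) g) :
    HasInitialForm u v (d' + j * d) (twistKnotAPolynomial (-(j + 1 : ℕ)))
      (f * lucasSeq t s (j + 1) - g * lucasSeq t s j) := by
  have h₁ := hf.mul (ht.lucasSeq hs (j + 1))
  have h₂ := hg.mul (ht.lucasSeq hs j)
  rw [show d' + ((j + 1 : ℕ) - 1) * d = d' + j * d by push_cast; ring] at h₁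
  rw [show d' + d + ((j : ℤ) - 1) * d = d' + j * d by ring] at h₂
  rw [twistKnotAPolynomial, twistAPoly, if_neg (by omega), Int.natAbs_neg, Int.natAbs_natCast,
    Nat.add_sub_cancel]
  exact h₁.minus h₂

theorem hasInitialForm_X_pow_mul_one_add_pow (k l : ℕ) (he : u + v * 2 ≤ e := by norm_num)
    (h0 : 0 ≤ e := by norm_num) :
    HasInitialForm (R := ℤ) u v (v * k + l * e) (X 1 ^ k * (1 + X 0 * X 1 ^ 2) ^ l)
      (X 1 ^ k * ((if 0 = e then 1 else 0) + if u + v * 2 = e then X 0 * X 1 ^ 2 else 0) ^ l) := by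
  simpa using (HasInitialForm.term (R := ℤ) (u := u) (v := v) (d := v * k) 1 0 k (by simp)).mul
    ((HasInitialForm.one_add_X_mul_pow (u := u) (v := v) (d := e) 2 (by simpa) h0).pow l)

theorem twistW_sq {R : Type*} [CommRing R] (L M : R) :
    twistW L M ^ 2 = M ^ 4 * (1 + L * M ^ 2) ^ 4 := by
  rw [twistW]
  ring

theorem hasInitialForm_twistW_sq_zero (e : ℤ) (he : u + v * 2 ≤ e := by norm_num)
    (h0 : 0 ≤ e := by norm_num) (hd : v * 4 + 4 * e < 2 * d := by norm_num) :
    HasInitialForm (R := ℤ) u v (2 * d) (twistW (X 0) (X 1) ^ 2) 0 := by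
  rw [twistW_sq]
  exact .of_weightLE (hasInitialForm_X_pow_mul_one_add_pow 4 4 he h0).weightLE hd

theorem hasInitialForm_upper_of_pos (j : ℕ) :
    HasInitialForm (-4) 1 ((j + 1) * 4) (twistKnotAPolynomial (j + 1 : ℕ))
      (-(X 1 ^ 4 - X 0 * X 1 ^ 8) ^ (j + 1)) := by
  have h := hasInitialForm_twistAPoly_of_pos (-4) 1 j (hasInitialForm_twistT (d := 4))
    (hasInitialForm_twistW_sq_zero 0) (.of_weightLE
      ((HasInitialForm.one_add_X_mul_pow (d := 2) 6 (by norm_num) (by norm_num)).mul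
        (.one_add_X_mul_pow (d := 0) 2 (by norm_num) le_rfl)).weightLE (by norm_num))
  simpa [lucasSeq_zero_right, ← sub_eq_add_neg] using h

theorem hasInitialForm_lower_of_pos (j : ℕ) :
    HasInitialForm 4 (-1) ((j + 1) * 4) (twistKnotAPolynomial (j + 1 : ℕ))
      (-(-X 0 + X 0 ^ 2 * X 1 ^ 4) ^ (j + 1)) := by
  have h := hasInitialForm_twistAPoly_of_pos 4 (-1) j (hasInitialForm_twistT (d := 4))
    (hasInitialForm_twistW_sq_zero 2) (.of_weightLE
      ((HasInitialForm.one_add_X_mul_pow (d := 0) 6 (by norm_num) le_rfl).mul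
        (.one_add_X_mul_pow (d := 2) 2 (by norm_num) (by norm_num))).weightLE (by norm_num))
  simpa [lucasSeq_zero_right] using h

theorem hasInitialForm_top_of_pos (j : ℕ) :
    HasInitialForm 0 1 ((j + 1) * 8) (twistKnotAPolynomial (j + 1 : ℕ))
      (X 0 * X 1 ^ 8 * (-(X 0 * X 1 ^ 8) + X 0 ^ 2 * X 1 ^ 8) ^ j) := by
  have h := hasInitialForm_twistAPoly_of_pos 0 1 j (hasInitialForm_twistT (d := 8))
    (hasInitialForm_twistW_sq_zero 2)
    ((HasInitialForm.one_add_X_mul_pow (d := 6) 6 (by norm_num) (by norm_num)).mul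
      (.one_add_X_mul_pow (d := 2) 2 (by norm_num) (by norm_num)))
  convert h using 1
  norm_num [lucasSeq_zero_right]
  ring

theorem hasInitialForm_right_of_pos (j : ℕ) :
    HasInitialForm 1 0 ((j + 1) * 2) (twistKnotAPolynomial (j + 1 : ℕ))
      (-(X 0 ^ 2 * X 1 ^ 4) ^ (j + 1)) := by
  have hs := hasInitialForm_X_pow_mul_one_add_pow (u := 1) (v := 0) (e := 1) 4 4
  rw [← twistW_sq] at hs
  have h := hasInitialForm_twistAPoly_of_pos 1 0 j (hasInitialForm_twistT (d := 2)) hs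
    ((HasInitialForm.one_add_X_mul_pow (d := 1) 6 (by norm_num) (by norm_num)).mul
      (.one_add_X_mul_pow (d := 1) 2 (by norm_num) (by norm_num)))
  convert h using 1
  rw [← lucasSeq_add_mul_sub (X 0 ^ 2 * X 1 ^ 8) (X 0 ^ 2 * X 1 ^ 4), neg_sub]
  norm_num
  ring_nf

theorem hasInitialForm_upper_of_neg (j : ℕ) :
    HasInitialForm (-4) 1 (2 + j * 4) (twistKnotAPolynomial (-(j + 1 : ℕ)))
      (X 0 * X 1 ^ 6 * (X 1 ^ 4 - X 0 * X 1 ^ 8) ^ j) := by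
  have h := hasInitialForm_twistAPoly_of_neg (-4) 1 j (hasInitialForm_twistT (d := 4))
    (hasInitialForm_twistW_sq_zero 0) (.one_add_X_mul_pow (d := 2) 6 (by norm_num) (by norm_num))
    (.of_weightLE (hasInitialForm_X_pow_mul_one_add_pow (e := 0) 4 3).weightLE (by norm_num))
  simpa [lucasSeq_zero_right, ← sub_eq_add_neg] using h

theorem hasInitialForm_lower_of_neg (j : ℕ) :
    HasInitialForm 4 (-1) (j * 4) (twistKnotAPolynomial (-(j + 1 : ℕ)))
      ((-X 0 + X 0 ^ 2 * X 1 ^ 4) ^ j) := by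
  have h := hasInitialForm_twistAPoly_of_neg 4 (-1) j (hasInitialForm_twistT (d := 4))
    (hasInitialForm_twistW_sq_zero 2) (.one_add_X_mul_pow (d := 0) 6 (by norm_num) le_rfl)
    (.of_weightLE (hasInitialForm_X_pow_mul_one_add_pow (e := 2) 4 3).weightLE (by norm_num))
  simpa [lucasSeq_zero_right] using h

theorem hasInitialForm_top_of_neg (j : ℕ) :
    HasInitialForm 0 1 (6 + j * 8) (twistKnotAPolynomial (-(j + 1 : ℕ)))
      (X 0 * X 1 ^ 6 * (-(X 0 * X 1 ^ 8) + X 0 ^ 2 * X 1 ^ 8) ^ j) := by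
  have h := hasInitialForm_twistAPoly_of_neg 0 1 j (hasInitialForm_twistT (d := 8))
    (hasInitialForm_twistW_sq_zero 2) (.one_add_X_mul_pow (d := 6) 6 (by norm_num) (by norm_num))
    (.of_weightLE (hasInitialForm_X_pow_mul_one_add_pow (e := 2) 4 3).weightLE (by norm_num))
  simpa [lucasSeq_zero_right] using h

theorem hasInitialForm_right_of_neg (j : ℕ) :
    HasInitialForm 1 0 (1 + j * 2) (twistKnotAPolynomial (-(j + 1 : ℕ)))
      (X 0 * X 1 ^ 6 * (X 0 ^ 2 * X 1 ^ 8) ^ j) := by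
  have hs := hasInitialForm_X_pow_mul_one_add_pow (u := 1) (v := 0) (e := 1) 4 4
  rw [← twistW_sq] at hs
  have h := hasInitialForm_twistAPoly_of_neg 1 0 j (hasInitialForm_twistT (d := 2)) hs
    (.one_add_X_mul_pow (d := 1) 6 (by norm_num) (by norm_num))
    (hasInitialForm_X_pow_mul_one_add_pow (e := 1) 4 3)
  convert h using 1
  rw [← lucasSeq_add_mul_sub (X 0 ^ 2 * X 1 ^ 4) (X 0 ^ 2 * X 1 ^ 8)]
  norm_num
  ring_nf

theorem hasInitialForm_left (n : ℤ) :
    HasInitialForm (-1) 0 0 (twistKnotAPolynomial n) (twistAPoly n 0 (X 1)) := by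
  have h := HasInitialForm.algHom (u := -1) (v := 0) (φ := aeval ![0, X 1])
    (Fin.forall_fin_two.2 ⟨?_, ?_⟩) (twistKnotAPolynomial n)
  · rwa [twistKnotAPolynomial, ← AlgHom.coe_toRingHom, map_twistAPoly, AlgHom.coe_toRingHom,
      aeval_X, aeval_X] at h
  · simpa using HasInitialForm.term (R := ℤ) (u := -1) (v := 0) (d := 0) 1 1 0 (by norm_num)
  · simpa using HasInitialForm.term (R := ℤ) (u := -1) (v := 0) (d := 0) 1 0 1 (by norm_num)

theorem hasInitialForm_bottom (n : ℤ) :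
    HasInitialForm 0 (-1) 0 (twistKnotAPolynomial n) (twistAPoly n (X 0) 0) := by
  have h := HasInitialForm.algHom (u := 0) (v := -1) (φ := aeval ![X 0, 0])
    (Fin.forall_fin_two.2 ⟨?_, ?_⟩) (twistKnotAPolynomial n)
  · rwa [twistKnotAPolynomial, ← AlgHom.coe_toRingHom, map_twistAPoly, AlgHom.coe_toRingHom,
      aeval_X, aeval_X] at h
  · simpa using HasInitialForm.term (R := ℤ) (u := 0) (v := -1) (d := 0) 1 1 0 (by norm_num)
  · simpa using HasInitialForm.term (R := ℤ) (u := 0) (v := -1) (d := 0) 1 0 1 (by norm_num)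

end TwistInitialForm

section NewtonPolygon

open MvPolynomial

theorem exists_forall_strongDual_apply_eq (l : StrongDual ℝ (ℝ × ℝ)) :
    ∃ a b : ℝ, ∀ x, l x = a * x.1 + b * x.2 :=
  ⟨l (1, 0), l (0, 1), fun x => by
    rw [mul_comm (l _), mul_comm (l _), ← smul_eq_mul, ← smul_eq_mul, ← map_smul, ← map_smul,
      ← map_add]
    simp⟩

theorem exists_nonneg_eq_smul_of_det_pos {u v x : ℝ × ℝ} (hdet : 0 < u.1 * v.2 - u.2 * v.1)
    (hv : v.1 * x.1 + v.2 * x.2 = 0) (hu : u.1 * x.1 + u.2 * x.2 ≤ 0) :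
    ∃ t : ℝ, 0 ≤ t ∧ x = t • ((-v.2, v.1) : ℝ × ℝ) := by
  refine ⟨-(u.1 * x.1 + u.2 * x.2) / (u.1 * v.2 - u.2 * v.1),
    div_nonneg (neg_nonneg.2 hu) hdet.le, Prod.ext ?_ ?_⟩
  · rw [Prod.smul_fst, smul_eq_mul, div_mul_eq_mul_div, eq_div_iff hdet.ne']
    linear_combination -u.2 * hv
  · rw [Prod.smul_snd, smul_eq_mul, div_mul_eq_mul_div, eq_div_iff hdet.ne']
    linear_combination u.1 * hv

theorem eq_of_det_ne_zero {u v x y : ℝ × ℝ} (hdet : u.1 * v.2 - u.2 * v.1 ≠ 0)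
    (hu : u.1 * x.1 + u.2 * x.2 = u.1 * y.1 + u.2 * y.2)
    (hv : v.1 * x.1 + v.2 * x.2 = v.1 * y.1 + v.2 * y.2) : x = y :=
  Prod.ext (mul_left_cancel₀ hdet (by linear_combination v.2 * hu - u.2 * hv))
    (mul_left_cancel₀ hdet (by linear_combination u.1 * hv - v.1 * hu))

theorem mem_segment_of_det_pos {u v w x y z : ℝ × ℝ} (huv : 0 < u.1 * v.2 - u.2 * v.1)
    (hvw : 0 < v.1 * w.2 - v.2 * w.1) (hx : v.1 * x.1 + v.2 * x.2 = v.1 * z.1 + v.2 * z.2)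
    (hy : v.1 * y.1 + v.2 * y.2 = v.1 * z.1 + v.2 * z.2)
    (hu : u.1 * z.1 + u.2 * z.2 ≤ u.1 * x.1 + u.2 * x.2)
    (hw : w.1 * z.1 + w.2 * z.2 ≤ w.1 * y.1 + w.2 * y.2) : z ∈ segment ℝ x y := by
  obtain ⟨t, ht, hzx⟩ := exists_nonneg_eq_smul_of_det_pos (x := z - x) huv
    (by simp only [Prod.fst_sub, Prod.snd_sub]; linarith)
    (by simp only [Prod.fst_sub, Prod.snd_sub]; linarith)
  obtain ⟨s, hs, hyz⟩ := exists_nonneg_eq_smul_of_det_pos (u := -w) (v := v) (x := y - z)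
    (by simp only [Prod.fst_neg, Prod.snd_neg]; linarith)
    (by simp only [Prod.fst_sub, Prod.snd_sub]; linarith)
    (by simp only [Prod.fst_sub, Prod.snd_sub, Prod.fst_neg, Prod.snd_neg]; linarith)
  rw [mem_segment_iff_sameRay, hzx, hyz]
  exact ((SameRay.refl _).nonneg_smul_left ht).nonneg_smul_right hs

theorem setOf_max_eq_of_mem_cone {E : Type*} {H : Set E} {f g l : E → ℝ} {a b d e : ℝ} {z : E}
    (hf : ∀ x ∈ H, f x ≤ d) (hg : ∀ x ∈ H, g x ≤ e) (hz : z ∈ H) (hzf : f z = d) (hzg : g z = e)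
    (hinj : ∀ x y, f x = f y → g x = g y → x = y) (ha : 0 ≤ a) (hb : 0 ≤ b)
    (hab : a ≠ 0 ∨ b ≠ 0) (hl : ∀ x, l x = a * f x + b * g x)
    (hS : {x ∈ H | ∀ y ∈ H, l y ≤ l x}.Nontrivial) :
    {x ∈ H | ∀ y ∈ H, l y ≤ l x} = {x ∈ H | f x = d} ∨
      {x ∈ H | ∀ y ∈ H, l y ≤ l x} = {x ∈ H | g x = e} := by
  have hmax : {x ∈ H | ∀ y ∈ H, l y ≤ l x} =
      {x ∈ H | a * (d - f x) = 0 ∧ b * (e - g x) = 0} := by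
    ext x
    refine and_congr_right fun hx => ⟨fun h => ?_, fun h y hy => ?_⟩
    · have hfx := mul_nonneg ha (sub_nonneg.2 (hf x hx))
      have hgx := mul_nonneg hb (sub_nonneg.2 (hg x hx))
      have hzx := h z hz
      rw [hl, hl, hzf, hzg] at hzx
      constructor <;> linarith
    · have hfy := mul_nonneg ha (sub_nonneg.2 (hf y hy))
      have hgy := mul_nonneg hb (sub_nonneg.2 (hg y hy))
      rw [hl, hl]
      linarith
  rw [hmax] at hS ⊢
  rcases eq_or_ne a 0 with rfl | ha'
  · right
    simp only [zero_mul, mul_eq_zero, hab.resolve_left (not_not.2 rfl), false_or, true_and,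
      sub_eq_zero, eq_comm]
  rcases eq_or_ne b 0 with rfl | hb'
  · left
    simp only [zero_mul, mul_eq_zero, ha', false_or, and_true, sub_eq_zero, eq_comm]
  · obtain ⟨x, hx, y, hy, hxy⟩ := hS
    simp only [mul_eq_zero, ha', hb', false_or, sub_eq_zero, Set.mem_ofPred_eq] at hx hy
    exact absurd (hinj x y (hx.2.1.symm.trans hy.2.1) (hx.2.2.symm.trans hy.2.2)) hxy

theorem exists_nonneg_of_forall_add_three_eq_neg {f : Fin 6 → ℝ} (hf : ∀ i, f (i + 3) = -f i) :
    ∃ i, 0 ≤ f i ∧ f (i + 1) ≤ 0 := by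
  by_contra! h
  have hneg (i : Fin 6) (hi : 0 ≤ f i) : False := by
    have h3 := h _ (h _ (h i hi).le).le
    rw [show i + 1 + 1 + 1 = i + 3 by omega, hf] at h3
    linarith
  rcases le_total 0 (f 0) with h0 | h0
  · exact hneg 0 h0
  · exact hneg (0 + 3) (by rw [hf]; linarith)

variable {A g : MvPolynomial (Fin 2) ℤ} {p q : Fin 2 →₀ ℕ} {w : ℤ × ℤ} {d r : ℤ}

theorem mem_newtonPolygon {m : Fin 2 →₀ ℕ} (hm : m ∈ A.support) :
    exponentPoint m ∈ newtonPolygon A :=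
  subset_convexHull ℝ _ ⟨m, hm, rfl⟩

theorem exponentPoint_injective : Function.Injective exponentPoint := by
  intro m m' h
  simp only [exponentPoint, Prod.mk.injEq, Nat.cast_inj] at h
  exact Finsupp.ext (Fin.forall_fin_two.2 h)

theorem le_of_exponentPoint_mem_segment {m : Fin 2 →₀ ℕ} (hpq : p 0 ≤ q 0)
    (hm : exponentPoint m ∈ segment ℝ (exponentPoint p) (exponentPoint q)) : p 0 ≤ m 0 := by
  obtain ⟨a, b, -, hb, hab, hm⟩ := hm
  have h0 : a * (p 0 : ℝ) + b * q 0 = m 0 := congrArg Prod.fst hm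
  have hb' := mul_le_mul_of_nonneg_left (Nat.cast_le (α := ℝ).2 hpq) hb
  refine Nat.cast_le (α := ℝ).1 ?_
  linear_combination hb' + h0 - (p 0 : ℝ) * hab

theorem fst_eq_of_segment_eq {p' q' : Fin 2 →₀ ℕ} (hpq : p 0 ≤ q 0) (hpq' : p' 0 ≤ q' 0)
    (h : segment ℝ (exponentPoint p) (exponentPoint q) =
      segment ℝ (exponentPoint p') (exponentPoint q')) : p 0 = p' 0 :=
  le_antisymm (le_of_exponentPoint_mem_segment hpq (h ▸ left_mem_segment ℝ _ _))
    (le_of_exponentPoint_mem_segment hpq' (h ▸ left_mem_segment ℝ _ _))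

theorem weight_exponentPoint (w : ℤ × ℤ) (m : Fin 2 →₀ ℕ) :
    w.1 * (exponentPoint m).1 + w.2 * (exponentPoint m).2 = (w.1 * m 0 + w.2 * m 1 : ℤ) := by
  simp only [exponentPoint, Int.cast_add, Int.cast_mul, Int.cast_natCast]

theorem WeightLE.le_of_mem_newtonPolygon (h : WeightLE w.1 w.2 d A) {x : ℝ × ℝ}
    (hx : x ∈ newtonPolygon A) : w.1 * x.1 + w.2 * x.2 ≤ d := by
  refine convexHull_min ?_ (convex_halfSpace_le
    (((w.1 : ℝ) • LinearMap.fst ℝ ℝ ℝ + (w.2 : ℝ) • LinearMap.snd ℝ ℝ ℝ).isLinear) (d : ℝ)) hx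
  rintro _ ⟨m, hm, rfl⟩
  exact (weight_exponentPoint w m).trans_le (Int.cast_le.2 (h m hm))

/-- The points of the Newton polygon of `A` that have weight `d` when the coordinates have the
weights `w.1` and `w.2`. If `d` is the greatest weight, this is the face with outer normal `w`. -/
def newtonFace (A : MvPolynomial (Fin 2) ℤ) (w : ℤ × ℤ) (d : ℤ) : Set (ℝ × ℝ) :=
  {x ∈ newtonPolygon A | w.1 * x.1 + w.2 * x.2 = d}

theorem exponentPoint_mem_newtonFace_iff {m : Fin 2 →₀ ℕ} (hm : m ∈ A.support) :
    exponentPoint m ∈ newtonFace A w d ↔ w.1 * m 0 + w.2 * m 1 = d := by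
  rw [newtonFace, Set.mem_ofPred_eq, and_iff_right (mem_newtonPolygon hm), weight_exponentPoint,
    Int.cast_inj]

theorem weight_eq_of_exponentPoint_mem_newtonFace {m : Fin 2 →₀ ℕ}
    (hm : exponentPoint m ∈ newtonFace A w d) : w.1 * m 0 + w.2 * m 1 = d := by
  have hmd := hm.2
  rwa [weight_exponentPoint, Int.cast_inj] at hmd

theorem convex_newtonFace (A : MvPolynomial (Fin 2) ℤ) (w : ℤ × ℤ) (d : ℤ) :
    Convex ℝ (newtonFace A w d) :=
  (convex_convexHull ℝ _).inter (convex_hyperplane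
    (((w.1 : ℝ) • LinearMap.fst ℝ ℝ ℝ + (w.2 : ℝ) • LinearMap.snd ℝ ℝ ℝ).isLinear) (d : ℝ))

theorem WeightLE.isExposed_newtonFace (h : WeightLE w.1 w.2 d A) :
    IsExposed ℝ (newtonPolygon A) (newtonFace A w d) := by
  rintro ⟨x₀, hx₀, hd⟩
  refine ⟨(w.1 : ℝ) • ContinuousLinearMap.fst ℝ ℝ ℝ + (w.2 : ℝ) • ContinuousLinearMap.snd ℝ ℝ ℝ,
    Set.ext fun x => and_congr_right fun hx => ⟨fun hxd y hy => ?_, fun hxy => ?_⟩⟩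
  · exact (h.le_of_mem_newtonPolygon hy).trans_eq hxd.symm
  · exact (h.le_of_mem_newtonPolygon hx).antisymm (hd.symm.trans_le (hxy x₀ hx₀))

theorem HasSlope.det_eq_zero {r : ℤ} (h : HasSlope p q r)
    (hw : w.1 * p 0 + w.2 * p 1 = w.1 * q 0 + w.2 * q 1) : r * w.2 + w.1 = 0 := by
  have h0 : (q 0 - p 0 : ℤ) ≠ 0 := sub_ne_zero.2 (by exact_mod_cast h.1.symm)
  have h1 : (q 1 - p 1 : ℤ) = r * (q 0 - p 0) := by exact_mod_cast h.2
  refine (mul_eq_zero.1 ?_).resolve_right h0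
  linear_combination -hw - w.2 * h1

theorem IsNewtonEdge.hasSlope (h : IsNewtonEdge A p q)
    (hF : segment ℝ (exponentPoint p) (exponentPoint q) ⊆ newtonFace A w d) (hw : w.2 ≠ 0)
    (hr : r * w.2 + w.1 = 0) : HasSlope p q r := by
  have hp := weight_eq_of_exponentPoint_mem_newtonFace (hF (left_mem_segment ℝ _ _))
  have hq := weight_eq_of_exponentPoint_mem_newtonFace (hF (right_mem_segment ℝ _ _))
  have h1 : (q 1 - p 1 : ℤ) = r * (q 0 - p 0) := mul_left_cancel₀ hw (by
    linear_combination hq - hp - (q 0 - p 0 : ℤ) * hr)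
  refine ⟨fun h0 => h.1 (Finsupp.ext (Fin.forall_fin_two.2 ⟨h0, ?_⟩)), by exact_mod_cast h1⟩
  rw [h0, sub_self, mul_zero, sub_eq_zero] at h1
  exact_mod_cast h1.symm

theorem IsNewtonEdge.exists_functional (h : IsNewtonEdge A p q) :
    ∃ a b : ℝ, (a ≠ 0 ∨ b ≠ 0) ∧ segment ℝ (exponentPoint p) (exponentPoint q) =
      {x ∈ newtonPolygon A |
        ∀ y ∈ newtonPolygon A, a * y.1 + b * y.2 ≤ a * x.1 + b * x.2} := by
  obtain ⟨l, hl⟩ := h.2 ⟨_, left_mem_segment ℝ _ _⟩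
  obtain ⟨a, b, hab⟩ := exists_forall_strongDual_apply_eq l
  simp only [hab] at hl
  by_cases hne : a ≠ 0 ∨ b ≠ 0
  · exact ⟨a, b, hne, hl⟩
  obtain ⟨rfl, rfl⟩ := not_or.1 hne |>.imp not_not.1 not_not.1
  simp only [zero_mul, add_zero, le_refl, implies_true, and_true, Set.ofPred_mem_eq] at hl
  -- The polygon is the segment itself, and a functional constant on it exposes it.
  have hconst (x) (hx : x ∈ newtonPolygon A) :
      -((q 1 : ℝ) - p 1) * x.1 + ((q 0 : ℝ) - p 0) * x.2 = (q 0 : ℝ) * p 1 - q 1 * p 0 := by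
    rw [← hl] at hx
    obtain ⟨s, t, -, -, hst, rfl⟩ := hx
    simp only [exponentPoint, Prod.fst_add, Prod.snd_add, Prod.smul_fst, Prod.smul_snd,
      smul_eq_mul]
    linear_combination ((q 0 : ℝ) * p 1 - q 1 * p 0) * hst
  refine ⟨-(q 1 - p 1), q 0 - p 0, ?_, hl.trans (Set.ext fun x => ⟨fun hx => ⟨hx, fun y hy => ?_⟩,
    And.left⟩)⟩
  · by_contra! h0
    refine h.1 (Finsupp.ext (Fin.forall_fin_two.2 ⟨?_, ?_⟩))
    · exact_mod_cast (sub_eq_zero.1 h0.2).symm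
    · exact_mod_cast (sub_eq_zero.1 (neg_eq_zero.1 h0.1)).symm
  · rw [hconst x hx, hconst y hy]

open Classical in
theorem HasInitialForm.sum_edge {u v : ℤ} {f : Polynomial ℤ} (hA : HasInitialForm u v d A g)
    (hF : segment ℝ (exponentPoint p) (exponentPoint q) = newtonFace A (u, v) d)
    (hpq : p 0 ≤ q 0) (hf : aeval ![Polynomial.X, 1] g = Polynomial.X ^ p 0 * f) (r : ℤ) :
    ∑ m ∈ A.support with exponentPoint m ∈ segment ℝ (exponentPoint p) (exponentPoint q),
      Polynomial.monomial ((m 0 - p 0) / (r : ℚ).den) (coeff m A) = f := by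
  apply mul_left_cancel₀ (pow_ne_zero (p 0) Polynomial.X_ne_zero)
  rw [← hf, ← hA.sum_monomial, Finset.mul_sum]
  have hmem (m) (hm : m ∈ A.support) : exponentPoint m ∈ segment ℝ (exponentPoint p)
      (exponentPoint q) ↔ u * m 0 + v * m 1 = d := by
    rw [hF, exponentPoint_mem_newtonFace_iff hm]
  refine Finset.sum_congr (Finset.filter_congr hmem) fun m hm => ?_
  obtain ⟨hm, hmd⟩ := Finset.mem_filter.1 hm
  have h0 : p 0 ≤ m 0 := le_of_exponentPoint_mem_segment hpq ((hmem m hm).2 hmd)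
  rw [Polynomial.X_pow_mul_monomial, Rat.den_intCast, Nat.div_one, Nat.sub_add_cancel h0]

theorem HasInitialForm.isEdgePolynomial {u v : ℤ} {f : Polynomial ℤ}
    (hA : HasInitialForm u v d A g)
    (hF : segment ℝ (exponentPoint p) (exponentPoint q) = newtonFace A (u, v) d)
    (hpq : p 0 < q 0) (hf : aeval ![Polynomial.X, 1] g = Polynomial.X ^ p 0 * f)
    (hv : v ≠ 0) (hr : r * v + u = 0) : IsEdgePolynomial A r f :=
  have h : IsNewtonEdge A p q := ⟨fun h => hpq.ne (congrArg (· 0) h),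
    hF ▸ WeightLE.isExposed_newtonFace (w := (u, v)) hA.weightLE⟩
  ⟨p, q, h, h.hasSlope hF.le hv hr, hpq, (hA.sum_edge hF hpq.le hf r).symm⟩

/-- The Newton polygon of `A` is a hexagon with opposite sides parallel: its side `i`, with outer
normal `w i`, joins the vertices `z i` and `z (i + 1)`. A side may consist of a single point. -/
structure IsHexagon (A : MvPolynomial (Fin 2) ℤ) (w : Fin 6 → ℤ × ℤ) (d : Fin 6 → ℤ)
    (z : Fin 6 → Fin 2 →₀ ℕ) : Prop where
  opposite : ∀ i, w (i + 3) = -w i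
  det_pos : ∀ i, 0 < (w i).1 * (w (i + 1)).2 - (w i).2 * (w (i + 1)).1
  weightLE : ∀ i, WeightLE (w i).1 (w i).2 (d i) A
  mem_support : ∀ i, z i ∈ A.support
  weight_left : ∀ i, (w i).1 * z i 0 + (w i).2 * z i 1 = d i
  weight_right : ∀ i, (w i).1 * z (i + 1) 0 + (w i).2 * z (i + 1) 1 = d i

namespace IsHexagon

variable {w : Fin 6 → ℤ × ℤ} {d : Fin 6 → ℤ} {z : Fin 6 → Fin 2 →₀ ℕ}

theorem left_mem_newtonFace (h : IsHexagon A w d z) (i : Fin 6) :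
    exponentPoint (z i) ∈ newtonFace A (w i) (d i) :=
  (exponentPoint_mem_newtonFace_iff (h.mem_support i)).2 (h.weight_left i)

theorem right_mem_newtonFace (h : IsHexagon A w d z) (i : Fin 6) :
    exponentPoint (z (i + 1)) ∈ newtonFace A (w i) (d i) :=
  (exponentPoint_mem_newtonFace_iff (h.mem_support (i + 1))).2 (h.weight_right i)

theorem cast_det_pos (h : IsHexagon A w d z) (i : Fin 6) :
    (0 : ℝ) < (w i).1 * (w (i + 1)).2 - (w i).2 * (w (i + 1)).1 := by
  exact_mod_cast h.det_pos i

theorem newtonFace_eq_segment (h : IsHexagon A w d z) (i : Fin 6) :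
    newtonFace A (w i) (d i) = segment ℝ (exponentPoint (z i)) (exponentPoint (z (i + 1))) := by
  refine Set.Subset.antisymm (fun x hx => ?_) ((convex_newtonFace A (w i) (d i)).segment_subset
    (h.left_mem_newtonFace i) (h.right_mem_newtonFace i))
  have hdet := h.cast_det_pos (i - 1)
  have hprev := h.right_mem_newtonFace (i - 1)
  rw [sub_add_cancel] at hdet hprev
  refine mem_segment_of_det_pos (u := ((w (i - 1)).1, (w (i - 1)).2))
    (v := ((w i).1, (w i).2)) (w := ((w (i + 1)).1, (w (i + 1)).2))
    hdet (h.cast_det_pos i)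
    ((h.left_mem_newtonFace i).2.trans hx.2.symm) ((h.right_mem_newtonFace i).2.trans hx.2.symm)
    (((h.weightLE _).le_of_mem_newtonPolygon hx.1).trans_eq hprev.2.symm)
    (((h.weightLE _).le_of_mem_newtonPolygon hx.1).trans_eq (h.left_mem_newtonFace _).2.symm)

theorem exists_segment_eq_newtonFace (h : IsHexagon A w d z) (hpq : IsNewtonEdge A p q) :
    ∃ i, segment ℝ (exponentPoint p) (exponentPoint q) = newtonFace A (w i) (d i) := by
  obtain ⟨a, b, hab, hS⟩ := hpq.exists_functional
  obtain ⟨i, hi, hi'⟩ := exists_nonneg_of_forall_add_three_eq_neg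
    (f := fun i => (w i).1 * b - (w i).2 * a) fun i => by
      rw [h.opposite, Prod.fst_neg, Prod.snd_neg, Int.cast_neg, Int.cast_neg]
      ring
  have hdet := h.cast_det_pos i
  set D : ℝ := (w i).1 * (w (i + 1)).2 - (w i).2 * (w (i + 1)).1 with hD
  have hmax : {x ∈ newtonPolygon A |
      ∀ y ∈ newtonPolygon A, a * y.1 + b * y.2 ≤ a * x.1 + b * x.2}.Nontrivial :=
    hS ▸ ⟨_, left_mem_segment ℝ _ _, _, right_mem_segment ℝ _ _, exponentPoint_injective.ne hpq.1⟩
  have hcone := setOf_max_eq_of_mem_cone (l := fun x => a * x.1 + b * x.2)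
    (a := (a * (w (i + 1)).2 - b * (w (i + 1)).1) / D) (b := ((w i).1 * b - (w i).2 * a) / D)
    (fun x hx => (h.weightLE i).le_of_mem_newtonPolygon hx)
    (fun x hx => (h.weightLE (i + 1)).le_of_mem_newtonPolygon hx)
    (mem_newtonPolygon (h.mem_support (i + 1))) (h.right_mem_newtonFace i).2
    (h.left_mem_newtonFace (i + 1)).2
    (fun x y => eq_of_det_ne_zero (u := ((w i).1, (w i).2))
      (v := ((w (i + 1)).1, (w (i + 1)).2)) hdet.ne')
    (div_nonneg (by linarith) hdet.le) (div_nonneg hi hdet.le) ?_ ?_ hmax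
  · rw [hS]
    exact hcone.elim (fun hc => ⟨i, hc⟩) fun hc => ⟨i + 1, hc⟩
  · by_contra! h0
    rw [div_eq_zero_iff, or_iff_left hdet.ne', div_eq_zero_iff, or_iff_left hdet.ne'] at h0
    have ha : D * a = 0 := by linear_combination (w i).1 * h0.1 + (w (i + 1)).1 * h0.2 + a * hD
    have hb : D * b = 0 := by linear_combination (w i).2 * h0.1 + (w (i + 1)).2 * h0.2 + b * hD
    exact hab.elim (mul_ne_zero hdet.ne' · ha) (mul_ne_zero hdet.ne' · hb)
  · intro x
    field_simp
    rw [hD]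
    ring

theorem eq_or_eq_add_three (h : IsHexagon A w d z) {i k : Fin 6}
    (hik : (w i).1 * (w k).2 - (w i).2 * (w k).1 = 0) : k = i ∨ k = i + 3 := by
  have h1 := h.det_pos i
  have h2 := h.det_pos (i + 2)
  have w3 := h.opposite i
  have w4 := h.opposite (i + 1)
  have w5 := h.opposite (i + 2)
  rw [show i + 1 + 3 = i + 4 by omega] at w4
  rw [show i + 2 + 3 = i + 5 by omega] at w5
  rw [show i + 2 + 1 = i + 3 by omega, w3, Prod.fst_neg, Prod.snd_neg] at h2
  obtain ⟨t, rfl⟩ : ∃ t, k = i + t := ⟨k - i, by omega⟩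
  fin_cases t <;>
    simp only [Fin.reduceFinMk, Fin.zero_eta, Fin.mk_one, w4, w5, Prod.fst_neg, Prod.snd_neg] at *
  · exact .inl (add_zero i)
  · omega
  · linarith
  · exact .inr trivial
  · linarith
  · linarith

theorem eq_or_eq_add_three_of_hasSlope (h : IsHexagon A w d z) {i k : Fin 6} (hi : w i = (r, -1))
    (hr : HasSlope p q r)
    (hk : segment ℝ (exponentPoint p) (exponentPoint q) = newtonFace A (w k) (d k)) :
    k = i ∨ k = i + 3 := by
  have hp := weight_eq_of_exponentPoint_mem_newtonFace (hk ▸ left_mem_segment ℝ _ _)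
  have hq := weight_eq_of_exponentPoint_mem_newtonFace (hk ▸ right_mem_segment ℝ _ _)
  refine h.eq_or_eq_add_three ?_
  rw [hi]
  linear_combination hr.det_eq_zero (hp.trans hq.symm)

theorem setOf_isEdgePolynomial (h : IsHexagon A w d z) {i : Fin 6} (hi : w i = (r, -1))
    (hz : z i 0 < z (i + 1) 0) (hz' : z (i + 4) 0 < z (i + 3) 0)
    {g g' : MvPolynomial (Fin 2) ℤ} (hg : HasInitialForm (w i).1 (w i).2 (d i) A g)
    (hg' : HasInitialForm (w (i + 3)).1 (w (i + 3)).2 (d (i + 3)) A g') {f f' : Polynomial ℤ}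
    (hf : aeval ![Polynomial.X, 1] g = Polynomial.X ^ z i 0 * f)
    (hf' : aeval ![Polynomial.X, 1] g' = Polynomial.X ^ z (i + 4) 0 * f') :
    {f | IsEdgePolynomial A r f} = {f, f'} := by
  have hF := (h.newtonFace_eq_segment i).symm
  have hF' := (h.newtonFace_eq_segment (i + 3)).symm
  rw [show i + 3 + 1 = i + 4 by omega, segment_symm] at hF'
  ext f₀
  constructor
  · rintro ⟨p, q, hpq, hr, hlt, rfl⟩
    obtain ⟨k, hk⟩ := h.exists_segment_eq_newtonFace hpq
    rcases h.eq_or_eq_add_three_of_hasSlope hi hr hk with rfl | rfl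
    · rw [hg.sum_edge hk hlt.le (by rw [hf, fst_eq_of_segment_eq hlt.le hz.le (hk.trans hF.symm)])]
      exact .inl rfl
    · rw [hg'.sum_edge hk hlt.le
        (by rw [hf', fst_eq_of_segment_eq hlt.le hz'.le (hk.trans hF'.symm)])]
      exact .inr rfl
  · rintro (rfl | rfl)
    · exact hg.isEdgePolynomial hF hz hf (by simp [hi]) (by simp [hi])
    · exact hg'.isEdgePolynomial hF' hz' hf' (by simp [h.opposite, hi]) (by simp [h.opposite, hi])

end IsHexagon

end NewtonPolygon

section TwistKnotNewtonPolygon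

open MvPolynomial

/-- The exponent of the monomial `L ^ a * M ^ b`. -/
noncomputable def bidegree (a b : ℕ) : Fin 2 →₀ ℕ := Finsupp.single 0 a + Finsupp.single 1 b

@[simp] theorem bidegree_zero (a b : ℕ) : bidegree a b 0 = a := by simp [bidegree]

@[simp] theorem bidegree_one (a b : ℕ) : bidegree a b 1 = b := by simp [bidegree]

theorem monomial_bidegree (a b : ℕ) (c : ℤ) :
    monomial (bidegree a b) c = C c * X 0 ^ a * X 1 ^ b := by
  rw [bidegree, monomial_add_single, ← C_mul_X_pow_eq_monomial]

theorem aeval_monomial_bidegree (a b : ℕ) (c : ℤ) :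
    aeval ![Polynomial.X, 1] (monomial (bidegree a b) c) =
      (Polynomial.C c * Polynomial.X ^ a : Polynomial ℤ) := by
  rw [monomial_bidegree]
  simp

theorem coeff_X_sub_one_pow_self (k : ℕ) :
    ((Polynomial.X - 1 : Polynomial ℤ) ^ k).coeff k = 1 := by
  have h := (Polynomial.monic_X_sub_C (1 : ℤ)).pow k
  have hc := h.coeff_natDegree
  rwa [(Polynomial.monic_X_sub_C 1).natDegree_pow, Polynomial.natDegree_X_sub_C, mul_one,
    map_one] at hc

theorem coeff_X_sub_one_pow_zero (k : ℕ) :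
    ((Polynomial.X - 1 : Polynomial ℤ) ^ k).coeff 0 = (-1) ^ k := by
  simp [Polynomial.coeff_zero_eq_eval_zero]

theorem coeff_X_pow_mul_self (n : ℕ) (p : Polynomial ℤ) :
    (Polynomial.X ^ n * p).coeff n = p.coeff 0 := by
  simpa using Polynomial.coeff_X_pow_mul p n 0

theorem aeval_X_sub_pow (j : ℕ) : aeval ![Polynomial.X, 1]
    ((X 1 ^ 4 - X 0 * X 1 ^ 8) ^ j : MvPolynomial (Fin 2) ℤ) =
      ((1 - Polynomial.X) ^ j : Polynomial ℤ) := by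
  simp

theorem aeval_neg_X_add_pow (j : ℕ) : aeval ![Polynomial.X, 1]
    ((-X 0 + X 0 ^ 2 * X 1 ^ 4) ^ j : MvPolynomial (Fin 2) ℤ) =
      (Polynomial.X ^ j * (Polynomial.X - 1) ^ j : Polynomial ℤ) := by
  rw [← mul_pow, map_pow]
  congr 1
  simp only [map_add, map_neg, map_mul, map_pow, aeval_X, Matrix.cons_val_zero,
    Matrix.cons_val_one, one_pow]
  ring

theorem aeval_top (j b : ℕ) : aeval ![Polynomial.X, 1]
    (X 0 * X 1 ^ b * (-(X 0 * X 1 ^ 8) + X 0 ^ 2 * X 1 ^ 8) ^ j : MvPolynomial (Fin 2) ℤ) =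
      (Polynomial.X ^ (j + 1) * (Polynomial.X - 1) ^ j : Polynomial ℤ) := by
  rw [pow_succ' Polynomial.X j, mul_assoc Polynomial.X, ← mul_pow]
  simp only [map_add, map_neg, map_mul, map_pow, aeval_X, Matrix.cons_val_zero,
    Matrix.cons_val_one, one_pow, mul_one]
  ring

theorem HasInitialForm.coeff_bidegree {u v d : ℤ} {p g : MvPolynomial (Fin 2) ℤ}
    (hp : HasInitialForm u v d p g) (hv : v ≠ 0) {a b : ℕ} (h : u * a + v * b = d) :
    coeff (bidegree a b) p = (aeval ![Polynomial.X, 1] g : Polynomial ℤ).coeff a := by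
  rw [hp.coeff_eq_coeff_aeval hv (by rwa [bidegree_zero, bidegree_one]), bidegree_zero]

section Pos

variable (j : ℕ)

theorem coeff_left_of_pos :
    coeff (bidegree 0 (4 * (j + 1))) (twistKnotAPolynomial (j + 1 : ℕ)) = -1 := by
  rw [(hasInitialForm_upper_of_pos j).coeff_bidegree one_ne_zero (by push_cast; ring), map_neg,
    aeval_X_sub_pow, Polynomial.coeff_zero_eq_eval_zero]
  simp

theorem coeff_bottom_left_of_pos :
    coeff (bidegree 1 0) (twistKnotAPolynomial (j + 1 : ℕ)) = 1 := by
  rw [(hasInitialForm_bottom _).coeff_bidegree (by decide) (by simp),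
    twistAPoly_zero_right_of_pos (by positivity)]
  simp only [map_mul, map_pow, map_sub, map_one, aeval_X, Matrix.cons_val_zero]
  rw [← zero_add 1, Polynomial.coeff_X_mul, Polynomial.coeff_zero_eq_eval_zero]
  simp

theorem coeff_bottom_right_of_pos :
    coeff (bidegree (j + 1) 0) (twistKnotAPolynomial (j + 1 : ℕ)) = -(-1) ^ (j + 1) := by
  rw [(hasInitialForm_lower_of_pos j).coeff_bidegree (by decide) (by push_cast; ring), map_neg,
    aeval_neg_X_add_pow, Polynomial.coeff_neg, coeff_X_pow_mul_self, coeff_X_sub_one_pow_zero]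

theorem coeff_right_of_pos :
    coeff (bidegree (2 * (j + 1)) (4 * (j + 1))) (twistKnotAPolynomial (j + 1 : ℕ)) = -1 := by
  rw [(hasInitialForm_lower_of_pos j).coeff_bidegree (by decide) (by push_cast; ring), map_neg,
    aeval_neg_X_add_pow, two_mul, Polynomial.coeff_neg, Polynomial.coeff_X_pow_mul,
    coeff_X_sub_one_pow_self]

theorem coeff_top_right_of_pos :
    coeff (bidegree (2 * j + 1) (8 * (j + 1))) (twistKnotAPolynomial (j + 1 : ℕ)) = 1 := by
  rw [(hasInitialForm_top_of_pos j).coeff_bidegree one_ne_zero (by push_cast; ring), aeval_top,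
    show 2 * j + 1 = j + (j + 1) by ring, Polynomial.coeff_X_pow_mul, coeff_X_sub_one_pow_self]

theorem coeff_top_left_of_pos :
    coeff (bidegree (j + 1) (8 * (j + 1))) (twistKnotAPolynomial (j + 1 : ℕ)) = (-1) ^ j := by
  rw [(hasInitialForm_top_of_pos j).coeff_bidegree one_ne_zero (by push_cast; ring), aeval_top,
    coeff_X_pow_mul_self, coeff_X_sub_one_pow_zero]

theorem hasInitialForm_steep_left_of_pos :
    HasInitialForm (-4 * (j + 1)) (-1) (-4 * (j + 1)) (twistKnotAPolynomial (j + 1 : ℕ))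
      (monomial (bidegree 0 (4 * (j + 1))) (-1) + monomial (bidegree 1 0) 1) := by
  have hl := hasInitialForm_left (j + 1 : ℕ)
  rw [twistAPoly_zero_left_of_pos (by positivity), Int.natAbs_natCast,
    show (-X 1 ^ (4 * (j + 1)) : MvPolynomial (Fin 2) ℤ) =
      monomial (bidegree 0 (4 * (j + 1))) (-1) by simp [monomial_bidegree]] at hl
  have h := hl.binomial (hasInitialForm_bottom _).weightLE (s := bidegree 1 0) (k := 4 * (j + 1))
    (by norm_num) (by positivity) (by simp) (by simp) (by simp) (by simp)
  rw [coeff_left_of_pos, coeff_bottom_left_of_pos] at h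
  convert h using 1 <;> ring

theorem hasInitialForm_steep_right_of_pos :
    HasInitialForm (4 * (j + 1)) 1 (8 * (j + 1) ^ 2 + 4 * (j + 1))
      (twistKnotAPolynomial (j + 1 : ℕ)) (monomial (bidegree (2 * (j + 1)) (4 * (j + 1))) (-1) +
        monomial (bidegree (2 * j + 1) (8 * (j + 1))) 1) := by
  have hr := hasInitialForm_right_of_pos j
  rw [show (-(X 0 ^ 2 * X 1 ^ 4) ^ (j + 1) : MvPolynomial (Fin 2) ℤ) =
      monomial (bidegree (2 * (j + 1)) (4 * (j + 1))) (-1) by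
    rw [monomial_bidegree, mul_pow, ← pow_mul, ← pow_mul, map_neg, map_one]
    ring] at hr
  have h := hr.binomial (hasInitialForm_top_of_pos j).weightLE
    (s := bidegree (2 * j + 1) (8 * (j + 1))) (k := 4 * (j + 1)) (by norm_num) (by positivity)
    (by simp; omega) (by simp; omega) (by simp; omega) (by simp; omega)
  rw [coeff_right_of_pos, coeff_top_right_of_pos] at h
  convert h using 1 <;> ring

theorem isHexagon_of_pos : IsHexagon (twistKnotAPolynomial (j + 1 : ℕ))
    ![(-4 * (j + 1), -1), (0, -1), (4, -1), (4 * (j + 1), 1), (0, 1), (-4, 1)]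
    ![-4 * (j + 1), 0, (j + 1) * 4, 8 * (j + 1) ^ 2 + 4 * (j + 1), (j + 1) * 8, (j + 1) * 4]
    ![bidegree 0 (4 * (j + 1)), bidegree 1 0, bidegree (j + 1) 0,
      bidegree (2 * (j + 1)) (4 * (j + 1)), bidegree (2 * j + 1) (8 * (j + 1)),
      bidegree (j + 1) (8 * (j + 1))] where
  opposite i := by fin_cases i <;> simp
  det_pos i := by fin_cases i <;> simp <;> omega
  weightLE i := by
    fin_cases i
    exacts [(hasInitialForm_steep_left_of_pos j).weightLE, (hasInitialForm_bottom _).weightLE,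
      (hasInitialForm_lower_of_pos j).weightLE, (hasInitialForm_steep_right_of_pos j).weightLE,
      (hasInitialForm_top_of_pos j).weightLE, (hasInitialForm_upper_of_pos j).weightLE]
  mem_support i := by
    rw [mem_support_iff]
    fin_cases i
    · exact (coeff_left_of_pos j).trans_ne (by simp)
    · exact (coeff_bottom_left_of_pos j).trans_ne (by simp)
    · exact (coeff_bottom_right_of_pos j).trans_ne (by simp)
    · exact (coeff_right_of_pos j).trans_ne (by simp)
    · exact (coeff_top_right_of_pos j).trans_ne (by simp)
    · exact (coeff_top_left_of_pos j).trans_ne (by simp)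
  weight_left i := by fin_cases i <;> simp <;> linarith
  weight_right i := by fin_cases i <;> simp <;> linarith

theorem setOf_isEdgePolynomial_four_of_pos :
    {f | IsEdgePolynomial (twistKnotAPolynomial (j + 1 : ℕ)) (4 : ℤ) f} =
      {-(Polynomial.X - 1) ^ (j + 1), -(1 - Polynomial.X) ^ (j + 1)} := by
  refine (isHexagon_of_pos j).setOf_isEdgePolynomial (i := 2) rfl ?_ ?_
    (hasInitialForm_lower_of_pos j) (hasInitialForm_upper_of_pos j) ?_ ?_
  · simp
  · simp
  · simp [aeval_neg_X_add_pow]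
  · simp

end Pos

section Neg

variable (j : ℕ)

theorem coeff_bottom_left_of_neg :
    coeff (bidegree 0 0) (twistKnotAPolynomial (-(j + 1 : ℕ))) = 1 := by
  rw [(hasInitialForm_bottom _).coeff_bidegree (by decide) (by simp),
    twistAPoly_zero_right_of_neg (by simp; omega), Polynomial.coeff_zero_eq_eval_zero]
  simp

theorem coeff_bottom_right_of_neg :
    coeff (bidegree j 0) (twistKnotAPolynomial (-(j + 1 : ℕ))) = (-1) ^ j := by
  rw [(hasInitialForm_lower_of_neg j).coeff_bidegree (by decide) (by push_cast; ring),
    aeval_neg_X_add_pow, coeff_X_pow_mul_self, coeff_X_sub_one_pow_zero]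

theorem coeff_right_of_neg :
    coeff (bidegree (2 * j) (4 * j)) (twistKnotAPolynomial (-(j + 1 : ℕ))) = 1 := by
  rw [(hasInitialForm_lower_of_neg j).coeff_bidegree (by decide) (by push_cast; ring),
    aeval_neg_X_add_pow, two_mul, Polynomial.coeff_X_pow_mul, coeff_X_sub_one_pow_self]

theorem coeff_top_right_of_neg :
    coeff (bidegree (2 * j + 1) (8 * j + 6)) (twistKnotAPolynomial (-(j + 1 : ℕ))) = 1 := by
  rw [(hasInitialForm_top_of_neg j).coeff_bidegree one_ne_zero (by push_cast; ring), aeval_top,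
    show 2 * j + 1 = j + (j + 1) by ring, Polynomial.coeff_X_pow_mul, coeff_X_sub_one_pow_self]

theorem coeff_top_left_of_neg :
    coeff (bidegree (j + 1) (8 * j + 6)) (twistKnotAPolynomial (-(j + 1 : ℕ))) = (-1) ^ j := by
  rw [(hasInitialForm_top_of_neg j).coeff_bidegree one_ne_zero (by push_cast; ring), aeval_top,
    coeff_X_pow_mul_self, coeff_X_sub_one_pow_zero]

theorem coeff_left_of_neg :
    coeff (bidegree 1 (4 * j + 6)) (twistKnotAPolynomial (-(j + 1 : ℕ))) = 1 := by
  rw [(hasInitialForm_upper_of_neg j).coeff_bidegree one_ne_zero (by push_cast; ring), map_mul,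
    aeval_X_sub_pow]
  simp [Polynomial.coeff_X_mul, Polynomial.coeff_zero_eq_eval_zero]

theorem hasInitialForm_steep_right_of_neg :
    HasInitialForm (4 * j + 6) (-1) (8 * j ^ 2 + 8 * j) (twistKnotAPolynomial (-(j + 1 : ℕ)))
      (monomial (bidegree (2 * j + 1) (8 * j + 6)) 1 + monomial (bidegree (2 * j) (4 * j)) 1) := by
  have hr := hasInitialForm_right_of_neg j
  rw [show (X 0 * X 1 ^ 6 * (X 0 ^ 2 * X 1 ^ 8) ^ j : MvPolynomial (Fin 2) ℤ) =
      monomial (bidegree (2 * j + 1) (8 * j + 6)) 1 by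
    rw [monomial_bidegree, mul_pow, ← pow_mul, ← pow_mul, map_one]
    ring] at hr
  have h := hr.binomial (hasInitialForm_lower_of_neg j).weightLE
    (s := bidegree (2 * j) (4 * j)) (k := 4 * j + 2) (by norm_num) (by positivity)
    (by simp; omega) (by simp; omega) (by simp; omega) (by simp; omega)
  rw [coeff_right_of_neg, coeff_top_right_of_neg] at h
  convert h using 1 <;> ring

theorem hasInitialForm_steep_left_of_neg :
    HasInitialForm (-(4 * j + 6)) 1 0 (twistKnotAPolynomial (-(j + 1 : ℕ)))
      (monomial (bidegree 0 0) 1 + monomial (bidegree 1 (4 * j + 6)) 1) := by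
  have hl := hasInitialForm_left (-(j + 1 : ℕ))
  rw [twistAPoly_zero_left_of_neg (by simp; omega),
    show (1 : MvPolynomial (Fin 2) ℤ) = monomial (bidegree 0 0) 1 by
      simp [monomial_bidegree]] at hl
  have h := hl.binomial (hasInitialForm_upper_of_neg j).weightLE
    (s := bidegree 1 (4 * j + 6)) (k := 4 * j + 2) (by norm_num) (by positivity)
    (by simp) (by simp) (by simp; omega) (by simp; omega)
  rw [coeff_left_of_neg, coeff_bottom_left_of_neg] at h
  convert h using 1 <;> ring

theorem isHexagon_of_neg : IsHexagon (twistKnotAPolynomial (-(j + 1 : ℕ)))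
    ![(0, -1), (4, -1), (4 * j + 6, -1), (0, 1), (-4, 1), (-(4 * j + 6), 1)]
    ![0, j * 4, 8 * j ^ 2 + 8 * j, 6 + j * 8, 2 + j * 4, 0]
    ![bidegree 0 0, bidegree j 0, bidegree (2 * j) (4 * j), bidegree (2 * j + 1) (8 * j + 6),
      bidegree (j + 1) (8 * j + 6), bidegree 1 (4 * j + 6)] where
  opposite i := by fin_cases i <;> simp
  det_pos i := by fin_cases i <;> simp <;> omega
  weightLE i := by
    fin_cases i
    exacts [(hasInitialForm_bottom _).weightLE, (hasInitialForm_lower_of_neg j).weightLE,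
      (hasInitialForm_steep_right_of_neg j).weightLE, (hasInitialForm_top_of_neg j).weightLE,
      (hasInitialForm_upper_of_neg j).weightLE, (hasInitialForm_steep_left_of_neg j).weightLE]
  mem_support i := by
    rw [mem_support_iff]
    fin_cases i
    exacts [(coeff_bottom_left_of_neg j).trans_ne (by simp),
      (coeff_bottom_right_of_neg j).trans_ne (by simp), (coeff_right_of_neg j).trans_ne (by simp),
      (coeff_top_right_of_neg j).trans_ne (by simp), (coeff_top_left_of_neg j).trans_ne (by simp),
      (coeff_left_of_neg j).trans_ne (by simp)]
  weight_left i := by fin_cases i <;> simp <;> linarith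
  weight_right i := by fin_cases i <;> simp <;> linarith

variable {j} in
theorem setOf_isEdgePolynomial_four_of_neg (hj : j ≠ 0) :
    {f | IsEdgePolynomial (twistKnotAPolynomial (-(j + 1 : ℕ))) (4 : ℤ) f} =
      {(Polynomial.X - 1) ^ j, (1 - Polynomial.X) ^ j} := by
  refine (isHexagon_of_neg j).setOf_isEdgePolynomial (i := 1) rfl ?_ ?_
    (hasInitialForm_lower_of_neg j) (hasInitialForm_upper_of_neg j) ?_ ?_
  · simp
    omega
  · simp
    omega
  · simp [aeval_neg_X_add_pow]
  · simp

end Neg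

end TwistKnotNewtonPolygon

section SignOfIndex

open MvPolynomial

variable {n : ℤ} {p q : Fin 2 →₀ ℕ}

theorem exists_eq_natCast_succ_of_pos (hn : 0 < n) : ∃ j : ℕ, n = (j + 1 : ℕ) :=
  ⟨(n - 1).toNat, by omega⟩

theorem exists_eq_neg_natCast_succ_of_neg (hn : n < 0) : ∃ j : ℕ, n = -(j + 1 : ℕ) :=
  ⟨(-n - 1).toNat, by omega⟩

theorem coeff_twistKnotAPolynomial_of_pos (hn : 0 < n) :
    coeff (Finsupp.single 1 (4 * n.toNat)) (twistKnotAPolynomial n) = -1 := by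
  obtain ⟨j, rfl⟩ := exists_eq_natCast_succ_of_pos hn
  rw [← coeff_left_of_pos j, bidegree, Finsupp.single_zero, zero_add, Int.toNat_natCast]

theorem coeff_twistKnotAPolynomial_of_neg (hn : n < 0) : coeff 0 (twistKnotAPolynomial n) = 1 := by
  obtain ⟨j, rfl⟩ := exists_eq_neg_natCast_succ_of_neg hn
  rw [← coeff_bottom_left_of_neg j, bidegree, Finsupp.single_zero, Finsupp.single_zero, add_zero]

theorem exists_isUnit_coeff (hn : n ≠ 0) : ∃ m, IsUnit (coeff m (twistKnotAPolynomial n)) := by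
  rcases hn.lt_or_gt with hn | hn
  · exact ⟨_, coeff_twistKnotAPolynomial_of_neg hn ▸ isUnit_one⟩
  · exact ⟨_, coeff_twistKnotAPolynomial_of_pos hn ▸ isUnit_one.neg⟩

theorem IsNewtonEdge.hasSlope_of_pos (h : IsNewtonEdge (twistKnotAPolynomial n) p q)
    (hn : 0 < n) : HasSlope p q 0 ∨ HasSlope p q (-4 * n) ∨ HasSlope p q 4 := by
  obtain ⟨j, rfl⟩ := exists_eq_natCast_succ_of_pos hn
  suffices HasSlope p q (0 : ℤ) ∨ HasSlope p q (-4 * (j + 1) : ℤ) ∨ HasSlope p q (4 : ℤ) by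
    exact_mod_cast this
  obtain ⟨i, hi⟩ := (isHexagon_of_pos j).exists_segment_eq_newtonFace h
  have hslope (r : ℤ) := h.hasSlope (r := r) hi.le
  fin_cases i
  exacts [.inr (.inl (hslope _ (by simp) (by simp))), .inl (hslope _ (by simp) (by simp)),
    .inr (.inr (hslope _ (by simp) (by simp))), .inr (.inl (hslope _ (by simp) (by simp))),
    .inl (hslope _ (by simp) (by simp)), .inr (.inr (hslope _ (by simp) (by simp)))]

theorem setOf_isEdgePolynomial_steep_of_pos (hn : 0 < n) :
    {f | IsEdgePolynomial (twistKnotAPolynomial n) (-4 * n) f} =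
      {Polynomial.X - 1, -(Polynomial.X - 1)} := by
  obtain ⟨j, rfl⟩ := exists_eq_natCast_succ_of_pos hn
  rw [show (-4 * ((j + 1 : ℕ) : ℤ) : ℚ) = (-4 * (j + 1) : ℤ) by push_cast; ring]
  refine (isHexagon_of_pos j).setOf_isEdgePolynomial (i := 0) rfl ?_ ?_
    (hasInitialForm_steep_left_of_pos j) (hasInitialForm_steep_right_of_pos j) ?_ ?_
  · simp
  · simp
    omega
  · simp [aeval_monomial_bidegree]
    ring
  · simp [aeval_monomial_bidegree]
    ring

theorem setOf_isEdgePolynomial_four_of_pos_of_even (hn : 0 < n) (he : Even n) :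
    {f | IsEdgePolynomial (twistKnotAPolynomial n) 4 f} = {-(Polynomial.X - 1) ^ n.toNat} := by
  obtain ⟨j, rfl⟩ := exists_eq_natCast_succ_of_pos hn
  have h := setOf_isEdgePolynomial_four_of_pos j
  rw [← neg_sub Polynomial.X 1, ((Int.even_coe_nat _).1 he).neg_pow, Set.pair_eq_singleton] at h
  exact_mod_cast h

theorem setOf_isEdgePolynomial_four_of_pos_of_odd (hn : 0 < n) (ho : Odd n) :
    {f | IsEdgePolynomial (twistKnotAPolynomial n) 4 f} =
      {(Polynomial.X - 1) ^ n.toNat, -(Polynomial.X - 1) ^ n.toNat} := by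
  obtain ⟨j, rfl⟩ := exists_eq_natCast_succ_of_pos hn
  have h := setOf_isEdgePolynomial_four_of_pos j
  rw [← neg_sub Polynomial.X 1, ((Int.odd_coe_nat _).1 ho).neg_pow, neg_neg, Set.pair_comm] at h
  exact_mod_cast h

theorem IsNewtonEdge.hasSlope_of_neg (h : IsNewtonEdge (twistKnotAPolynomial n) p q)
    (hn : n < 0) : HasSlope p q 0 ∨ HasSlope p q (-4 * n + 2) ∨ HasSlope p q 4 := by
  obtain ⟨j, rfl⟩ := exists_eq_neg_natCast_succ_of_neg hn
  rw [show (-4 * (-(j + 1 : ℕ) : ℤ) + 2 : ℚ) = (4 * j + 6 : ℤ) by push_cast; ring]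
  suffices HasSlope p q (0 : ℤ) ∨ HasSlope p q (4 * j + 6 : ℤ) ∨ HasSlope p q (4 : ℤ) by
    exact_mod_cast this
  obtain ⟨i, hi⟩ := (isHexagon_of_neg j).exists_segment_eq_newtonFace h
  have hslope (r : ℤ) := h.hasSlope (r := r) hi.le
  fin_cases i
  exacts [.inl (hslope _ (by simp) (by simp)), .inr (.inr (hslope _ (by simp) (by simp))),
    .inr (.inl (hslope _ (by simp) (by simp))), .inl (hslope _ (by simp) (by simp)),
    .inr (.inr (hslope _ (by simp) (by simp))), .inr (.inl (hslope _ (by simp) (by simp)))]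

theorem IsNewtonEdge.hasSlope_of_eq_neg_one (h : IsNewtonEdge (twistKnotAPolynomial n) p q)
    (hn : n = -1) : HasSlope p q (-4 * n + 2) := by
  subst hn
  rw [show (-4 * (-1 : ℤ) + 2 : ℚ) = (6 : ℤ) by norm_num]
  have hle : WeightLE 6 (-1) 0 (twistKnotAPolynomial (-1)) := by
    simpa using (hasInitialForm_steep_right_of_neg 0).weightLE
  have hge : WeightLE (-6) 1 0 (twistKnotAPolynomial (-1)) := by
    simpa using (hasInitialForm_steep_left_of_neg 0).weightLE
  have hmem (x) (hx : x ∈ newtonPolygon (twistKnotAPolynomial (-1))) :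
      x ∈ newtonFace (twistKnotAPolynomial (-1)) (6, -1) 0 := by
    have h₁ := hle.le_of_mem_newtonPolygon (w := (6, -1)) hx
    have h₂ := hge.le_of_mem_newtonPolygon (w := (-6, 1)) hx
    push_cast at h₁ h₂
    exact ⟨hx, by push_cast; linarith⟩
  exact h.hasSlope (fun x hx => hmem x (h.2.subset hx)) (by decide) (by decide)

theorem setOf_isEdgePolynomial_steep_of_neg (hn : n < 0) :
    {f | IsEdgePolynomial (twistKnotAPolynomial n) (-4 * n + 2) f} = {Polynomial.X + 1} := by
  obtain ⟨j, rfl⟩ := exists_eq_neg_natCast_succ_of_neg hn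
  rw [show (-4 * (-(j + 1 : ℕ) : ℤ) + 2 : ℚ) = (4 * j + 6 : ℤ) by push_cast; ring]
  rw [← Set.pair_eq_singleton]
  refine (isHexagon_of_neg j).setOf_isEdgePolynomial (i := 2) rfl ?_ ?_
    (hasInitialForm_steep_right_of_neg j) (hasInitialForm_steep_left_of_neg j) ?_ ?_
  · simp
  · simp
  · simp [aeval_monomial_bidegree]
    ring
  · simp [aeval_monomial_bidegree]
    ring

theorem setOf_isEdgePolynomial_four_of_neg_of_even (hn : n < -1) (he : Even n) :
    {f | IsEdgePolynomial (twistKnotAPolynomial n) 4 f} =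
      {(Polynomial.X - 1) ^ (-n - 1).toNat, -(Polynomial.X - 1) ^ (-n - 1).toNat} := by
  obtain ⟨j, rfl⟩ := exists_eq_neg_natCast_succ_of_neg (hn.trans neg_one_lt_zero)
  have ho : Odd j := by grind
  have h := setOf_isEdgePolynomial_four_of_neg (j := j) (by omega)
  rw [← neg_sub Polynomial.X 1, ho.neg_pow] at h
  rw [show (-(-(j + 1 : ℕ) : ℤ) - 1).toNat = j by omega]
  exact_mod_cast h

theorem setOf_isEdgePolynomial_four_of_neg_of_odd (hn : n < -1) (ho : Odd n) :
    {f | IsEdgePolynomial (twistKnotAPolynomial n) 4 f} =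
      {(Polynomial.X - 1) ^ (-n - 1).toNat} := by
  obtain ⟨j, rfl⟩ := exists_eq_neg_natCast_succ_of_neg (hn.trans neg_one_lt_zero)
  have he : Even j := by grind
  have h := setOf_isEdgePolynomial_four_of_neg (j := j) (by omega)
  rw [← neg_sub Polynomial.X 1, he.neg_pow, Set.pair_eq_singleton] at h
  rw [show (-(-(j + 1 : ℕ) : ℤ) - 1).toNat = j by omega]
  exact_mod_cast h

end SignOfIndex

theorem theorem1p4 (n : ℤ) (hn : n ≠ 0) :
    ∃ A : MvPolynomial (Fin 2) ℤ,
      (twistKnot n).IsAPolynomial A ∧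
      (∀ B, (twistKnot n).IsAPolynomial B → B = A ∨ B = -A) ∧
      (0 < n →
        MvPolynomial.coeff (Finsupp.single 1 (4 * n.toNat)) A = -1 ∧
        (∀ p q, IsNewtonEdge A p q →
          HasSlope p q 0 ∨ HasSlope p q (-4 * n) ∨ HasSlope p q 4) ∧
        {f | IsEdgePolynomial A (-4 * n) f} = {Polynomial.X - 1, -(Polynomial.X - 1)} ∧
        (Even n → {f | IsEdgePolynomial A 4 f} = {-(Polynomial.X - 1) ^ n.toNat}) ∧
        (Odd n → {f | IsEdgePolynomial A 4 f} = {(Polynomial.X - 1) ^ n.toNat, -(Polynomial.X - 1) ^ n.toNat})) ∧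
      (n < 0 →
        MvPolynomial.coeff 0 A = 1 ∧
        (∀ p q, IsNewtonEdge A p q →
          HasSlope p q 0 ∨ HasSlope p q (-4 * n + 2) ∨ HasSlope p q 4) ∧
        {f | IsEdgePolynomial A (-4 * n + 2) f} = {Polynomial.X + 1} ∧
        (n = -1 → ∀ p q, IsNewtonEdge A p q → HasSlope p q (-4 * n + 2)) ∧
        (n < -1 → Even n → {f | IsEdgePolynomial A 4 f} =
          {(Polynomial.X - 1) ^ (-n - 1).toNat, -(Polynomial.X - 1) ^ (-n - 1).toNat}) ∧
        (n < -1 → Odd n → {f | IsEdgePolynomial A 4 f} = {(Polynomial.X - 1) ^ (-n - 1).toNat})) := by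
  obtain ⟨m, hm⟩ := exists_isUnit_coeff hn
  have hA := isAPolynomial_twistKnotAPolynomial hn hm
  refine ⟨twistKnotAPolynomial n, hA, fun B hB => hA.eq_or_eq_neg hB hm, fun hpos => ?_,
    fun hneg => ?_⟩
  · exact ⟨coeff_twistKnotAPolynomial_of_pos hpos, fun p q h => h.hasSlope_of_pos hpos,
      setOf_isEdgePolynomial_steep_of_pos hpos,
      setOf_isEdgePolynomial_four_of_pos_of_even hpos,
      setOf_isEdgePolynomial_four_of_pos_of_odd hpos⟩
  · exact ⟨coeff_twistKnotAPolynomial_of_neg hneg, fun p q h => h.hasSlope_of_neg hneg,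
      setOf_isEdgePolynomial_steep_of_neg hneg,
      fun h1 p q h => h.hasSlope_of_eq_neg_one h1,
      setOf_isEdgePolynomial_four_of_neg_of_even,
      setOf_isEdgePolynomial_four_of_neg_of_odd⟩
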